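/- **Proposition (quantum metric $g_1$ and $\nabla_Q$ on $\mathbb{CP}^n$).** Let $\mathbb{CP}^n=S^{2n+1}/U(1)$ carry the Fubini–Study metric $g$ induced by twice the Euclidean metric. In each standard affine chart $\mathbb C^n$, with coordinates $z^i=x^i+\mathrm i x^{i+n}$ and $t^2=1/(1+|\vec z|^2)$, write $g_{i\bar j}=t^2\delta_{ij}-t^4\bar z^iz^j$ (so $g=g_{i\bar j}(dz^i\otimes d\bar z^j+d\bar z^j\otimes dz^i)$), $\tau=\tau_+=t^2\sum_i\bar z^i\,dz^i$, $\bar\tau=\tau_-=t^2\sum_i z^i\,d\bar z^i$, $z^i_+=z^i$, $z^i_-=\bar z^i$. Let $J$ be the complex structure, $\omega_{ab}=g(\partial_a,J\partial_b)$, $\omega^{ab}=g^{ac}g^{bd}\omega_{cd}$, $\varpi=\omega_{ab}\,dx^b\wedge dx^a=2\mathrm i\,g_{i\bar j}\,dz^i\wedge d\bar z^j$, and let $\nabla$ be the Levi-Civita connection, $\nabla_jdx^i=-\Gamma^i_{jk}dx^k$, with curvature $[\nabla_a,\nabla_b]dx^c=-R^c{}_{dab}dx^d$. Work to first order in a formal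 parameter $\lambda$ ($\lambda^2=0$). Let $A_\lambda$ be the smooth complex functions with $a\bullet b=ab+\frac\lambda2\omega^{ij}\partial_ia\,\partial_jb$, let $\Omega^1$ be the one-forms with the bimodule structure $a\bullet\xi=a\xi+\frac\lambda2\omega^{ij}\partial_ia\,\nabla_j\xi$, $\xi\bullet a=a\xi-\frac\lambda2\omega^{ij}\partial_ia\,\nabla_j\xi$, let $\otimes_1$ be the tensor product over $A_\lambda$, let $d$ be undeformed, and on one-forms let $$\xi\wedge_1\eta=\xi\wedge\eta+\tfrac\lambda2\omega^{ij}\nabla_i\xi\wedge\nabla_j\eta+\lambda H^{ij}\xi_i\eta_j,\qquad H^{ij}=-\tfrac12\omega^{is}R^j{}_{nms}\,dx^m\wedge dx^n.$$ Let $\mathcal R=g_{ij}H^{ij}$ be the generalised Ricci 2-form, with components $\mathcal R_{mn}=\mathcal R(\partial_m,\partial_n)$, and define the quantum metric $$g_1=g_{ij}dx^i\otimes_1dx^j+\tfrac\lambda2\omega^{ij}g_{pm}\Gamma^p_{iq}\Gamma^q_{jn}\,dx^m\otimes_1dx^n-\tfrac\lambda2\mathcal R_{mn}\,dx^m\otimes_1dx^n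 .$$ Let $\nabla_Q$ be the quantisation of $\nabla$, i.e. the bimodule connection with $$\nabla_Qdx^i=-\Big(\Gamma^i_{mn}+\tfrac\lambda2\omega^{sj}\big(\partial_s\Gamma^i_{mk}\,\Gamma^k_{jn}-\Gamma^i_{kt}\Gamma^k_{sm}\Gamma^t_{jn}-\Gamma^i_{jk}R^k{}_{nms}\big)\Big)dx^m\otimes_1dx^n .$$ (A bimodule connection is a map $D:\Omega^1\to\Omega^1\otimes_1\Omega^1$ with a bimodule map $\sigma$ such that $D(a\bullet\xi)=a\bullet D\xi+da\otimes_1\xi$ and $D(\xi\bullet a)=(D\xi)\bullet a+\sigma(\xi\otimes_1da)$; it acts on $\Omega^1\otimes_1\Omega^1$ by $D(\xi\otimes_1\eta)=D\xi\otimes_1\eta+(\sigma\otimes\mathrm{id})(\xi\otimes_1D\eta)$.) Then: 1. With $\gamma=t^2d\bar z^i\otimes_1dz^i-\bar\tau\otimes_1\tau$, $\bar\gamma=t^2dz^i\otimes_1d\bar z^i-\tau\otimes_1\bar\tau$ and $\widetilde\varpi=\mathrm i(\bar\gamma-\gamma)$, $$g_1=g_{i\bar j}\,dz^i\otimes_1d\bar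 z^j+g_{i\bar j}\,d\bar z^j\otimes_1dz^i-\tfrac\lambda2(n+1)\,\widetilde\varpi ,\qquad \wedge_1(g_1)=0 .$$ 2. $\mathcal R=\tfrac12(n+1)\varpi$, and $\mathcal R$ is covariantly constant. 3. $\nabla_Q$ exists and is unique, and it is the quantum Levi-Civita connection: it is the only bimodule connection $D$ that is quantum torsion free ($\wedge_1D\xi=d\xi$ for all $\xi$) and quantum metric compatible ($Dg_1=0$). Moreover $$\nabla_Q\,dz^i_\pm=(1\pm\mathrm i\lambda)\big(\tau_\pm\otimes_1dz^i_\pm+dz^i_\pm\otimes_1\tau_\pm\big).$$ -/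

import Mathlib

open scoped TensorProduct RightActions ContDiff
open Complex (I)

noncomputable section

set_option linter.unusedSectionVars false

/-! ### Tensor products of bimodules over a noncommutative ring -/

section Balanced

variable (A : Type*) [Ring A]
variable (M : Type*) [AddCommGroup M] [Module A M] [Module Aᵐᵒᵖ M] [SMulCommClass A Aᵐᵒᵖ M]
variable (N : Type*) [AddCommGroup N] [Module A N] [Module Aᵐᵒᵖ N] [SMulCommClass A Aᵐᵒᵖ N]

/-- The subgroup generated by the relations `(m • a) ⊗ n = m ⊗ (a • n)`. -/
def balancedRel : AddSubgroup (M ⊗[ℤ] N) :=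
  AddSubgroup.closure
    {t | ∃ (m : M) (a : A) (n : N), t = (m <• a) ⊗ₜ[ℤ] n - m ⊗ₜ[ℤ] (a • n)}

/-- The tensor product `M ⊗_A N` of two `A`-bimodules, for a ring `A` that need not be
commutative. -/
def BTensor : Type _ := (M ⊗[ℤ] N) ⧸ balancedRel A M N

instance : AddCommGroup (BTensor A M N) :=
  inferInstanceAs (AddCommGroup ((M ⊗[ℤ] N) ⧸ balancedRel A M N))

namespace BTensor

variable {M N}

/-- The projection `M ⊗_ℤ N → M ⊗_A N`. -/
def proj : M ⊗[ℤ] N →+ BTensor A M N := QuotientAddGroup.mk' (balancedRel A M N)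

/-- The elementary tensor `m ⊗_A n`. -/
def tmul (m : M) (n : N) : BTensor A M N := proj A (m ⊗ₜ[ℤ] n)

theorem add_tmul (m m' : M) (n : N) : tmul A (m + m') n = tmul A m n + tmul A m' n := by
  simp only [tmul, TensorProduct.add_tmul, map_add]

theorem tmul_add (m : M) (n n' : N) : tmul A m (n + n') = tmul A m n + tmul A m n' := by
  simp only [tmul, TensorProduct.tmul_add, map_add]

theorem smul_tmul (m : M) (a : A) (n : N) : tmul A (m <• a) n = tmul A m (a • n) := by
  have h : (m <• a) ⊗ₜ[ℤ] n - m ⊗ₜ[ℤ] (a • n) ∈ balancedRel A M N :=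
    AddSubgroup.subset_closure ⟨m, a, n, rfl⟩
  rw [← sub_eq_zero, tmul, tmul, ← map_sub]
  exact (QuotientAddGroup.eq_zero_iff _).2 h

/-- Elementary tensors as a biadditive map. -/
def tmulHom : M →+ N →+ BTensor A M N :=
  AddMonoidHom.mk' (fun m => AddMonoidHom.mk' (fun n => tmul A m n) (tmul_add A m))
    (fun m m' => by ext n; exact add_tmul A m m' n)

theorem induction {P : BTensor A M N → Prop} (h0 : P 0) (ht : ∀ m n, P (tmul A m n))
    (ha : ∀ x y, P x → P y → P (x + y)) (x : BTensor A M N) : P x := by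
  obtain ⟨y, rfl⟩ := QuotientAddGroup.mk'_surjective (balancedRel A M N) x
  change P (proj A y)
  induction y using TensorProduct.induction_on with
  | zero => rw [map_zero]; exact h0
  | tmul m n => exact ht m n
  | add x y hx hy => rw [map_add]; exact ha _ _ hx hy

theorem hom_ext {P : Type*} [AddCommGroup P] {f f' : BTensor A M N →+ P}
    (h : ∀ m n, f (tmul A m n) = f' (tmul A m n)) : f = f' := by
  ext x
  induction x using BTensor.induction with
  | h0 => rw [map_zero, map_zero]
  | ht m n => exact h m n
  | ha x y hx hy => rw [map_add, map_add, hx, hy]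

variable {A}

/-- A biadditive map `f` with `f (m • a) n = f m (a • n)` descends to `M ⊗_A N`. -/
def lift {P : Type*} [AddCommGroup P] (f : M →+ N →+ P)
    (h : ∀ m (a : A) n, f (m <• a) n = f m (a • n)) : BTensor A M N →+ P :=
  QuotientAddGroup.lift (balancedRel A M N)
    (TensorProduct.liftAddHom f (fun r m n => by simp)) (by
      rw [balancedRel, AddSubgroup.closure_le]
      rintro _ ⟨m, a, n, rfl⟩
      simp [h])

theorem lift_tmul {P : Type*} [AddCommGroup P] (f : M →+ N →+ P)
    (h : ∀ m (a : A) n, f (m <• a) n = f m (a • n)) (m : M) (n : N) :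
    lift f h (tmul A m n) = f m n := rfl

/-- `f ⊗ id` for an additive map `f` that is linear for the right action. -/
def mapLeft {M' : Type*} [AddCommGroup M'] [Module A M'] [Module Aᵐᵒᵖ M']
    [SMulCommClass A Aᵐᵒᵖ M'] (f : M →+ M') (hf : ∀ m (a : A), f (m <• a) = f m <• a) :
    BTensor A M N →+ BTensor A M' N :=
  lift ((tmulHom A).comp f) (fun m a n => by
    change tmul A (f (m <• a)) n = tmul A (f m) (a • n)
    rw [hf, smul_tmul])

/-- `id ⊗ f` for an additive map `f` that is linear for the left action. -/
def mapRight {N' : Type*} [AddCommGroup N'] [Module A N'] [Module Aᵐᵒᵖ N']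
    [SMulCommClass A Aᵐᵒᵖ N'] (f : N →+ N') (hf : ∀ (a : A) n, f (a • n) = a • f n) :
    BTensor A M N →+ BTensor A M N' :=
  lift (((tmulHom A).flip.comp f).flip) (fun m a n => by
    change tmul A (m <• a) (f n) = tmul A m (f (a • n))
    rw [hf, smul_tmul])

/-- The left action `a • (m ⊗ n) = (a • m) ⊗ n`. -/
def leftAct : A →+* AddMonoid.End (BTensor A M N) where
  toFun a := mapLeft (DistribSMul.toAddMonoidHom M a) (fun m b => by
    simp [smul_comm])
  map_one' := hom_ext A fun m n => by
    change tmul A ((1 : A) • m) n = tmul A m n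
    rw [one_smul]
  map_mul' a b := hom_ext A fun m n => by
    change tmul A ((a * b) • m) n = tmul A (a • b • m) n
    rw [mul_smul]
  map_zero' := hom_ext A fun m n => by
    change tmul A ((0 : A) • m) n = 0
    rw [zero_smul]; exact DFunLike.congr_fun (map_zero (tmulHom A)) n
  map_add' a b := hom_ext A fun m n => by
    change tmul A ((a + b) • m) n = tmul A (a • m) n + tmul A (b • m) n
    rw [add_smul, add_tmul]

/-- The right action `(m ⊗ n) • a = m ⊗ (n • a)`. -/
def rightAct : Aᵐᵒᵖ →+* AddMonoid.End (BTensor A M N) where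
  toFun a := mapRight (DistribSMul.toAddMonoidHom N a) (fun b n => by
    simp [smul_comm])
  map_one' := hom_ext A fun m n => by
    change tmul A m ((1 : Aᵐᵒᵖ) • n) = tmul A m n
    rw [one_smul]
  map_mul' a b := hom_ext A fun m n => by
    change tmul A m ((a * b) • n) = tmul A m (a • b • n)
    rw [mul_smul]
  map_zero' := hom_ext A fun m n => by
    change tmul A m ((0 : Aᵐᵒᵖ) • n) = 0
    rw [zero_smul]; exact map_zero (tmulHom A m)
  map_add' a b := hom_ext A fun m n => by
    change tmul A m ((a + b) • n) = tmul A m (a • n) + tmul A m (b • n)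
    rw [add_smul, tmul_add]

instance : Module A (BTensor A M N) :=
  Module.compHom (BTensor A M N) (leftAct (A := A) (M := M) (N := N))

instance : Module Aᵐᵒᵖ (BTensor A M N) :=
  Module.compHom (BTensor A M N) (rightAct (A := A) (M := M) (N := N))

theorem left_smul_tmul (a : A) (m : M) (n : N) : a • tmul A m n = tmul A (a • m) n := rfl

theorem right_smul_tmul (a : A) (m : M) (n : N) : tmul A m n <• a = tmul A m (n <• a) := rfl

instance : SMulCommClass A Aᵐᵒᵖ (BTensor A M N) where
  smul_comm a b x := by
    induction x using BTensor.induction with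
    | h0 => simp only [smul_zero]
    | ht m n => rfl
    | ha x y hx hy => simp only [smul_add, hx, hy]

/-- The map `X ↦ ξ ⊗ X` from `M ⊗_A N` to `(P ⊗_A M) ⊗_A N`, for a fixed `ξ`. -/
def prepend {P : Type*} [AddCommGroup P] [Module A P] [Module Aᵐᵒᵖ P] [SMulCommClass A Aᵐᵒᵖ P]
    (ξ : P) : BTensor A M N →+ BTensor A (BTensor A P M) N :=
  lift ((tmulHom A).comp (tmulHom A ξ)) (fun m a n => by
    change tmul A (tmul A ξ (m <• a)) n = tmul A (tmul A ξ m) (a • n)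
    rw [← right_smul_tmul, smul_tmul])

end BTensor

/-! ### Bimodule connections -/

/-- A bimodule connection on the bimodule `Ω` of one-forms of a first order differential
calculus `d : A → Ω`: a left connection `∇ : Ω → Ω ⊗_A Ω` and a bimodule map `σ` (the generalised
braiding) with `∇ (ξ a) = (∇ ξ) a + σ (ξ ⊗ d a)`. -/
@[ext]
structure BimoduleConnection {A Ω : Type*} [Ring A] [AddCommGroup Ω] [Module A Ω] [Module Aᵐᵒᵖ Ω]
    [SMulCommClass A Aᵐᵒᵖ Ω] (d : A →+ Ω) where
  nabla : Ω →+ BTensor A Ω Ω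
  braiding : BTensor A Ω Ω →+ BTensor A Ω Ω
  braiding_left : ∀ (a : A) (X : BTensor A Ω Ω), braiding (a • X) = a • braiding X
  braiding_right : ∀ (X : BTensor A Ω Ω) (a : A), braiding (X <• a) = braiding X <• a
  leibniz_left : ∀ (a : A) (ξ : Ω), nabla (a • ξ) = a • nabla ξ + BTensor.tmul A (d a) ξ
  leibniz_right : ∀ (ξ : Ω) (a : A),
    nabla (ξ <• a) = nabla ξ <• a + braiding (BTensor.tmul A ξ (d a))

/-- The induced map `Ω ⊗_A Ω → Ω ⊗_A Ω ⊗_A Ω`,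
`∇ (ξ ⊗ η) = ∇ ξ ⊗ η + (σ ⊗ id) (ξ ⊗ ∇ η)`. -/
def BimoduleConnection.tensorNabla {A Ω : Type*} [Ring A] [AddCommGroup Ω] [Module A Ω]
    [Module Aᵐᵒᵖ Ω] [SMulCommClass A Aᵐᵒᵖ Ω] {d : A →+ Ω} (D : BimoduleConnection d) :
    BTensor A Ω Ω →+ BTensor A (BTensor A Ω Ω) Ω :=
  BTensor.lift
    (AddMonoidHom.mk' (fun ξ => AddMonoidHom.mk' (fun η =>
        BTensor.tmul A (D.nabla ξ) η
          + BTensor.mapLeft D.braiding D.braiding_right (BTensor.prepend ξ (D.nabla η)))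
        (fun η η' => by simp only [map_add, BTensor.tmul_add]; abel))
      (fun ξ ξ' => by
        ext η
        have h : ∀ X : BTensor A Ω Ω, BTensor.prepend (ξ + ξ') X
            = BTensor.prepend ξ X + BTensor.prepend ξ' X := fun X => by
          induction X using BTensor.induction with
          | h0 => simp
          | ht m n =>
            change BTensor.tmul A (BTensor.tmul A (ξ + ξ') m) n
              = BTensor.tmul A (BTensor.tmul A ξ m) n + BTensor.tmul A (BTensor.tmul A ξ' m) n
            rw [BTensor.add_tmul, BTensor.add_tmul]
          | ha x y hx hy => rw [map_add, map_add, map_add, hx, hy]; abel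
        simp only [AddMonoidHom.mk'_apply, AddMonoidHom.add_apply, map_add, BTensor.add_tmul, h]
        abel))
    (fun ξ a η => by
      have h : ∀ X : BTensor A Ω Ω, BTensor.prepend (ξ <• a) X
          = BTensor.prepend ξ (a • X) := fun X => by
        induction X using BTensor.induction with
        | h0 => simp
        | ht m n =>
          change BTensor.tmul A (BTensor.tmul A (ξ <• a) m) n
            = BTensor.tmul A (BTensor.tmul A ξ (a • m)) n
          rw [BTensor.smul_tmul]
        | ha x y hx hy => rw [smul_add, map_add, map_add, hx, hy]
      have h2 : BTensor.mapLeft D.braiding D.braiding_right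
          (BTensor.prepend ξ (BTensor.tmul A (d a) η))
          = BTensor.tmul A (D.braiding (BTensor.tmul A ξ (d a))) η := rfl
      simp only [AddMonoidHom.mk'_apply, D.leibniz_right, D.leibniz_left, map_add,
        BTensor.add_tmul, h, h2, BTensor.smul_tmul]
      abel)

end Balanced

/-! ### Semiquantisation of a coordinate patch

`A` is the algebra of complex functions on the patch and `ι` labels the real coordinates `x^a`.
Expansions in the deformation parameter `λ` with `λ ^ 2 = 0` are pairs `(c₀, c₁) = c₀ + λ c₁`. -/

/-- A coordinate patch with coordinate derivatives `∂_a`, an antisymmetric bivector `ω^{ab}` and a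
linear connection `∇_j dx^i = - Γ^i_{jk} dx^k`. -/
structure PatchData (A ι : Type*) [CommRing A] [Algebra ℂ A] where
  pd : ι → Derivation ℂ A A
  poisson : ι → ι → A
  poisson_antisymm : ∀ i j, poisson i j = - poisson j i
  Γ : ι → ι → ι → A

section Semi

variable {A ι : Type*} [CommRing A] [Algebra ℂ A] [Fintype ι] [DecidableEq ι]

namespace PatchData

variable (S : PatchData A ι)

/-- `{a, b} = ω^{ij} ∂_i a ∂_j b`. -/
def bracket (a b : A) : A := ∑ i, ∑ j, S.poisson i j * S.pd i a * S.pd j b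

/-- `(∇_j ξ)_m = ∂_j ξ_m - Γ^k_{jm} ξ_k`, for a one-form `ξ = ξ_m dx^m`. -/
def cov (j : ι) (ξ : ι → A) : ι → A := fun m => S.pd j (ξ m) - ∑ k, S.Γ k j m * ξ k

/-- The components `(∇_s X)_{ab}` of the covariant derivative of a covariant two-tensor. -/
def cov₂ (s : ι) (X : ι → ι → A) : ι → ι → A := fun a b =>
  S.pd s (X a b) - ∑ k, S.Γ k s a * X k b - ∑ k, S.Γ k s b * X a k

/-- `∇_{\hat a} ξ = ω^{ij} ∂_i a ∇_j ξ`. -/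
def covHam (a : A) (ξ : ι → A) : ι → A := fun m => ∑ i, ∑ j, S.poisson i j * S.pd i a * S.cov j ξ m

/-- The curvature `R^c_{dab}`, in the convention `[∇_a, ∇_b] dx^c = - R^c_{dab} dx^d`. -/
def curv (c d a b : ι) : A :=
  S.pd a (S.Γ c b d) - S.pd b (S.Γ c a d)
    + ∑ e, (S.Γ c a e * S.Γ e b d - S.Γ c b e * S.Γ e a d)

/-- The torsion `T^i_{jk} = Γ^i_{jk} - Γ^i_{kj}`. -/
def torsion (i j k : ι) : A := S.Γ i j k - S.Γ i k j

/-- The covariant derivative `T^j_{nm;s}` of the torsion. -/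
def covTorsion (j n m s : ι) : A :=
  S.pd s (S.torsion j n m) + ∑ k, S.Γ j s k * S.torsion k n m
    - ∑ k, S.Γ k s n * S.torsion j k m - ∑ k, S.Γ k s m * S.torsion j n k

/-- The product `ξ ∧ η` of one-forms. A two-form is given by its components on `(∂_a, ∂_b)`. -/
def wedge (ξ η : ι → A) : ι → ι → A := fun a b => ξ a * η b - ξ b * η a

/-- The two-forms `H^{ij} = (1/4) ω^{is} (T^j_{nm;s} - 2 R^j_{nms}) dx^m ∧ dx^n`. -/
def H (i j : ι) : ι → ι → A :=
  ∑ m, ∑ n, ∑ s, ((1 / 4 : ℂ) • (S.poisson i s * (S.covTorsion j n m s - 2 * S.curv j n m s))) •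
    wedge (Pi.single m (1 : A)) (Pi.single n (1 : A))

theorem cov_add (j : ι) (ξ η : ι → A) : S.cov j (ξ + η) = S.cov j ξ + S.cov j η := by
  ext m
  simp only [cov, Pi.add_apply, map_add, mul_add, Finset.sum_add_distrib]
  ring

theorem cov_smul (j : ι) (a : A) (ξ : ι → A) :
    S.cov j (a • ξ) = S.pd j a • ξ + a • S.cov j ξ := by
  ext m
  have h : ∑ k, S.Γ k j m * (a * ξ k) = a * ∑ k, S.Γ k j m * ξ k := by
    rw [Finset.mul_sum]; exact Finset.sum_congr rfl fun k _ => by ring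
  simp only [cov, Pi.add_apply, Pi.smul_apply, smul_eq_mul, Derivation.leibniz, h]
  ring

theorem bracket_antisymm (a b : A) : S.bracket a b = - S.bracket b a := by
  rw [bracket, bracket, Finset.sum_comm, ← Finset.sum_neg_distrib]
  refine Finset.sum_congr rfl fun j _ => ?_
  rw [← Finset.sum_neg_distrib]
  refine Finset.sum_congr rfl fun i _ => ?_
  rw [S.poisson_antisymm]; ring

theorem bracket_add_right (a b c : A) :
    S.bracket a (b + c) = S.bracket a b + S.bracket a c := by
  simp only [bracket, map_add, mul_add, Finset.sum_add_distrib]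

theorem bracket_add_left (a b c : A) :
    S.bracket (a + b) c = S.bracket a c + S.bracket b c := by
  simp only [bracket, map_add, mul_add, add_mul, Finset.sum_add_distrib]

theorem bracket_mul_right (a b c : A) :
    S.bracket a (b * c) = S.bracket a b * c + b * S.bracket a c := by
  simp only [bracket, Finset.sum_mul, Finset.mul_sum, ← Finset.sum_add_distrib,
    Derivation.leibniz, smul_eq_mul]
  exact Finset.sum_congr rfl fun i _ => Finset.sum_congr rfl fun j _ => by ring

theorem bracket_mul_left (a b c : A) :
    S.bracket (a * b) c = S.bracket a c * b + a * S.bracket b c := by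
  simp only [bracket, Finset.sum_mul, Finset.mul_sum, ← Finset.sum_add_distrib,
    Derivation.leibniz, smul_eq_mul]
  exact Finset.sum_congr rfl fun i _ => Finset.sum_congr rfl fun j _ => by ring

theorem bracket_one_left (a : A) : S.bracket 1 a = 0 := by simp [bracket]

theorem bracket_one_right (a : A) : S.bracket a 1 = 0 := by simp [bracket]

theorem bracket_zero_left (a : A) : S.bracket 0 a = 0 := by simp [bracket]

theorem bracket_zero_right (a : A) : S.bracket a 0 = 0 := by simp [bracket]

theorem covHam_add_left (a b : A) (ξ : ι → A) :
    S.covHam (a + b) ξ = S.covHam a ξ + S.covHam b ξ := by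
  ext m
  simp only [covHam, Pi.add_apply, map_add, mul_add, add_mul, Finset.sum_add_distrib]

theorem covHam_add_right (a : A) (ξ η : ι → A) :
    S.covHam a (ξ + η) = S.covHam a ξ + S.covHam a η := by
  ext m
  simp only [covHam, cov_add, Pi.add_apply, mul_add, Finset.sum_add_distrib]

theorem covHam_zero_left (ξ : ι → A) : S.covHam 0 ξ = 0 := by
  ext m; simp [covHam]

theorem covHam_one_left (ξ : ι → A) : S.covHam 1 ξ = 0 := by
  ext m; simp [covHam]

theorem covHam_zero_right (a : A) : S.covHam a 0 = 0 := by
  ext m; simp [covHam, cov]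

theorem covHam_mul (a b : A) (ξ : ι → A) :
    S.covHam (a * b) ξ = a • S.covHam b ξ + b • S.covHam a ξ := by
  ext m
  simp only [covHam, Pi.add_apply, Pi.smul_apply, smul_eq_mul, Finset.mul_sum,
    ← Finset.sum_add_distrib, Derivation.leibniz]
  exact Finset.sum_congr rfl fun i _ => Finset.sum_congr rfl fun j _ => by ring

theorem covHam_smul (a b : A) (ξ : ι → A) :
    S.covHam a (b • ξ) = S.bracket a b • ξ + b • S.covHam a ξ := by
  ext m
  simp only [covHam, bracket, cov_smul, Pi.add_apply, Pi.smul_apply, smul_eq_mul, Finset.mul_sum,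
    Finset.sum_mul, ← Finset.sum_add_distrib]
  exact Finset.sum_congr rfl fun i _ => Finset.sum_congr rfl fun j _ => by ring

end PatchData

/-- The algebra `A_λ = A ⊕ λ A`. -/
def QAlg (_S : PatchData A ι) : Type _ := A × A

/-- The one-forms `Ω¹ ⊕ λ Ω¹`, where `ξ = ξ_m dx^m` is given by its components. -/
def QForm (_S : PatchData A ι) : Type _ := (ι → A) × (ι → A)

instance (S : PatchData A ι) : AddCommGroup (QAlg S) := inferInstanceAs (AddCommGroup (A × A))

instance (S : PatchData A ι) : AddCommGroup (QForm S) :=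
  inferInstanceAs (AddCommGroup ((ι → A) × (ι → A)))

variable {S : PatchData A ι}

@[ext]
theorem QAlg.ext {a b : QAlg S} (h₁ : a.1 = b.1) (h₂ : a.2 = b.2) : a = b := Prod.ext h₁ h₂

@[ext]
theorem QForm.ext {a b : QForm S} (h₁ : a.1 = b.1) (h₂ : a.2 = b.2) : a = b := Prod.ext h₁ h₂

theorem QAlg.add_fst (a b : QAlg S) : (a + b).1 = a.1 + b.1 := rfl
theorem QAlg.add_snd (a b : QAlg S) : (a + b).2 = a.2 + b.2 := rfl
theorem QAlg.zero_fst : (0 : QAlg S).1 = 0 := rfl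
theorem QAlg.zero_snd : (0 : QAlg S).2 = 0 := rfl
theorem QForm.add_fst (a b : QForm S) : (a + b).1 = a.1 + b.1 := rfl
theorem QForm.add_snd (a b : QForm S) : (a + b).2 = a.2 + b.2 := rfl
theorem QForm.zero_fst : (0 : QForm S).1 = 0 := rfl
theorem QForm.zero_snd : (0 : QForm S).2 = 0 := rfl

/-- `a • b = a b + (λ/2) ω^{ij} ∂_i a ∂_j b`. -/
instance : Mul (QAlg S) :=
  ⟨fun a b => (a.1 * b.1, a.1 * b.2 + a.2 * b.1 + (1 / 2 : ℂ) • S.bracket a.1 b.1)⟩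

instance : One (QAlg S) := ⟨((1 : A), (0 : A))⟩

/-- `a • ξ = a ξ + (λ/2) ω^{ij} ∂_i a ∇_j ξ`. -/
instance : SMul (QAlg S) (QForm S) :=
  ⟨fun a ξ => (a.1 • ξ.1, a.1 • ξ.2 + a.2 • ξ.1 + (1 / 2 : ℂ) • S.covHam a.1 ξ.1)⟩

/-- `ξ • a = a ξ - (λ/2) ω^{ij} ∂_i a ∇_j ξ`. -/
instance : SMul (QAlg S)ᵐᵒᵖ (QForm S) :=
  ⟨fun a ξ => (a.unop.1 • ξ.1,
    a.unop.1 • ξ.2 + a.unop.2 • ξ.1 - (1 / 2 : ℂ) • S.covHam a.unop.1 ξ.1)⟩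

theorem QAlg.mul_fst (a b : QAlg S) : (a * b).1 = a.1 * b.1 := rfl
theorem QAlg.mul_snd (a b : QAlg S) :
    (a * b).2 = a.1 * b.2 + a.2 * b.1 + (1 / 2 : ℂ) • S.bracket a.1 b.1 := rfl
theorem QAlg.one_fst : (1 : QAlg S).1 = 1 := rfl
theorem QAlg.one_snd : (1 : QAlg S).2 = 0 := rfl
theorem QForm.smul_fst (a : QAlg S) (ξ : QForm S) : (a • ξ).1 = a.1 • ξ.1 := rfl
theorem QForm.smul_snd (a : QAlg S) (ξ : QForm S) :
    (a • ξ).2 = a.1 • ξ.2 + a.2 • ξ.1 + (1 / 2 : ℂ) • S.covHam a.1 ξ.1 := rfl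
theorem QForm.rsmul_fst (a : (QAlg S)ᵐᵒᵖ) (ξ : QForm S) : (a • ξ).1 = a.unop.1 • ξ.1 := rfl
theorem QForm.rsmul_snd (a : (QAlg S)ᵐᵒᵖ) (ξ : QForm S) :
    (a • ξ).2 = a.unop.1 • ξ.2 + a.unop.2 • ξ.1 - (1 / 2 : ℂ) • S.covHam a.unop.1 ξ.1 := rfl

instance : Ring (QAlg S) :=
  { (inferInstance : AddCommGroup (QAlg S)) with
    mul := (· * ·)
    one := 1
    left_distrib := fun a b c => by
      ext
      · exact mul_add a.1 b.1 c.1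
      · simp only [QAlg.mul_snd, QAlg.add_fst, QAlg.add_snd, S.bracket_add_right, smul_add]; ring
    right_distrib := fun a b c => by
      ext
      · exact add_mul a.1 b.1 c.1
      · simp only [QAlg.mul_snd, QAlg.add_fst, QAlg.add_snd, S.bracket_add_left, smul_add]; ring
    zero_mul := fun a => by
      ext
      · exact zero_mul a.1
      · simp [QAlg.mul_snd, QAlg.zero_fst, QAlg.zero_snd, S.bracket_zero_left]
    mul_zero := fun a => by
      ext
      · exact mul_zero a.1
      · simp [QAlg.mul_snd, QAlg.zero_fst, QAlg.zero_snd, S.bracket_zero_right]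
    one_mul := fun a => by
      ext
      · exact one_mul a.1
      · simp [QAlg.mul_snd, QAlg.one_fst, QAlg.one_snd, S.bracket_one_left]
    mul_one := fun a => by
      ext
      · exact mul_one a.1
      · simp [QAlg.mul_snd, QAlg.one_fst, QAlg.one_snd, S.bracket_one_right]
    mul_assoc := fun a b c => by
      ext
      · exact mul_assoc a.1 b.1 c.1
      · simp only [QAlg.mul_fst, QAlg.mul_snd, S.bracket_mul_left, S.bracket_mul_right,
          add_mul, mul_add, Algebra.smul_def]
        ring }

instance : Module (QAlg S) (QForm S) where
  one_smul ξ := by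
    ext m
    · simp [QForm.smul_fst, QAlg.one_fst]
    · simp [QForm.smul_snd, QAlg.one_fst, QAlg.one_snd, S.covHam_one_left]
  mul_smul a b ξ := by
    ext m
    · simp [QForm.smul_fst, QAlg.mul_fst, mul_assoc]
    · simp only [QForm.smul_fst, QForm.smul_snd, QAlg.mul_fst, QAlg.mul_snd, S.covHam_mul,
        S.covHam_smul, Pi.add_apply, Pi.smul_apply, smul_eq_mul]
      simp only [Algebra.smul_def]
      ring
  smul_zero a := by
    ext m
    · simp [QForm.smul_fst, QForm.zero_fst]
    · simp [QForm.smul_snd, QForm.zero_fst, QForm.zero_snd, S.covHam_zero_right]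
  smul_add a ξ η := by
    ext m
    · simp [QForm.smul_fst, QForm.add_fst, mul_add]
    · simp only [QForm.smul_snd, QForm.add_fst, QForm.add_snd, S.covHam_add_right, Pi.add_apply,
        Pi.smul_apply, smul_eq_mul]
      simp only [Algebra.smul_def]
      ring
  add_smul a b ξ := by
    ext m
    · simp [QForm.smul_fst, QForm.add_fst, QAlg.add_fst, add_mul]
    · simp only [QForm.smul_snd, QForm.add_snd, QAlg.add_fst, QAlg.add_snd,
        S.covHam_add_left, Pi.add_apply, Pi.smul_apply, smul_eq_mul]
      simp only [Algebra.smul_def]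
      ring
  zero_smul ξ := by
    ext m
    · simp [QForm.smul_fst, QForm.zero_fst, QAlg.zero_fst]
    · simp [QForm.smul_snd, QForm.zero_snd, QAlg.zero_fst, QAlg.zero_snd, S.covHam_zero_left]

instance : Module (QAlg S)ᵐᵒᵖ (QForm S) where
  one_smul ξ := by
    ext m
    · simp [QForm.rsmul_fst, QAlg.one_fst]
    · simp [QForm.rsmul_snd, QAlg.one_fst, QAlg.one_snd, S.covHam_one_left]
  mul_smul a b ξ := by
    ext m
    · simp only [QForm.rsmul_fst, QAlg.mul_fst, MulOpposite.unop_mul, Pi.smul_apply, smul_eq_mul]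
      ring
    · simp only [QForm.rsmul_fst, QForm.rsmul_snd, QAlg.mul_fst, QAlg.mul_snd, S.covHam_mul,
        S.covHam_smul, Pi.add_apply, Pi.sub_apply, Pi.smul_apply, smul_eq_mul,
        MulOpposite.unop_mul, S.bracket_antisymm a.unop.1]
      simp only [Algebra.smul_def]
      ring
  smul_zero a := by
    ext m
    · simp [QForm.rsmul_fst, QForm.zero_fst]
    · simp [QForm.rsmul_snd, QForm.zero_fst, QForm.zero_snd, S.covHam_zero_right]
  smul_add a ξ η := by
    ext m
    · simp [QForm.rsmul_fst, QForm.add_fst, mul_add]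
    · simp only [QForm.rsmul_snd, QForm.add_fst, QForm.add_snd, S.covHam_add_right, Pi.add_apply,
        Pi.sub_apply, Pi.smul_apply, smul_eq_mul]
      simp only [Algebra.smul_def]
      ring
  add_smul a b ξ := by
    ext m
    · simp [QForm.rsmul_fst, QForm.add_fst, QAlg.add_fst, add_mul]
    · simp only [QForm.rsmul_snd, QForm.add_snd, QAlg.add_fst, QAlg.add_snd,
        S.covHam_add_left, Pi.add_apply, Pi.sub_apply, Pi.smul_apply, smul_eq_mul, MulOpposite.unop_add]
      simp only [Algebra.smul_def]
      ring
  zero_smul ξ := by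
    ext m
    · simp [QForm.rsmul_fst, QForm.zero_fst, QAlg.zero_fst]
    · simp [QForm.rsmul_snd, QForm.zero_snd, QAlg.zero_fst, QAlg.zero_snd, S.covHam_zero_left]

instance : SMulCommClass (QAlg S) (QAlg S)ᵐᵒᵖ (QForm S) where
  smul_comm a b ξ := by
    ext m
    · simp only [QForm.smul_fst, QForm.rsmul_fst, Pi.smul_apply, smul_eq_mul]
      ring
    · simp only [QForm.smul_fst, QForm.smul_snd, QForm.rsmul_fst, QForm.rsmul_snd,
        S.covHam_smul, Pi.add_apply, Pi.sub_apply, Pi.smul_apply, smul_eq_mul,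
        S.bracket_antisymm a.1]
      simp only [Algebra.smul_def]
      ring

variable (S)

/-- `Ω¹ ⊗₁ Ω¹`, the tensor product over `A_λ`. -/
abbrev QTensor : Type _ := BTensor (QAlg S) (QForm S) (QForm S)

/-- A classical function, as an element of `A_λ`. -/
def QAlg.of (f : A) : QAlg S := (f, (0 : A))

/-- The deformation parameter `λ`. -/
def QAlg.lam : QAlg S := ((0 : A), (1 : A))

/-- The complex number `c`, as an element of `A_λ`. -/
def QAlg.const (c : ℂ) : QAlg S := QAlg.of S (algebraMap ℂ A c)

/-- A classical one-form `ξ_m dx^m`, as an element of `Ω¹(A_λ)`. -/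
def QForm.of (ξ : ι → A) : QForm S := (ξ, (0 : ι → A))

/-- The coordinate one-form `dx^i`. -/
def QForm.dx (i : ι) : QForm S := QForm.of S (Pi.single i 1)

variable {S} in
/-- `ξ ⊗₁ η`. -/
def QForm.tens (ξ η : QForm S) : QTensor S := BTensor.tmul (QAlg S) ξ η

infixl:75 " ⊗₁ " => QForm.tens

/-- `c_{mn} dx^m ⊗₁ dx^n`. -/
def QTensor.ofCoeff (c : ι → ι → A) : QTensor S :=
  ∑ n, QForm.of S (fun m => c m n) ⊗₁ QForm.dx S n

/-- The undeformed exterior derivative `d : A_λ → Ω¹(A_λ)`. -/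
def qd : QAlg S →+ QForm S where
  toFun a := ((fun i => S.pd i a.1), (fun i => S.pd i a.2))
  map_zero' := by ext i <;> simp [QAlg.zero_fst, QAlg.zero_snd, QForm.zero_fst, QForm.zero_snd]
  map_add' a b := by
    ext i
    · exact map_add (S.pd i) a.1 b.1
    · exact map_add (S.pd i) a.2 b.2

/-- The undeformed exterior derivative `d : Ω¹(A_λ) → Ω²(A_λ)`. A two-form is given by the
components on `(∂_a, ∂_b)` of its two coefficients in `λ`. -/
def qd₁ : QForm S →+ (ι → ι → A) × (ι → ι → A) where
  toFun ξ := ((fun a b => S.pd a (ξ.1 b) - S.pd b (ξ.1 a)),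
    (fun a b => S.pd a (ξ.2 b) - S.pd b (ξ.2 a)))
  map_zero' := by
    ext a b <;> simp [QForm.zero_fst, QForm.zero_snd]
  map_add' ξ η := by
    ext a b <;> simp [QForm.add_fst, QForm.add_snd] <;> ring

namespace PatchData

theorem wedge_add_left (ξ ξ' η : ι → A) : wedge (ξ + ξ') η = wedge ξ η + wedge ξ' η := by
  ext a b; simp only [wedge, Pi.add_apply]; ring

theorem wedge_add_right (ξ η η' : ι → A) : wedge ξ (η + η') = wedge ξ η + wedge ξ η' := by
  ext a b; simp only [wedge, Pi.add_apply]; ring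

/-- The order `λ` part
`(1/2) ω^{ij} ∇_i ξ ∧ ∇_j η + H^{ij} ξ_i η_j` of the quantum wedge product of classical
one-forms. -/
def wedgeCorr (ξ η : ι → A) : ι → ι → A :=
  (1 / 2 : ℂ) • ∑ i, ∑ j, S.poisson i j • wedge (S.cov i ξ) (S.cov j η)
    + ∑ i, ∑ j, (ξ i * η j) • S.H i j

theorem wedgeCorr_add_left (ξ ξ' η : ι → A) :
    S.wedgeCorr (ξ + ξ') η = S.wedgeCorr ξ η + S.wedgeCorr ξ' η := by
  simp only [wedgeCorr, cov_add, wedge_add_left, smul_add, Finset.sum_add_distrib, Pi.add_apply,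
    add_mul, add_smul]
  abel

theorem wedgeCorr_add_right (ξ η η' : ι → A) :
    S.wedgeCorr ξ (η + η') = S.wedgeCorr ξ η + S.wedgeCorr ξ η' := by
  simp only [wedgeCorr, cov_add, wedge_add_right, smul_add, Finset.sum_add_distrib, Pi.add_apply,
    mul_add, add_smul]
  abel

theorem wedgeCorr_balanced (ξ η : ι → A) (a : A) :
    S.wedgeCorr (a • ξ) η - (1 / 2 : ℂ) • wedge (S.covHam a ξ) η
      = S.wedgeCorr ξ (a • η) + (1 / 2 : ℂ) • wedge ξ (S.covHam a η) := by
  have h1 : ∀ i j, wedge (S.cov i (a • ξ)) (S.cov j η)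
      = S.pd i a • wedge ξ (S.cov j η) + a • wedge (S.cov i ξ) (S.cov j η) := fun i j => by
    ext p q
    simp only [wedge, cov_smul, Pi.add_apply, Pi.smul_apply, smul_eq_mul]; ring
  have h2 : ∀ i j, wedge (S.cov i ξ) (S.cov j (a • η))
      = S.pd j a • wedge (S.cov i ξ) η + a • wedge (S.cov i ξ) (S.cov j η) := fun i j => by
    ext p q
    simp only [wedge, cov_smul, Pi.add_apply, Pi.smul_apply, smul_eq_mul]; ring
  have h3 : wedge ξ (S.covHam a η)
      = ∑ i, ∑ j, S.poisson i j • S.pd i a • wedge ξ (S.cov j η) := by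
    ext p q
    simp only [wedge, covHam, Finset.sum_apply, Pi.smul_apply, smul_eq_mul, Finset.mul_sum,
      ← Finset.sum_sub_distrib]
    exact Finset.sum_congr rfl fun i _ => Finset.sum_congr rfl fun j _ => by ring
  have h4 : wedge (S.covHam a ξ) η
      = - ∑ i, ∑ j, S.poisson i j • S.pd j a • wedge (S.cov i ξ) η := by
    ext p q
    simp only [wedge, covHam, Finset.sum_apply, Pi.smul_apply, Pi.neg_apply, smul_eq_mul,
      Finset.sum_mul, ← Finset.sum_sub_distrib]
    rw [Finset.sum_comm, ← Finset.sum_neg_distrib]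
    refine Finset.sum_congr rfl fun i _ => ?_
    rw [← Finset.sum_neg_distrib]
    refine Finset.sum_congr rfl fun j _ => ?_
    rw [S.poisson_antisymm j i]; ring
  have h5 : ∑ i, ∑ j, ((a • ξ) i * η j) • S.H i j = ∑ i, ∑ j, (ξ i * (a • η) j) • S.H i j :=
    Finset.sum_congr rfl fun i _ => Finset.sum_congr rfl fun j _ => by
      simp only [Pi.smul_apply, smul_eq_mul]; congr 1; ring
  simp only [wedgeCorr, h1, h2, h3, h4, h5, smul_add, Finset.sum_add_distrib, smul_neg]
  abel

end PatchData

/-- The quantum wedge product `∧₁ : Ω¹ ⊗₁ Ω¹ → Ω²` on one-forms,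
`ξ ∧₁ η = ξ ∧ η + (λ/2) ω^{ij} ∇_i ξ ∧ ∇_j η + λ H^{ij} ξ_i η_j`. -/
def qWedge : QTensor S →+ (ι → ι → A) × (ι → ι → A) :=
  BTensor.lift
    (AddMonoidHom.mk' (fun ξ : QForm S => AddMonoidHom.mk' (fun η : QForm S =>
        (PatchData.wedge ξ.1 η.1,
          PatchData.wedge ξ.1 η.2 + PatchData.wedge ξ.2 η.1 + S.wedgeCorr ξ.1 η.1))
        (fun η η' => by
          simp only [QForm.add_fst, QForm.add_snd, PatchData.wedge_add_right,
            S.wedgeCorr_add_right, Prod.mk_add_mk, Prod.mk.injEq, true_and]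
          abel))
      (fun ξ ξ' => by
        ext1 η
        simp only [QForm.add_fst, QForm.add_snd, PatchData.wedge_add_left,
          S.wedgeCorr_add_left, Prod.mk_add_mk, Prod.mk.injEq, true_and,
          AddMonoidHom.mk'_apply, AddMonoidHom.add_apply]
        abel))
    (fun ξ a η => by
      have h := S.wedgeCorr_balanced ξ.1 η.1 a.1
      simp only [AddMonoidHom.mk'_apply, QForm.smul_fst, QForm.smul_snd, QForm.rsmul_fst,
        QForm.rsmul_snd, MulOpposite.unop_op, Prod.mk.injEq]
      constructor
      · ext p q; simp only [PatchData.wedge, Pi.smul_apply, smul_eq_mul]; ring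
      · ext p q
        have h' := congrFun (congrFun h p) q
        simp only [Pi.add_apply, Pi.sub_apply, Pi.smul_apply, PatchData.wedge,
          smul_eq_mul] at h' ⊢
        simp only [Algebra.smul_def] at h' ⊢
        linear_combination h')

/-- The right hand side of
`∇_Q dx^i = -(Γ^i_{mn} + (λ/2) ω^{sj} (Γ^i_{mk,s} Γ^k_{jn} - Γ^i_{kt} Γ^k_{sm} Γ^t_{jn}
  - Γ^i_{jk} R^k_{nms})) dx^m ⊗₁ dx^n`. -/
def nablaQdx (i : ι) : QTensor S :=
  - (QTensor.ofCoeff S (fun m n => S.Γ i m n)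
    + (QAlg.const S (1 / 2) * QAlg.lam S) • QTensor.ofCoeff S (fun m n => ∑ s, ∑ j, S.poisson s j *
        ((∑ k, S.pd s (S.Γ i m k) * S.Γ k j n) - (∑ k, ∑ t, S.Γ i k t * S.Γ k s m * S.Γ t j n)
          - ∑ k, S.Γ i j k * S.curv k n m s)))

/-- A bimodule connection is the quantisation `∇_Q` of the classical connection `∇` if it has the
above values on the coordinate one-forms. -/
def IsNablaQ (D : BimoduleConnection (qd S)) : Prop :=
  ∀ i, D.nabla (QForm.dx S i) = nablaQdx S i

/-- The generalised Ricci two-form `𝓡 = H^{ij} g_{ij}`. -/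
def genRicci (g : ι → ι → A) : ι → ι → A := ∑ i, ∑ j, g i j • S.H i j

/-- The functorial quantisation
`g_Q = g_{ij} dx^i ⊗₁ dx^j + (λ/2) ω^{ij} g_{pm} Γ^p_{iq} Γ^q_{jn} dx^m ⊗₁ dx^n` of the metric. -/
def metricQ (g : ι → ι → A) : QTensor S :=
  QTensor.ofCoeff S g + (QAlg.const S (1 / 2) * QAlg.lam S) • QTensor.ofCoeff S (fun m n =>
    ∑ i, ∑ j, ∑ p, ∑ q, S.poisson i j * g p m * S.Γ p i q * S.Γ q j n)

/-- The quantum metric `g₁`: `g_Q` minus `λ` times the antisymmetric lift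
`(1/2) 𝓡_{mn} dx^m ⊗₁ dx^n` of `𝓡`, where `𝓡_{mn}` are the components of `𝓡` on `(∂_m, ∂_n)`. -/
def quantumMetric (g : ι → ι → A) : QTensor S :=
  metricQ S g - (QAlg.const S (1 / 2) * QAlg.lam S) • QTensor.ofCoeff S (genRicci S g)

/-- `D` is a quantum Levi-Civita connection for `G ∈ Ω¹ ⊗₁ Ω¹`: it is quantum torsion free,
`∧₁ ∇ ξ = d ξ`, and quantum metric compatible, `∇ G = 0`. -/
def IsQuantumLeviCivita (D : BimoduleConnection (qd S)) (G : QTensor S) : Prop :=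
  (∀ ξ, qWedge S (D.nabla ξ) = qd₁ S ξ) ∧ D.tensorNabla G = 0

end Semi

/-! ### The standard affine charts of `ℂPⁿ` -/

namespace CPn

/-- The smooth complex functions on the chart `ℂⁿ`, in the sense of real differentiability. -/
def Smooth (n : ℕ) : Subalgebra ℂ ((Fin n → ℂ) → ℂ) where
  carrier := {f | ContDiff ℝ ∞ f}
  mul_mem' {f g} (hf : ContDiff ℝ ∞ f) (hg : ContDiff ℝ ∞ g) :=
    (hf.mul hg : ContDiff ℝ ∞ (fun z => f z * g z))
  add_mem' {f g} (hf : ContDiff ℝ ∞ f) (hg : ContDiff ℝ ∞ g) :=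
    (hf.add hg : ContDiff ℝ ∞ (fun z => f z + g z))
  algebraMap_mem' c := (contDiff_const : ContDiff ℝ ∞ (fun _ : Fin n → ℂ => c))

/-- A smooth function, as an element of `Smooth n`. -/
def Smooth.mk {n : ℕ} (f : (Fin n → ℂ) → ℂ) (hf : ContDiff ℝ ∞ f) : Smooth n := ⟨f, hf⟩

theorem Smooth.contDiff {n : ℕ} (f : Smooth n) : ContDiff ℝ ∞ f.1 := f.2

theorem Smooth.differentiableAt {n : ℕ} (f : Smooth n) (z : Fin n → ℂ) :
    DifferentiableAt ℝ f.1 z := ((Smooth.contDiff f).differentiable (by simp)) z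

/-- Labels of the real coordinates: `Sum.inl i` for `Re z^i` and `Sum.inr i` for `Im z^i`. -/
abbrev Idx (n : ℕ) : Type := Fin n ⊕ Fin n

variable {n : ℕ}

/-- The coordinate vector field `∂_a`. -/
def basisVec : Idx n → (Fin n → ℂ)
  | Sum.inl i => Pi.single i 1
  | Sum.inr i => Pi.single i I

/-- The coordinate derivative `∂_a`. -/
def pd (a : Idx n) : Derivation ℂ (Smooth n) (Smooth n) :=
  Derivation.mk'
    { toFun := fun f => Smooth.mk (fun z => fderiv ℝ f.1 z (basisVec a))
        (((Smooth.contDiff f).fderiv_right (m := ∞) (by simp)).clm_apply contDiff_const)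
      map_add' := fun f g => Subtype.ext (funext fun z => by
        change fderiv ℝ (f.1 + g.1) z _ = fderiv ℝ f.1 z _ + fderiv ℝ g.1 z _
        rw [fderiv_add (Smooth.differentiableAt f z) (Smooth.differentiableAt g z)]; rfl)
      map_smul' := fun c f => Subtype.ext (funext fun z => by
        change fderiv ℝ (c • f.1) z _ = c • fderiv ℝ f.1 z _
        rw [fderiv_const_smul (Smooth.differentiableAt f z)]; rfl) }
    (fun f g => Subtype.ext (funext fun z => by
      change fderiv ℝ (f.1 * g.1) z _ = f.1 z * fderiv ℝ g.1 z _ + g.1 z * fderiv ℝ f.1 z _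
      rw [fderiv_mul (Smooth.differentiableAt f z) (Smooth.differentiableAt g z)]; rfl))

/-- `t = (1 + |z|²)^{-1/2}`. -/
def tFun (z : Fin n → ℂ) : ℝ := (Real.sqrt (1 + ∑ i, ‖z i‖ ^ 2))⁻¹

/-- Homogeneous coordinates `(z¹, …, 1, …, zⁿ)` of the point `z` of the chart `U_k`, with `1` in
position `k`. -/
def homog (k : Fin (n + 1)) (z : Fin n → ℂ) : EuclideanSpace ℂ (Fin (n + 1)) :=
  WithLp.toLp 2 (k.insertNth (1 : ℂ) z)

/-- The lift `t (z¹, …, 1, …, zⁿ)` of the point `z` of the chart `U_k` to the sphere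
`S^{2n+1}`. -/
def sphereLift (k : Fin (n + 1)) (z : Fin n → ℂ) : EuclideanSpace ℂ (Fin (n + 1)) :=
  (tFun z) • homog k z

/-- The component of `w` orthogonal to the complex line through the unit vector `s`; for `w` tangent
to the sphere at `s` this is the component orthogonal to the orbit of `U(1)`. -/
def horizontal (s w : EuclideanSpace ℂ (Fin (n + 1))) : EuclideanSpace ℂ (Fin (n + 1)) :=
  w - (inner ℂ s w) • s

/-- The Fubini-Study metric at `z` in the chart `U_k`: the metric on `ℂPⁿ = S^{2n+1} / U(1)`
induced by twice the Euclidean metric on the sphere. -/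
def fubiniStudy (k : Fin (n + 1)) (z u v : Fin n → ℂ) : ℝ :=
  2 * (inner ℂ (horizontal (sphereLift k z) (fderiv ℝ (sphereLift k) z u))
    (horizontal (sphereLift k z) (fderiv ℝ (sphereLift k) z v))).re

theorem one_add_pos (z : Fin n → ℂ) : 0 < 1 + ∑ i, ‖z i‖ ^ 2 := by positivity

theorem contDiff_tFun : ContDiff ℝ ∞ (tFun : (Fin n → ℂ) → ℝ) := by
  have h : ContDiff ℝ ∞ (fun z : Fin n → ℂ => 1 + ∑ i, ‖z i‖ ^ 2) :=
    contDiff_const.add (ContDiff.sum fun i _ => (contDiff_apply ℝ ℂ i).norm_sq ℝ)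
  exact (h.sqrt fun z => (one_add_pos z).ne').inv fun z =>
    (Real.sqrt_pos.2 (one_add_pos z)).ne'

/-- The linear part of `homog k`. -/
def homogLin (k : Fin (n + 1)) : (Fin n → ℂ) →ₗ[ℂ] EuclideanSpace ℂ (Fin (n + 1)) where
  toFun u := WithLp.toLp 2 (k.insertNth (0 : ℂ) u)
  map_add' u v := by
    ext i
    refine Fin.succAboveCases k ?_ (fun j => ?_) i <;> simp
  map_smul' c u := by
    ext i
    refine Fin.succAboveCases k ?_ (fun j => ?_) i <;> simp

theorem homog_eq (k : Fin (n + 1)) (z : Fin n → ℂ) :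
    homog k z = homogLin k z + homog k 0 := by
  ext i
  refine Fin.succAboveCases k ?_ (fun j => ?_) i <;> simp [homog, homogLin]

theorem hasFDerivAt_homog (k : Fin (n + 1)) (z : Fin n → ℂ) :
    HasFDerivAt (homog k) (((homogLin k).restrictScalars ℝ).toContinuousLinearMap) z := by
  have h := (((homogLin k).restrictScalars ℝ).toContinuousLinearMap.hasFDerivAt (x := z)).add_const
    (homog k 0)
  exact h.congr_of_eventuallyEq (Filter.Eventually.of_forall fun w => homog_eq k w)

theorem contDiff_homog (k : Fin (n + 1)) : ContDiff ℝ ∞ (homog k : (Fin n → ℂ) → _) := by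
  have h : (homog k : (Fin n → ℂ) → _) = fun w =>
      ((homogLin k).restrictScalars ℝ).toContinuousLinearMap w + homog k 0 :=
    funext fun w => homog_eq k w
  rw [h]
  exact (ContinuousLinearMap.contDiff _).add contDiff_const

theorem contDiff_sphereLift (k : Fin (n + 1)) :
    ContDiff ℝ ∞ (sphereLift k : (Fin n → ℂ) → _) :=
  contDiff_tFun.smul (contDiff_homog k)

theorem contDiff_fubiniStudy (k : Fin (n + 1)) (u v : Fin n → ℂ) :
    ContDiff ℝ ∞ (fun z => ((fubiniStudy k z u v : ℝ) : ℂ)) := by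
  have hs := contDiff_sphereLift (n := n) k
  have hd : ∀ w, ContDiff ℝ ∞ (fun z => fderiv ℝ (sphereLift k) z w) := fun w =>
    (ContDiff.fderiv_right (m := ∞) hs (by simp)).clm_apply contDiff_const
  have hh : ∀ w, ContDiff ℝ ∞
      (fun z => horizontal (sphereLift k z) (fderiv ℝ (sphereLift k) z w)) := fun w =>
    (hd w).sub ((hs.inner ℂ (hd w)).smul hs)
  exact Complex.ofRealCLM.contDiff.comp
    (contDiff_const.mul (Complex.reCLM.contDiff.comp ((hh u).inner ℂ (hh v))))

/-- The function `z ↦ g_z(u, v)` for constant vector fields `u` and `v`. -/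
def metricFun (k : Fin (n + 1)) (u v : Fin n → ℂ) : Smooth n :=
  Smooth.mk (fun z => ((fubiniStudy k z u v : ℝ) : ℂ)) (contDiff_fubiniStudy k u v)

/-- The components `g_{ab}` of the Fubini-Study metric. -/
def metric (k : Fin (n + 1)) (a b : Idx n) : Smooth n := metricFun k (basisVec a) (basisVec b)

/-- The components `g^{ab}` of the inverse metric. -/
def metricInv (k : Fin (n + 1)) (a b : Idx n) : Smooth n :=
  ((Matrix.of (metric k : Idx n → Idx n → Smooth n))⁻¹) a b

/-- `ω_{ab} = g(∂_a, J ∂_b)`, where `J` is the complex structure. -/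
def omegaLow (k : Fin (n + 1)) (a b : Idx n) : Smooth n :=
  metricFun k (basisVec a) (I • basisVec b)

/-- The Poisson tensor `ω^{ab} = g^{ac} g^{bd} ω_{cd}`. -/
def omegaUp (k : Fin (n + 1)) (a b : Idx n) : Smooth n :=
  ∑ c, ∑ d, metricInv k a c * metricInv k b d * omegaLow k c d

/-- The Christoffel symbols `Γ^a_{bc} = (1/2) g^{ad} (∂_b g_{dc} + ∂_c g_{db} - ∂_d g_{bc})` of
the Levi-Civita connection. -/
def christoffel (k : Fin (n + 1)) (a b c : Idx n) : Smooth n :=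
  (1 / 2 : ℂ) • ∑ d, metricInv k a d *
    (pd b (metric k d c) + pd c (metric k d b) - pd d (metric k b c))

theorem inner_homog (k : Fin (n + 1)) (z : Fin n → ℂ) :
    inner ℂ (sphereLift k z) (sphereLift k z) = (1 : ℂ) := by
  have h1 : ‖homog k z‖ ^ 2 = 1 + ∑ i, ‖z i‖ ^ 2 := by
    rw [EuclideanSpace.norm_sq_eq, Fin.sum_univ_succAbove _ k]
    simp [homog]
  have h2 : ‖sphereLift k z‖ ^ 2 = 1 := by
    rw [sphereLift, norm_smul, mul_pow, h1, tFun, norm_inv, inv_pow, Real.norm_eq_abs, sq_abs,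
      Real.sq_sqrt (one_add_pos z).le]
    exact inv_mul_cancel₀ (one_add_pos z).ne'
  rw [inner_self_eq_norm_sq_to_K]
  have h3 := congrArg (fun r : ℝ => (r : ℂ)) h2
  simpa using h3

theorem horizontal_fderiv (k : Fin (n + 1)) (z u : Fin n → ℂ) :
    horizontal (sphereLift k z) (fderiv ℝ (sphereLift k) z u)
      = ((tFun z : ℝ) : ℂ) • horizontal (sphereLift k z) (homogLin k u) := by
  have ht : DifferentiableAt ℝ (tFun : (Fin n → ℂ) → ℝ) z :=
    (contDiff_tFun.differentiable (by simp)) z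
  have hd := (ht.hasFDerivAt.smul (hasFDerivAt_homog k z)).fderiv
  have ht0 : ((tFun z : ℝ) : ℂ) ≠ 0 := by
    have : tFun z ≠ 0 := inv_ne_zero (Real.sqrt_pos.2 (one_add_pos z)).ne'
    exact_mod_cast this
  have hh : homog k z = ((tFun z : ℝ) : ℂ)⁻¹ • sphereLift k z := by
    rw [sphereLift, ← Complex.coe_smul, smul_smul, inv_mul_cancel₀ ht0, one_smul]
  have e : fderiv ℝ (sphereLift k) z u = ((tFun z : ℝ) : ℂ) • homogLin k u
      + (((fderiv ℝ tFun z u : ℝ) : ℂ) * ((tFun z : ℝ) : ℂ)⁻¹) • sphereLift k z := by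
    have e1 : fderiv ℝ (sphereLift k) z u
        = tFun z • homogLin k u + (fderiv ℝ tFun z u) • homog k z := by
      change fderiv ℝ ((tFun : (Fin n → ℂ) → ℝ) • homog k :
        (Fin n → ℂ) → EuclideanSpace ℂ (Fin (n + 1))) z u = _
      rw [hd]
      rfl
    rw [e1, hh, ← Complex.coe_smul, ← Complex.coe_smul, smul_smul]
  rw [e]
  simp only [horizontal, inner_add_right, inner_smul_right, inner_homog, smul_sub, smul_smul,
    add_smul, mul_one]
  abel

theorem omegaLow_antisymm (k : Fin (n + 1)) (a b : Idx n) : omegaLow k a b = - omegaLow k b a := by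
  have hI : ∀ s w : EuclideanSpace ℂ (Fin (n + 1)), horizontal s (I • w) = I • horizontal s w := by
    intro s w
    simp only [horizontal, inner_smul_right, smul_sub, smul_smul]
  ext z
  change ((fubiniStudy k z _ _ : ℝ) : ℂ) = - ((fubiniStudy k z _ _ : ℝ) : ℂ)
  rw [← Complex.ofReal_neg]
  congr 1
  simp only [fubiniStudy, horizontal_fderiv, map_smul, hI, inner_smul_left, inner_smul_right]
  rw [← inner_conj_symm (horizontal (sphereLift k z) (homogLin k (basisVec a)))]
  simp only [Complex.mul_re, Complex.mul_im, Complex.conj_re, Complex.conj_im, Complex.ofReal_re,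
    Complex.ofReal_im, Complex.I_re, Complex.I_im]
  ring

theorem omegaUp_antisymm (k : Fin (n + 1)) (a b : Idx n) : omegaUp k a b = - omegaUp k b a := by
  rw [omegaUp, omegaUp, Finset.sum_comm, ← Finset.sum_neg_distrib]
  refine Finset.sum_congr rfl fun c _ => ?_
  rw [← Finset.sum_neg_distrib]
  refine Finset.sum_congr rfl fun d _ => ?_
  rw [omegaLow_antisymm]; ring

variable (n) in
/-- The chart `U_k` of `ℂPⁿ` with the Poisson tensor and the Levi-Civita connection of the
Fubini-Study metric. -/
def patch (k : Fin (n + 1)) : PatchData (Smooth n) (Idx n) where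
  pd := pd
  poisson := omegaUp k
  poisson_antisymm := omegaUp_antisymm k
  Γ := christoffel k

/-- The symplectic form `ϖ = ω_{ab} dx^b ∧ dx^a`. -/
def varpi (k : Fin (n + 1)) : Idx n → Idx n → Smooth n :=
  ∑ a, ∑ b, omegaLow k a b • PatchData.wedge (Pi.single b 1) (Pi.single a 1)

/-- The coordinate function `z^i`. -/
def zc (i : Fin n) : Smooth n := Smooth.mk (fun z => z i) (contDiff_apply ℝ ℂ i)

/-- The function `\bar z^i`. -/
def zbar (i : Fin n) : Smooth n :=
  Smooth.mk (fun z => (starRingEnd ℂ) (z i)) (Complex.conjCLE.contDiff.comp (contDiff_apply ℝ ℂ i))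

/-- The function `t² = 1 / (1 + |z|²)`. -/
def t2 : Smooth n :=
  Smooth.mk (fun z => ((tFun z ^ 2 : ℝ) : ℂ))
    (Complex.ofRealCLM.contDiff.comp (contDiff_tFun.pow 2))

/-- `g_{i \bar j} = t² δ_{ij} - t⁴ \bar z^i z^j`. -/
def gBar (i j : Fin n) : Smooth n :=
  (if i = j then t2 else 0) - t2 ^ 2 * zbar i * zc j

/-- The components of `dz^i`. -/
def dz (i : Fin n) : Idx n → Smooth n := fun a => pd a (zc i)

/-- The components of `d\bar z^i`. -/
def dzbar (i : Fin n) : Idx n → Smooth n := fun a => pd a (zbar i)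

/-- The one-form `τ = t² \bar z^i dz^i`. -/
def tau : Idx n → Smooth n := ∑ i, (t2 * zbar i) • dz i

/-- The one-form `\bar τ = t² z^i d\bar z^i`. -/
def taubar : Idx n → Smooth n := ∑ i, (t2 * zc i) • dzbar i

/-- `γ = t² d\bar z^i ⊗₁ dz^i - \bar τ ⊗₁ τ`. -/
def gamma (k : Fin (n + 1)) : QTensor (patch n k) :=
  ∑ i, QForm.of (patch n k) ((t2 : Smooth n) • dzbar i) ⊗₁ QForm.of (patch n k) (dz i)
    - QForm.of (patch n k) taubar ⊗₁ QForm.of (patch n k) tau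

/-- `\bar γ = t² dz^i ⊗₁ d\bar z^i - τ ⊗₁ \bar τ`. -/
def gammabar (k : Fin (n + 1)) : QTensor (patch n k) :=
  ∑ i, QForm.of (patch n k) ((t2 : Smooth n) • dz i) ⊗₁ QForm.of (patch n k) (dzbar i)
    - QForm.of (patch n k) tau ⊗₁ QForm.of (patch n k) taubar

/-- `\tilde ϖ = i (\bar γ - γ)`, taken with `⊗₁`. -/
def varpiTilde (k : Fin (n + 1)) : QTensor (patch n k) :=
  QAlg.const (patch n k) I • (gammabar k - gamma k)

end CPn

end

/-!
# The quantum Levi-Civita connection of `ℂPⁿ` to first order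

*Symbols.* Let `V` carry a covariant derivative. A bimodule over `A_λ` whose two actions are
`a v ± (λ/2) ω^{ij} ∂_i a ∇_j v` is identified with `V ⊕ λ V` (`Symbol`). The map
`v ⊗₁ η ↦ v ⊗ η + (λ/2) ω^{ij} ∇_i v ⊗ ∇_j η` identifies `M ⊗₁ Ω¹` with the quantisation of the
classical tensor product (`Symbol.tensor`). So every statement about `Ω¹ ⊗₁ Ω¹` and
`Ω¹ ⊗₁ Ω¹ ⊗₁ Ω¹` becomes a statement about pairs of classical tensors.

*The connection.* Assume that the classical connection is torsion free and that `ω` is parallel.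
Then the pair `∇ ξ + (λ/2) ω^{ij} dx^m ⊗ [∇_j, ∇_m] ∇_i ξ` is the symbol of a bimodule connection
(`quantConn`), whose braiding is the flip corrected by the curvature. On coordinate forms it takes
the prescribed values (`quantConn_isNablaQ`), and the connection it induces on `Ω¹ ⊗₁ Ω¹` is given
by the same formula (`symb₃_tensorNabla`). The symbol of `∧₁` is antisymmetrisation plus contraction
with `H^{ij}` (`qWedge_eq`), and this contraction cancels the curvature term, so the quantum torsion
vanishes. The symbol of the quantum metric is `(g, -𝓡/2)` (`symb₂_quantumMetric`); hence it is
preserved as soon as `g` and `𝓡` are parallel (`quantConn_isQuantumLeviCivita`). The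
difference of two quantum Levi-Civita connections is, first at order zero and then at order `λ`, a
symmetric tensor that does not move `g`, so it vanishes (`quantumLeviCivita_unique`).

*Projective space.* Write `h = g_{i \bar j} dz^i ⊗ d\bar z^j`, so that `g` is `h` plus its
transpose. The computation rests on `∂_b τ_d = h_{db} - τ_b τ_d` and its conjugate. They give
`∇ dz^i = τ ⊗ dz^i + dz^i ⊗ τ`, `∇ h = 0`, the curvature (`curv_eq`) and
`𝓡_{pq} = i (n + 1) (h_{pq} - h_{qp})` (`genRicci_apply`). Contraction with `ω^{ab}` is of type
`(1, 1)` (`pois_hol_hol`, `pois_anti_anti`), and on `h` it is multiplication by `± i`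
(`pois_hol_herm`). This kills the corrections in `g_{i \bar j} dz^i ⊗₁ d\bar z^j`, and makes the
curvature term of `∇_Q dz^i` equal to `i` times its classical part.
-/

noncomputable section

set_option linter.unusedSectionVars false

namespace Semiquantum

section General

variable {A ι : Type*} [CommRing A] [Algebra ℂ A] [Fintype ι] [DecidableEq ι]

/-! ### Modules with a covariant derivative and their symbols -/

variable (A) in
/-- The scalar `1/2` as an element of `A`. -/
def half : A := algebraMap ℂ A (1 / 2)

theorem half_add_half : half A + half A = 1 := by
  rw [half, ← map_add]; norm_num

theorem half_smul (ξ : ι → A) : (1 / 2 : ℂ) • ξ = half A • ξ :=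
  (algebraMap_smul A (1 / 2 : ℂ) ξ).symm

/-- An `A`-module `V` with derivatives `∇_j` along the coordinate vector fields, obeying the Leibniz
rule. Tensor fields are the examples of interest. -/
structure CovModule (S : PatchData A ι) (V : Type*) [AddCommGroup V] [Module A V] where
  nab : ι → V →+ V
  nab_smul : ∀ (j : ι) (a : A) (v : V), nab j (a • v) = S.pd j a • v + a • nab j v

variable {S : PatchData A ι} {V : Type*} [AddCommGroup V] [Module A V]

/-- The tensor product `v ⊗ η` of `v : V` with a one-form `η`. An element `X` of `V ⊗ Ω¹` is stored
as the family of its coefficients `X n : V` of `dx^n`, so that the last tensor factor becomes the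
first argument. -/
def tens : (ι → A) →ₗ[A] V →ₗ[A] (ι → V) :=
  LinearMap.mk₂ A (fun η v n => η n • v)
    (fun η η' v => by ext n; exact add_smul _ _ _)
    (fun c η v => by ext n; exact mul_smul _ _ _)
    (fun η v v' => by ext n; exact smul_add _ _ _)
    (fun c η v => by ext n; exact smul_comm _ _ _)

theorem tens_apply (η : ι → A) (v : V) (n : ι) : tens η v n = η n • v := rfl

variable (S) in
/-- One-forms with the covariant derivative of the patch. -/
def covForm : CovModule S (ι → A) where
  nab j := AddMonoidHom.mk' (S.cov j) (S.cov_add j)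
  nab_smul := S.cov_smul

theorem covForm_nab (j : ι) (ξ : ι → A) : (covForm S).nab j ξ = S.cov j ξ := rfl

namespace CovModule

variable (C : CovModule S V)

/-- The covariant derivative on `V ⊗ Ω¹`. -/
def form : CovModule S (ι → V) where
  nab j := AddMonoidHom.mk' (fun X n => C.nab j (X n) - ∑ k, S.Γ k j n • X k) (fun X Y => by
    ext n; simp only [Pi.add_apply, map_add, smul_add, Finset.sum_add_distrib]; abel)
  nab_smul j a X := by
    ext n
    have h : ∑ k, S.Γ k j n • a • X k = a • ∑ k, S.Γ k j n • X k := by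
      rw [Finset.smul_sum]; exact Finset.sum_congr rfl fun k _ => smul_comm _ _ _
    simp only [AddMonoidHom.mk'_apply, Pi.smul_apply, C.nab_smul, h, Pi.add_apply]
    module

theorem form_nab (j : ι) (X : ι → V) (n : ι) :
    C.form.nab j X n = C.nab j (X n) - ∑ k, S.Γ k j n • X k := rfl

theorem form_nab_tens (j : ι) (η : ι → A) (v : V) :
    C.form.nab j (tens η v) = tens (S.cov j η) v + tens η (C.nab j v) := by
  ext n
  simp only [form_nab, tens_apply, C.nab_smul, Pi.add_apply, PatchData.cov, sub_smul,
    Finset.sum_smul, mul_smul]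
  abel

/-- `ω^{ij} ∂_i a ∇_j v`. -/
def ham (a : A) (v : V) : V := ∑ i, ∑ j, (S.poisson i j * S.pd i a) • C.nab j v

theorem ham_zero_left (v : V) : C.ham 0 v = 0 := by simp [ham]

theorem ham_zero_right (a : A) : C.ham a 0 = 0 := by simp [ham]

theorem ham_add_right (a : A) (v w : V) : C.ham a (v + w) = C.ham a v + C.ham a w := by
  simp only [ham, map_add, smul_add, Finset.sum_add_distrib]

/-- The term `(1/2) ω^{ij} ∇_i v ⊗ ∇_j η` of the quantisation of `v ⊗ η`. -/
def corr (v : V) (η : ι → A) : ι → V :=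
  half A • ∑ i, ∑ j, S.poisson i j • tens (S.cov j η) (C.nab i v)

theorem corr_zero_left (η : ι → A) : C.corr 0 η = 0 := by simp [corr]

theorem corr_add_left (v w : V) (η : ι → A) : C.corr (v + w) η = C.corr v η + C.corr w η := by
  simp only [corr, map_add, smul_add, Finset.sum_add_distrib]

theorem corr_add_right (v : V) (η θ : ι → A) : C.corr v (η + θ) = C.corr v η + C.corr v θ := by
  simp only [corr, S.cov_add, map_add, LinearMap.add_apply, smul_add, Finset.sum_add_distrib]

theorem corr_smul_left (a : A) (v : V) (η : ι → A) :
    C.corr (a • v) η = a • C.corr v η + half A • tens (S.covHam a η) v := by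
  have h : tens (S.covHam a η) v
      = ∑ i, ∑ j, S.poisson i j • S.pd i a • tens (S.cov j η) v := by
    ext n
    simp only [tens_apply, PatchData.covHam, Finset.sum_smul, Finset.sum_apply, Pi.smul_apply,
      mul_smul]
  simp only [corr, C.nab_smul, map_add, map_smul, smul_add, Finset.sum_add_distrib, h,
    Finset.smul_sum, smul_smul]
  rw [add_comm]
  congr 1
  exact Finset.sum_congr rfl fun i _ => Finset.sum_congr rfl fun j _ => by congr 1; ring

theorem corr_smul_right (a : A) (v : V) (η : ι → A) :
    C.corr v (a • η) = a • C.corr v η - half A • tens η (C.ham a v) := by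
  have h : tens η (C.ham a v)
      = - ∑ i, ∑ j, S.poisson i j • S.pd j a • tens η (C.nab i v) := by
    simp only [ham, map_sum, map_smul]
    rw [Finset.sum_comm, ← Finset.sum_neg_distrib]
    refine Finset.sum_congr rfl fun i _ => ?_
    rw [← Finset.sum_neg_distrib]
    refine Finset.sum_congr rfl fun j _ => ?_
    rw [S.poisson_antisymm]; module
  simp only [corr, S.cov_smul, map_add, map_smul, smul_add, Finset.sum_add_distrib, h,
    Finset.smul_sum, smul_smul, LinearMap.add_apply, LinearMap.smul_apply, smul_neg, sub_neg_eq_add]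
  rw [add_comm]
  congr 1
  exact Finset.sum_congr rfl fun i _ => Finset.sum_congr rfl fun j _ => by congr 1; ring

theorem form_ham_tens (a : A) (η : ι → A) (v : V) :
    C.form.ham a (tens η v) = tens (S.covHam a η) v + tens η (C.ham a v) := by
  have h : S.covHam a η = ∑ i, ∑ j, (S.poisson i j * S.pd i a) • S.cov j η := by
    ext n; simp [PatchData.covHam]
  simp only [ham, form_nab_tens, h, map_sum, map_smul, LinearMap.sum_apply, LinearMap.smul_apply,
    smul_add, Finset.sum_add_distrib]

end CovModule

theorem covForm_ham (a : A) (ξ : ι → A) : (covForm S).ham a ξ = S.covHam a ξ := by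
  ext n; simp [CovModule.ham, PatchData.covHam, covForm_nab]

variable (S) in
/-- An identification of a bimodule `M` over `A_λ` with `V ⊕ λ V`, under which the actions of `A_λ`
are `a v ± (λ/2) ω^{ij} ∂_i a ∇_j v`. -/
structure Symbol (M : Type*) [AddCommGroup M] [Module (QAlg S) M] [Module (QAlg S)ᵐᵒᵖ M]
    [SMulCommClass (QAlg S) (QAlg S)ᵐᵒᵖ M] (C : CovModule S V) where
  hom : M →+ V × V
  left : ∀ (a : QAlg S) (m : M), hom (a • m)
    = (a.1 • (hom m).1, a.1 • (hom m).2 + a.2 • (hom m).1 + half A • C.ham a.1 (hom m).1)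
  right : ∀ (a : QAlg S) (m : M), hom (m <• a)
    = (a.1 • (hom m).1, a.1 • (hom m).2 + a.2 • (hom m).1 - half A • C.ham a.1 (hom m).1)
  bijective : Function.Bijective hom

variable (S) in
/-- The one-form `λ ξ`, for a classical one-form `ξ`. -/
def lamForm (ξ : ι → A) : QForm S := ((0 : ι → A), ξ)

variable (S) in
/-- The element `λ f` of `A_λ`, for a classical function `f`. -/
def lamAlg (f : A) : QAlg S := ((0 : A), f)

theorem form_of_fst (ξ : ι → A) : (QForm.of S ξ).1 = ξ := rfl
theorem form_of_snd (ξ : ι → A) : (QForm.of S ξ).2 = 0 := rfl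
theorem dx_fst (n : ι) : (QForm.dx S n).1 = Pi.single n 1 := rfl
theorem dx_snd (n : ι) : (QForm.dx S n).2 = 0 := rfl
theorem lamForm_fst (ξ : ι → A) : (lamForm S ξ).1 = 0 := rfl
theorem lamForm_snd (ξ : ι → A) : (lamForm S ξ).2 = ξ := rfl
theorem alg_of_fst (a : A) : (QAlg.of S a).1 = a := rfl
theorem alg_of_snd (a : A) : (QAlg.of S a).2 = 0 := rfl
theorem lamAlg_fst (a : A) : (lamAlg S a).1 = 0 := rfl
theorem lamAlg_snd (a : A) : (lamAlg S a).2 = a := rfl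

theorem sum_form_of {κ : Type*} [Fintype κ] (f : κ → ι → A) :
    ∑ n, QForm.of S (f n) = QForm.of S (∑ n, f n) :=
  (map_sum (AddMonoidHom.inl (ι → A) (ι → A)) f Finset.univ).symm

theorem sum_lamForm (f : ι → ι → A) : ∑ n, lamForm S (f n) = lamForm S (∑ n, f n) :=
  (map_sum (AddMonoidHom.inr (ι → A) (ι → A)) f Finset.univ).symm

theorem of_smul_dx (a : A) (n : ι) : QAlg.of S a • QForm.dx S n
    = QForm.of S (Pi.single n a) + lamForm S (half A • S.covHam a (Pi.single n 1)) := by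
  ext1
  · simp only [QForm.smul_fst, QForm.add_fst, dx_fst, form_of_fst, alg_of_fst, lamForm_fst,
      add_zero]
    ext m; simp [Pi.single_apply]
  · simp only [QForm.smul_snd, QForm.add_snd, dx_fst, dx_snd, form_of_snd, alg_of_fst, alg_of_snd,
      lamForm_snd, zero_smul, smul_zero, zero_add, half_smul]

theorem lamAlg_smul_dx (a : A) (n : ι) :
    lamAlg S a • QForm.dx S n = lamForm S (Pi.single n a) := by
  ext1
  · simp [QForm.smul_fst, lamAlg_fst, lamForm_fst]
  · simp only [QForm.smul_snd, dx_fst, dx_snd, lamForm_snd, lamAlg_fst, lamAlg_snd,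
      S.covHam_zero_left, smul_zero, add_zero, zero_add]
    ext m; simp [Pi.single_apply]

theorem of_add_lamForm (ξ ζ : ι → A) : QForm.of S ξ + lamForm S ζ = (ξ, ζ) := by
  ext1
  · exact add_zero ξ
  · exact zero_add ζ

/-- The `dx^n` generate the left module `Ω¹`; the leading coefficients are the components of the
leading part. -/
theorem exists_sum_smul_dx (η : QForm S) :
    ∃ b : ι → QAlg S, (∀ n, (b n).1 = η.1 n) ∧ η = ∑ n, b n • QForm.dx S n := by
  refine ⟨fun n => QAlg.of S (η.1 n) + lamAlg S ((η.2
    - ∑ k, half A • S.covHam (η.1 k) (Pi.single k 1)) n), fun n => ?_, ?_⟩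
  · simp [QAlg.add_fst, alg_of_fst, lamAlg_fst]
  · simp only [add_smul, of_smul_dx, lamAlg_smul_dx, Finset.sum_add_distrib, sum_form_of,
      sum_lamForm]
    rw [add_assoc, Finset.univ_sum_single, Finset.univ_sum_single]
    have h : ∀ ξ ζ : ι → A, lamForm S ξ + lamForm S ζ = lamForm S (ξ + ζ) := fun ξ ζ =>
      (map_add (AddMonoidHom.inr (ι → A) (ι → A)) ξ ζ).symm
    rw [h, of_add_lamForm, add_sub_cancel]
    rfl

/-- The identity symbol of `Ω¹`. -/
def Symbol.form (S : PatchData A ι) : Symbol S (QForm S) (covForm S) where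
  hom := AddMonoidHom.id (QForm S)
  left a m := by
    rw [covForm_ham, ← half_smul]; rfl
  right a m := by
    rw [covForm_ham, ← half_smul]; rfl
  bijective := Function.bijective_id

namespace Symbol

variable {M : Type*} [AddCommGroup M] [Module (QAlg S) M] [Module (QAlg S)ᵐᵒᵖ M]
  [SMulCommClass (QAlg S) (QAlg S)ᵐᵒᵖ M] {C : CovModule S V} (s : Symbol S M C)

/-- `v ⊗ η ↦ v ⊗ η + (λ/2) ω^{ij} ∇_i v ⊗ ∇_j η`, as a map on `M ⊗₁ Ω¹`. -/
def tensorHom : BTensor (QAlg S) M (QForm S) →+ (ι → V) × (ι → V) :=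
  BTensor.lift
    (AddMonoidHom.mk' (fun m : M => AddMonoidHom.mk' (fun η : QForm S =>
        (tens η.1 (s.hom m).1,
          tens η.1 (s.hom m).2 + tens η.2 (s.hom m).1 + C.corr (s.hom m).1 η.1))
        (fun η η' => by
          simp only [QForm.add_fst, QForm.add_snd, map_add, LinearMap.add_apply, C.corr_add_right,
            Prod.mk_add_mk, Prod.mk.injEq, true_and]
          abel))
      (fun m m' => by
        ext1 η
        simp only [map_add, Prod.fst_add, Prod.snd_add, C.corr_add_left, Prod.mk_add_mk,
          Prod.mk.injEq, true_and, AddMonoidHom.mk'_apply, AddMonoidHom.add_apply]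
        abel))
    (fun m a η => by
      simp only [AddMonoidHom.mk'_apply, s.right, QForm.smul_fst, QForm.smul_snd, half_smul,
        map_add, map_sub, map_smul, LinearMap.add_apply, LinearMap.smul_apply, C.corr_smul_left,
        C.corr_smul_right, Prod.mk.injEq, true_and]
      module)

theorem tensorHom_tmul (m : M) (η : QForm S) :
    s.tensorHom (BTensor.tmul _ m η) = (tens η.1 (s.hom m).1,
      tens η.1 (s.hom m).2 + tens η.2 (s.hom m).1 + C.corr (s.hom m).1 η.1) := rfl

theorem exists_sum_tmul_dx (X : BTensor (QAlg S) M (QForm S)) :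
    ∃ Y : ι → M, X = ∑ n, BTensor.tmul _ (Y n) (QForm.dx S n) := by
  induction X using BTensor.induction with
  | h0 => exact ⟨0, by
      have : ∀ n, BTensor.tmul (QAlg S) (0 : M) (QForm.dx S n) = 0 := fun n =>
        DFunLike.congr_fun (map_zero (BTensor.tmulHom (QAlg S))) _
      simp [this]⟩
  | ht m η =>
    obtain ⟨b, -, rfl⟩ := exists_sum_smul_dx η
    refine ⟨fun n => m <• b n, ?_⟩
    simp only [BTensor.smul_tmul]
    exact map_sum (BTensor.tmulHom (QAlg S) m) _ _
  | ha X X' hX hX' =>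
    obtain ⟨Y, rfl⟩ := hX
    obtain ⟨Y', rfl⟩ := hX'
    exact ⟨Y + Y', by simp only [Pi.add_apply, BTensor.add_tmul, Finset.sum_add_distrib]⟩

theorem sum_tens_single (v : ι → V) : ∑ n, tens (Pi.single n (1 : A)) (v n) = v := by
  ext m
  simp [Finset.sum_apply, tens_apply, Pi.single_apply, ite_smul]

theorem tensorHom_sum (Y : ι → M) :
    s.tensorHom (∑ n, BTensor.tmul _ (Y n) (QForm.dx S n))
      = (fun n => (s.hom (Y n)).1, (fun n => (s.hom (Y n)).2)
          + ∑ n, C.corr (s.hom (Y n)).1 (Pi.single n 1)) := by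
  have h : ∀ n, s.tensorHom (BTensor.tmul _ (Y n) (QForm.dx S n))
      = (tens (Pi.single n (1 : A)) (s.hom (Y n)).1,
        tens (Pi.single n (1 : A)) (s.hom (Y n)).2 + C.corr (s.hom (Y n)).1 (Pi.single n 1)) := by
    intro n
    rw [tensorHom_tmul]
    simp only [dx_fst, dx_snd, map_zero, LinearMap.zero_apply, add_zero]
  rw [map_sum]
  ext1
  · simp only [h, Prod.fst_sum]
    exact sum_tens_single fun n => (s.hom (Y n)).1
  · simp only [h, Prod.snd_sum, Finset.sum_add_distrib]
    congr 1
    exact sum_tens_single fun n => (s.hom (Y n)).2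

/-- The symbol of `M ⊗₁ Ω¹`: the tensor product of bimodules is the quantisation of the classical
tensor product `V ⊗ Ω¹`. -/
def tensor : Symbol S (BTensor (QAlg S) M (QForm S)) C.form where
  hom := s.tensorHom
  left a X := by
    induction X using BTensor.induction with
    | h0 => simp [C.form.ham_zero_right, Prod.ext_iff]
    | ht m η =>
      rw [BTensor.left_smul_tmul, tensorHom_tmul, tensorHom_tmul]
      simp only [s.left, map_add, map_smul, C.form_ham_tens, C.corr_smul_left, Prod.mk.injEq,
        true_and]
      module
    | ha X Y hX hY =>
      rw [smul_add, map_add, hX, hY, map_add]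
      simp only [Prod.fst_add, Prod.snd_add, C.form.ham_add_right, Prod.mk_add_mk, Prod.mk.injEq,
        smul_add, true_and]
      abel
  right a X := by
    induction X using BTensor.induction with
    | h0 => simp [C.form.ham_zero_right, Prod.ext_iff]
    | ht m η =>
      rw [BTensor.right_smul_tmul, tensorHom_tmul, tensorHom_tmul]
      simp only [QForm.rsmul_fst, QForm.rsmul_snd, MulOpposite.unop_op, half_smul, map_add, map_sub,
        map_smul, LinearMap.add_apply, LinearMap.sub_apply, LinearMap.smul_apply, C.form_ham_tens,
        C.corr_smul_right, Prod.mk.injEq, true_and]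
      module
    | ha X Y hX hY =>
      rw [smul_add, map_add, hX, hY, map_add]
      simp only [Prod.fst_add, Prod.snd_add, C.form.ham_add_right, Prod.mk_add_mk, Prod.mk.injEq,
        smul_add, true_and]
      abel
  bijective := by
    constructor
    · rw [injective_iff_map_eq_zero]
      intro X hX
      obtain ⟨Y, rfl⟩ := exists_sum_tmul_dx X
      rw [tensorHom_sum, Prod.mk_eq_zero] at hX
      have h1 : ∀ n, (s.hom (Y n)).1 = 0 := fun n => congrFun hX.1 n
      have h2 : ∀ n, (s.hom (Y n)).2 = 0 := fun n => by
        have := congrFun hX.2 n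
        simpa [h1, C.corr_zero_left] using this
      have h3 : Y = 0 := funext fun n =>
        (injective_iff_map_eq_zero s.hom).1 s.bijective.1 _ (Prod.ext (h1 n) (h2 n))
      have : ∀ n, BTensor.tmul (QAlg S) (0 : M) (QForm.dx S n) = 0 := fun n =>
        DFunLike.congr_fun (map_zero (BTensor.tmulHom (QAlg S))) _
      simp [h3, this]
    · rintro ⟨X₁, X₂⟩
      choose Y hY using fun n => s.bijective.2 (X₁ n, 0)
      choose Z hZ using fun n => s.bijective.2
        (0, X₂ n - (∑ k, C.corr (X₁ k) (Pi.single k 1)) n)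
      refine ⟨∑ n, BTensor.tmul _ (Y n) (QForm.dx S n)
        + ∑ n, BTensor.tmul _ (Z n) (QForm.dx S n), ?_⟩
      rw [map_add, tensorHom_sum, tensorHom_sum]
      ext n
      · simp [hY, hZ]
      · simp [hY, hZ, C.corr_zero_left]

/-- The inverse of a symbol. -/
def inv : V × V →+ M := (AddEquiv.ofBijective s.hom s.bijective).symm.toAddMonoidHom

theorem hom_inv (v : V × V) : s.hom (s.inv v) = v :=
  (AddEquiv.ofBijective s.hom s.bijective).apply_symm_apply v

theorem ext {m m' : M} (h : s.hom m = s.hom m') : m = m' := s.bijective.1 h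

end Symbol

/-! ### Curvature and second covariant derivatives -/

variable (S) in
/-- The coordinate derivatives commute, the connection is torsion free and the bivector is
covariantly constant. -/
structure IsParallelPoisson : Prop where
  pd_comm : ∀ a b f, S.pd a (S.pd b f) = S.pd b (S.pd a f)
  symm : ∀ i j k, S.Γ i j k = S.Γ i k j
  nab_poisson : ∀ s i j, S.pd s (S.poisson i j)
    + ∑ k, S.Γ i s k * S.poisson k j + ∑ k, S.Γ j s k * S.poisson i k = 0

namespace CovModule

variable (C : CovModule S V)

/-- The commutator `[∇_a, ∇_b]`. -/
def R (a b : ι) (v : V) : V := C.nab a (C.nab b v) - C.nab b (C.nab a v)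

theorem R_add (a b : ι) (v w : V) : C.R a b (v + w) = C.R a b v + C.R a b w := by
  simp only [R, map_add]; abel

theorem R_zero (a b : ι) : C.R a b 0 = 0 := by simp [R]

theorem R_smul (h : IsParallelPoisson S) (a b : ι) (f : A) (v : V) :
    C.R a b (f • v) = f • C.R a b v := by
  simp only [R, C.nab_smul, map_add, h.pd_comm a b f]
  module

/-- Covariant differentiation passes through contraction with the parallel bivector. -/
theorem nab_poisson_sum (h : IsParallelPoisson S) (m : ι) (F : ι → ι → V) :
    C.nab m (∑ i, ∑ j, S.poisson i j • F i j) = ∑ i, ∑ j, S.poisson i j •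
      (C.nab m (F i j) - ∑ k, S.Γ k m i • F k j - ∑ k, S.Γ k m j • F i k) := by
  have h1 : ∀ i j, S.pd m (S.poisson i j)
      = - (∑ k, S.Γ i m k * S.poisson k j) - ∑ k, S.Γ j m k * S.poisson i k := fun i j => by
    linear_combination h.nab_poisson m i j
  have h2 : ∑ i, ∑ j, ∑ k, (S.Γ i m k * S.poisson k j) • F i j
      = ∑ i, ∑ j, ∑ k, (S.poisson i j * S.Γ k m i) • F k j := by
    rw [Finset.sum_comm, Finset.sum_congr rfl fun j _ => Finset.sum_comm, Finset.sum_comm]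
    exact Finset.sum_congr rfl fun i _ => Finset.sum_congr rfl fun j _ =>
      Finset.sum_congr rfl fun k _ => by rw [mul_comm]
  have h3 : ∑ i, ∑ j, ∑ k, (S.Γ j m k * S.poisson i k) • F i j
      = ∑ i, ∑ j, ∑ k, (S.poisson i j * S.Γ k m j) • F i k := by
    refine Finset.sum_congr rfl fun i _ => ?_
    rw [Finset.sum_comm]
    exact Finset.sum_congr rfl fun j _ => Finset.sum_congr rfl fun k _ => by rw [mul_comm]
  simp only [map_sum, C.nab_smul, h1, sub_smul, neg_smul, smul_sub, Finset.smul_sum,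
    Finset.sum_add_distrib, Finset.sum_sub_distrib, Finset.sum_neg_distrib, Finset.sum_smul,
    smul_smul, h2, h3]
  abel

end CovModule

variable (S) in
/-- `∇ ξ = dx^m ⊗ ∇_m ξ`; the first argument is the component of `∇_m ξ`, the second is `m`. -/
def grad (ξ : ι → A) : ι → ι → A := fun n m => S.cov m ξ n

variable (S) in
/-- `∇ X = dx^m ⊗ ∇_m X` for a two-tensor `X`. -/
def grad₂ (X : ι → ι → A) : ι → ι → ι → A := fun c b m => (covForm S).form.nab m X c b

variable (S) in
/-- `(1/2) ω^{ij} dx^m ⊗ [∇_j, ∇_m] ∇_i ξ`. -/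
def curvTerm (ξ : ι → A) : ι → ι → A := fun n m =>
  half A * ∑ i, ∑ j, S.poisson i j * (covForm S).R j m (S.cov i ξ) n

variable (S) in
/-- `(1/2) ω^{ij} dx^m ⊗ [∇_j, ∇_m] ∇_i X` for a two-tensor `X`. -/
def curvTerm₂ (X : ι → ι → A) : ι → ι → ι → A := fun c b m =>
  half A * ∑ i, ∑ j, S.poisson i j * (covForm S).form.R j m ((covForm S).form.nab i X) c b

variable (S) in
/-- `ω^{ij} ∂_i a dx^m ⊗ [∇_j, ∇_m] ξ`. -/
def hamCurv (a : A) (ξ : ι → A) : ι → ι → A := fun n m =>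
  ∑ i, ∑ j, S.poisson i j * S.pd i a * (covForm S).R j m ξ n

variable (S) in
/-- The `A`-linear map `ξ ⊗ η ↦ ω^{ij} η_i dx^m ⊗ [∇_j, ∇_m] ξ`. -/
def curvBraid (X : ι → ι → A) : ι → ι → A := fun n m =>
  ∑ i, ∑ j, S.poisson i j * (covForm S).R j m (X i) n

variable (S) in
/-- The classical differential of a function. -/
def dFun (a : A) : ι → A := fun i => S.pd i a

theorem grad_add (ξ η : ι → A) : grad S (ξ + η) = grad S ξ + grad S η := by
  ext n m; exact congrFun (S.cov_add m ξ η) n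

theorem grad_zero : grad S (0 : ι → A) = 0 := by
  ext n m; exact congrFun (map_zero ((covForm S).nab m)) n

theorem grad_sub (ξ η : ι → A) : grad S (ξ - η) = grad S ξ - grad S η := by
  ext n m; exact congrFun (map_sub ((covForm S).nab m) ξ η) n

theorem grad_smul (a : A) (ξ : ι → A) :
    grad S (a • ξ) = a • grad S ξ + tens ξ (dFun S a) := by
  ext n m
  simp only [grad, S.cov_smul, Pi.add_apply, Pi.smul_apply, tens_apply, dFun, smul_eq_mul]
  ring

theorem half_smul_half_add (ξ : ι → ι → A) : half A • ξ + half A • ξ = ξ := by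
  rw [← add_smul, half_add_half, one_smul]

theorem algebraMap_pd (i : ι) (c : ℂ) : S.pd i (algebraMap ℂ A c) = 0 :=
  (S.pd i).map_algebraMap c

theorem dFun_half : dFun S (half A) = 0 := by
  ext i; exact algebraMap_pd i _

theorem curvTerm_add (ξ η : ι → A) : curvTerm S (ξ + η) = curvTerm S ξ + curvTerm S η := by
  ext n m
  simp only [curvTerm, S.cov_add, CovModule.R_add, Pi.add_apply, mul_add, Finset.sum_add_distrib]

theorem curvTerm_smul (h : IsParallelPoisson S) (a : A) (ξ : ι → A) :
    curvTerm S (a • ξ) = a • curvTerm S ξ + half A • hamCurv S a ξ := by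
  ext n m
  simp only [curvTerm, hamCurv, S.cov_smul, CovModule.R_add, (covForm S).R_smul h, Pi.add_apply,
    Pi.smul_apply, smul_eq_mul, Finset.mul_sum, ← Finset.sum_add_distrib]
  exact Finset.sum_congr rfl fun i _ => Finset.sum_congr rfl fun j _ => by ring

/-- The Hessian `∇ da` is symmetric. -/
theorem cov_dFun_symm (h : IsParallelPoisson S) (a : A) (i m : ι) :
    S.cov m (dFun S a) i = S.cov i (dFun S a) m := by
  simp only [PatchData.cov, dFun, h.pd_comm m i, h.symm _ m i]

theorem nab_grad (h : IsParallelPoisson S) (i : ι) (ξ : ι → A) (n m : ι) :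
    (covForm S).form.nab i (grad S ξ) n m
      = S.cov i (S.cov m ξ) n - ∑ k, S.Γ k m i * S.cov k ξ n := by
  simp only [CovModule.form_nab, covForm_nab, Pi.sub_apply, Finset.sum_apply, Pi.smul_apply,
    smul_eq_mul, h.symm _ m i]
  simp only [PatchData.cov, grad]
  ring

theorem grad_covHam (h : IsParallelPoisson S) (a : A) (ξ : ι → A) :
    grad S (S.covHam a ξ) = (covForm S).form.ham a (grad S ξ)
      + ∑ i, ∑ j, S.poisson i j • tens (S.cov j ξ) (S.cov i (dFun S a)) - hamCurv S a ξ := by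
  have h0 : S.covHam a ξ = ∑ i, ∑ j, S.poisson i j • S.pd i a • S.cov j ξ := by
    ext n; simp [PatchData.covHam, mul_assoc]
  ext n m
  rw [grad, h0, ← covForm_nab, (covForm S).nab_poisson_sum h]
  simp only [CovModule.ham, hamCurv, Finset.sum_apply, Pi.add_apply, Pi.sub_apply, Pi.smul_apply,
    smul_eq_mul, tens_apply, nab_grad h, CovModule.R, covForm_nab, ← Finset.sum_add_distrib,
    ← Finset.sum_sub_distrib, S.cov_smul]
  refine Finset.sum_congr rfl fun i _ => Finset.sum_congr rfl fun j _ => ?_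
  have h1 : S.cov i (dFun S a) m = S.pd m (S.pd i a) - ∑ k, S.Γ k m i * S.pd k a := by
    rw [← cov_dFun_symm h]; rfl
  have h2 : ∑ k, S.Γ k m i * (S.pd k a * S.cov j ξ n)
      = (∑ k, S.Γ k m i * S.pd k a) * S.cov j ξ n := by
    rw [Finset.sum_mul]; exact Finset.sum_congr rfl fun k _ => by ring
  have h3 : ∑ k, S.Γ k m j * (S.pd i a * S.cov k ξ n)
      = S.pd i a * ∑ k, S.Γ k m j * S.cov k ξ n := by
    rw [Finset.mul_sum]; exact Finset.sum_congr rfl fun k _ => by ring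
  rw [h1, h2, h3]
  ring

/-- Exchange of the two factors of a two-tensor. -/
def flip₂ : (ι → ι → A) →ₗ[A] (ι → ι → A) where
  toFun X n m := X m n
  map_add' _ _ := rfl
  map_smul' _ _ := rfl

theorem flip₂_apply (X : ι → ι → A) (n m : ι) : flip₂ X n m = X m n := rfl

theorem flip₂_tens (ξ η : ι → A) : flip₂ (tens ξ η) = tens η ξ := by
  ext n m; simp [flip₂_apply, tens_apply, mul_comm]

theorem nab_flip₂ (j : ι) (X : ι → ι → A) :
    (covForm S).form.nab j (flip₂ X) = flip₂ ((covForm S).form.nab j X) := by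
  ext n m
  simp only [CovModule.form_nab, covForm_nab, flip₂_apply, Pi.sub_apply, Finset.sum_apply,
    Pi.smul_apply, smul_eq_mul, PatchData.cov]
  ring

theorem ham_flip₂ (a : A) (X : ι → ι → A) :
    (covForm S).form.ham a (flip₂ X) = flip₂ ((covForm S).form.ham a X) := by
  simp only [CovModule.ham, nab_flip₂, map_sum, map_smul]

theorem flip₂_corr (ξ η : ι → A) :
    flip₂ ((covForm S).corr ξ η) = - (covForm S).corr η ξ := by
  simp only [CovModule.corr, map_smul, map_sum, flip₂_tens, ← smul_neg]
  congr 1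
  rw [Finset.sum_comm, ← Finset.sum_neg_distrib]
  refine Finset.sum_congr rfl fun j _ => ?_
  rw [← Finset.sum_neg_distrib]
  refine Finset.sum_congr rfl fun i _ => ?_
  rw [S.poisson_antisymm, neg_smul]; rfl

theorem curvBraid_add (X Y : ι → ι → A) :
    curvBraid S (X + Y) = curvBraid S X + curvBraid S Y := by
  ext n m
  simp only [curvBraid, Pi.add_apply, CovModule.R_add, mul_add, Finset.sum_add_distrib]

theorem curvBraid_smul (h : IsParallelPoisson S) (a : A) (X : ι → ι → A) :
    curvBraid S (a • X) = a • curvBraid S X := by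
  ext n m
  simp only [curvBraid, Pi.smul_apply, (covForm S).R_smul h, smul_eq_mul, Finset.mul_sum]
  exact Finset.sum_congr rfl fun i _ => Finset.sum_congr rfl fun j _ => by ring

theorem curvBraid_zero : curvBraid S 0 = 0 := by
  ext n m; simp [curvBraid, CovModule.R_zero]

theorem curvBraid_tens (h : IsParallelPoisson S) (η ξ : ι → A) (n m : ι) :
    curvBraid S (tens η ξ) n m = ∑ i, ∑ j, S.poisson i j * (η i * (covForm S).R j m ξ n) := by
  simp only [curvBraid, tens_apply, (covForm S).R_smul h, Pi.smul_apply, smul_eq_mul]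

theorem curvBraid_tens_dFun (h : IsParallelPoisson S) (a : A) (ξ : ι → A) :
    curvBraid S (tens (dFun S a) ξ) = hamCurv S a ξ := by
  ext n m
  simp only [curvBraid_tens h, hamCurv, dFun, mul_assoc]

/-! ### The quantised connection -/

variable (S) in
/-- The symbol of `Ω¹ ⊗₁ Ω¹`. -/
abbrev symb₂ : Symbol S (QTensor S) (covForm S).form := (Symbol.form S).tensor

variable (S) in
/-- The symbol of `Ω¹ ⊗₁ Ω¹ ⊗₁ Ω¹`. -/
abbrev symb₃ : Symbol S (BTensor (QAlg S) (QTensor S) (QForm S)) (covForm S).form.form :=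
  (symb₂ S).tensor

theorem symb₂_tmul (ξ η : QForm S) : (symb₂ S).hom (BTensor.tmul _ ξ η) =
    (tens η.1 ξ.1, tens η.1 ξ.2 + tens η.2 ξ.1 + (covForm S).corr ξ.1 η.1) := rfl

theorem symb₃_tmul (X : QTensor S) (η : QForm S) : (symb₃ S).hom (BTensor.tmul _ X η) =
    (tens η.1 ((symb₂ S).hom X).1, tens η.1 ((symb₂ S).hom X).2 + tens η.2 ((symb₂ S).hom X).1
      + (covForm S).form.corr ((symb₂ S).hom X).1 η.1) := rfl

variable (S) in
/-- The symbol `∇ ξ + (λ/2) ω^{ij} dx^m ⊗ [∇_j, ∇_m] ∇_i ξ` of the quantised connection. -/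
def nablaSymb : QForm S →+ (ι → ι → A) × (ι → ι → A) :=
  AddMonoidHom.mk' (fun ξ => (grad S ξ.1, grad S ξ.2 + curvTerm S ξ.1)) (fun ξ η => by
    simp only [QForm.add_fst, QForm.add_snd, grad_add, curvTerm_add, Prod.mk_add_mk,
      Prod.mk.injEq, true_and]
    abel)

theorem nablaSymb_apply (ξ : QForm S) :
    nablaSymb S ξ = (grad S ξ.1, grad S ξ.2 + curvTerm S ξ.1) := rfl

variable (S) in
/-- The symbol of the generalised braiding: the flip, corrected by the curvature. -/
def braidSymb : (ι → ι → A) × (ι → ι → A) →+ (ι → ι → A) × (ι → ι → A) :=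
  AddMonoidHom.mk' (fun X => (flip₂ X.1, flip₂ X.2 + curvBraid S X.1)) (fun X Y => by
    simp only [Prod.fst_add, Prod.snd_add, map_add, curvBraid_add, Prod.mk_add_mk,
      Prod.mk.injEq, true_and]
    abel)

theorem braidSymb_apply (X : (ι → ι → A) × (ι → ι → A)) :
    braidSymb S X = (flip₂ X.1, flip₂ X.2 + curvBraid S X.1) := rfl

theorem qd_fst (a : QAlg S) : (qd S a).1 = dFun S a.1 := rfl
theorem qd_snd (a : QAlg S) : (qd S a).2 = dFun S a.2 := rfl

theorem corr_dFun (a : A) (ξ : ι → A) : (covForm S).corr (dFun S a) ξ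
    = half A • ∑ i, ∑ j, S.poisson i j • tens (S.cov j ξ) (S.cov i (dFun S a)) := rfl

/-- The quantisation of the classical connection, as a bimodule connection. -/
def quantConn (h : IsParallelPoisson S) : BimoduleConnection (qd S) where
  nabla := (symb₂ S).inv.comp (nablaSymb S)
  braiding := ((symb₂ S).inv.comp (braidSymb S)).comp (symb₂ S).hom
  braiding_left a X := by
    apply (symb₂ S).ext
    simp only [AddMonoidHom.comp_apply, Symbol.hom_inv, (symb₂ S).left, braidSymb_apply, map_add,
      map_smul, ham_flip₂, curvBraid_smul h, Prod.mk.injEq, true_and]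
    module
  braiding_right X a := by
    apply (symb₂ S).ext
    simp only [AddMonoidHom.comp_apply, Symbol.hom_inv, (symb₂ S).right, braidSymb_apply, map_add,
      map_sub, map_smul, ham_flip₂, curvBraid_smul h, Prod.mk.injEq, true_and]
    module
  leibniz_left a ξ := by
    apply (symb₂ S).ext
    rw [map_add]
    simp only [AddMonoidHom.comp_apply, Symbol.hom_inv, (symb₂ S).left, symb₂_tmul,
      nablaSymb_apply, qd_fst, qd_snd, QForm.smul_fst, QForm.smul_snd, grad_add, grad_smul,
      half_smul, dFun_half, map_zero, add_zero, grad_covHam h, curvTerm_smul h, corr_dFun,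
      Prod.mk_add_mk, Prod.mk.injEq, true_and]
    module
  leibniz_right ξ a := by
    apply (symb₂ S).ext
    have h2 := half_smul_half_add (hamCurv S a.1 ξ.1)
    rw [map_add]
    simp only [AddMonoidHom.comp_apply, Symbol.hom_inv, (symb₂ S).right, symb₂_tmul,
      nablaSymb_apply, braidSymb_apply, qd_fst, qd_snd, QForm.rsmul_fst, QForm.rsmul_snd,
      MulOpposite.unop_op, grad_add, grad_sub, grad_smul, map_add, flip₂_tens, flip₂_corr,
      curvBraid_tens_dFun h,
      half_smul, dFun_half, map_zero, add_zero, grad_covHam h, curvTerm_smul h, corr_dFun,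
      Prod.mk_add_mk, Prod.mk.injEq, true_and]
    linear_combination (norm := module) (1 : A) • h2

theorem symb₂_nabla (h : IsParallelPoisson S) (ξ : QForm S) :
    (symb₂ S).hom ((quantConn h).nabla ξ) = (grad S ξ.1, grad S ξ.2 + curvTerm S ξ.1) :=
  (symb₂ S).hom_inv _

theorem symb₂_braiding (h : IsParallelPoisson S) (X : QTensor S) :
    (symb₂ S).hom ((quantConn h).braiding X) = (flip₂ ((symb₂ S).hom X).1,
      flip₂ ((symb₂ S).hom X).2 + curvBraid S ((symb₂ S).hom X).1) :=
  (symb₂ S).hom_inv _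

/-! ### The induced connection on two-tensors -/

/-- The tensor `ξ ⊗ X` for a one-form `ξ` and a two-tensor `X`. -/
def preTens : (ι → A) →ₗ[A] (ι → ι → A) →ₗ[A] (ι → ι → ι → A) :=
  LinearMap.mk₂ A (fun ξ X c b a => ξ a * X c b)
    (fun ξ ξ' X => by ext c b a; exact add_mul _ _ _)
    (fun r ξ X => by ext c b a; exact mul_assoc _ _ _)
    (fun ξ X X' => by ext c b a; exact mul_add _ _ _)
    (fun r ξ X => by ext c b a; exact mul_left_comm _ _ _)

theorem preTens_apply (ξ : ι → A) (X : ι → ι → A) (c b a : ι) :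
    preTens ξ X c b a = ξ a * X c b := rfl

theorem preTens_tens (ξ ζ η : ι → A) : preTens ξ (tens η ζ) = tens η (tens ζ ξ) := by
  ext c b a
  simp only [preTens_apply, tens_apply, Pi.smul_apply, smul_eq_mul]
  ring

/-- Exchange of the first two factors of a three-tensor. -/
def flip₁₂ : (ι → ι → ι → A) →ₗ[A] (ι → ι → ι → A) where
  toFun Z c := flip₂ (Z c)
  map_add' _ _ := rfl
  map_smul' _ _ := rfl

theorem flip₁₂_apply (Z : ι → ι → ι → A) (c b a : ι) : flip₁₂ Z c b a = Z c a b := rfl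

theorem flip₁₂_tens (η : ι → A) (X : ι → ι → A) : flip₁₂ (tens η X) = tens η (flip₂ X) := rfl

theorem form_corr_flip₂ (X : ι → ι → A) (η : ι → A) :
    (covForm S).form.corr (flip₂ X) η = flip₁₂ ((covForm S).form.corr X η) := by
  simp only [CovModule.corr, nab_flip₂, map_sum, map_smul, flip₁₂_tens]

theorem symb₃_prepend (ξ : QForm S) (X : QTensor S) :
    (symb₃ S).hom (BTensor.prepend ξ X) = (preTens ξ.1 ((symb₂ S).hom X).1,
      preTens ξ.1 ((symb₂ S).hom X).2 + preTens ξ.2 ((symb₂ S).hom X).1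
        + half A • ∑ i, ∑ j, S.poisson i j •
          preTens (S.cov i ξ.1) ((covForm S).form.nab j ((symb₂ S).hom X).1)) := by
  induction X using BTensor.induction with
  | h0 => simp only [map_zero, Prod.fst_zero, Prod.snd_zero, smul_zero, Finset.sum_const_zero,
      add_zero]; rfl
  | ht ζ η =>
    have h : BTensor.prepend ξ (BTensor.tmul (QAlg S) ζ η)
      = BTensor.tmul (QAlg S) (BTensor.tmul (QAlg S) ξ ζ) η := rfl
    rw [h, symb₃_tmul]
    simp only [symb₂_tmul, map_add, preTens_tens, CovModule.form_nab_tens, CovModule.corr, map_sum,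
      map_smul, covForm_nab, smul_add, Finset.sum_add_distrib, Prod.mk.injEq, true_and]
    module
  | ha X Y hX hY =>
    rw [map_add, map_add, hX, hY, map_add]
    simp only [Prod.fst_add, Prod.snd_add, map_add, smul_add, Finset.sum_add_distrib,
      Prod.mk_add_mk, Prod.mk.injEq, true_and]
    abel

theorem symb₃_mapLeft_braiding (h : IsParallelPoisson S)
    (Z : BTensor (QAlg S) (QTensor S) (QForm S)) :
    (symb₃ S).hom (BTensor.mapLeft (quantConn h).braiding (quantConn h).braiding_right Z)
      = (flip₁₂ ((symb₃ S).hom Z).1,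
        flip₁₂ ((symb₃ S).hom Z).2 + fun c => curvBraid S (((symb₃ S).hom Z).1 c)) := by
  induction Z using BTensor.induction with
  | h0 =>
    simp only [map_zero, Prod.fst_zero, Prod.snd_zero, Pi.zero_apply, curvBraid_zero, zero_add]; rfl
  | ht X η =>
    have e : BTensor.mapLeft (quantConn h).braiding (quantConn h).braiding_right
      (BTensor.tmul (QAlg S) X η) = BTensor.tmul (QAlg S) ((quantConn h).braiding X) η := rfl
    have e2 : ∀ X : ι → ι → A, (fun c => curvBraid S (tens η.1 X c))
        = tens η.1 (curvBraid S X) := fun X => by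
      ext1 c; exact curvBraid_smul h _ _
    rw [e, symb₃_tmul, symb₃_tmul, symb₂_braiding]
    simp only [map_add, flip₁₂_tens, form_corr_flip₂, e2, Prod.mk.injEq, true_and]
    abel
  | ha X Y hX hY =>
    have e2 : ∀ X Y : ι → ι → ι → A, (fun c => curvBraid S ((X + Y) c))
        = (fun c => curvBraid S (X c)) + fun c => curvBraid S (Y c) := fun X Y => by
      ext1 c; exact curvBraid_add _ _
    rw [map_add, map_add, hX, hY, map_add]
    simp only [Prod.fst_add, Prod.snd_add, map_add, e2, Prod.mk_add_mk, Prod.mk.injEq, true_and]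
    abel

theorem grad₂_add (X Y : ι → ι → A) : grad₂ S (X + Y) = grad₂ S X + grad₂ S Y := by
  ext c b m
  simp only [grad₂, map_add, Pi.add_apply]

theorem grad₂_tens (η ξ : ι → A) :
    grad₂ S (tens η ξ) = tens η (grad S ξ) + flip₁₂ (preTens ξ (grad S η)) := by
  ext c b m
  simp only [grad₂, CovModule.form_nab_tens, Pi.add_apply, flip₁₂_apply, preTens_apply, tens_apply,
    Pi.smul_apply, smul_eq_mul, covForm_nab, grad]
  ring

theorem curvTerm₂_add (X Y : ι → ι → A) :
    curvTerm₂ S (X + Y) = curvTerm₂ S X + curvTerm₂ S Y := by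
  ext c b m
  simp only [curvTerm₂, map_add, CovModule.R_add, Pi.add_apply, mul_add, Finset.sum_add_distrib]

theorem R_tens (a b : ι) (η ξ : ι → A) :
    (covForm S).form.R a b (tens η ξ)
      = tens ((covForm S).R a b η) ξ + tens η ((covForm S).R a b ξ) := by
  simp only [CovModule.R, CovModule.form_nab_tens, map_add, map_sub, LinearMap.sub_apply,
    covForm_nab]
  abel

theorem sum_poisson_antisymm (F : ι → ι → A) :
    ∑ i, ∑ j, S.poisson i j * F i j
      = half A * ∑ i, ∑ j, S.poisson i j * (F i j - F j i) := by
  have h : ∑ i, ∑ j, S.poisson i j * F j i = - ∑ i, ∑ j, S.poisson i j * F i j := by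
    rw [Finset.sum_comm, ← Finset.sum_neg_distrib]
    refine Finset.sum_congr rfl fun j _ => ?_
    rw [← Finset.sum_neg_distrib]
    refine Finset.sum_congr rfl fun i _ => ?_
    rw [S.poisson_antisymm]; ring
  simp only [mul_sub, Finset.sum_sub_distrib, h]
  linear_combination (-∑ i, ∑ j, S.poisson i j * F i j) * half_add_half (A := A)

/-- The covariant derivative of the correction term of the quantised tensor product. -/
theorem grad₂_corr (h : IsParallelPoisson S) (ξ η : ι → A) :
    grad₂ S ((covForm S).corr ξ η) + curvTerm₂ S (tens η ξ)
      = tens η (curvTerm S ξ) + (covForm S).form.corr (grad S ξ) η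
        + flip₁₂ (preTens ξ (curvTerm S η)
          + half A • ∑ i, ∑ j, S.poisson i j •
            preTens (S.cov i ξ) ((covForm S).form.nab j (grad S η)))
        + fun c => curvBraid S (preTens ξ (grad S η) c) := by
  have e1 : ∀ c, preTens ξ (grad S η) c = tens (grad S η c) ξ := fun c => by
    ext b a; simp only [preTens_apply, tens_apply, Pi.smul_apply, smul_eq_mul]; ring
  have e2 : ∀ m, (covForm S).form.nab m (half A • ∑ i, ∑ j, S.poisson i j •
      tens (S.cov j η) (S.cov i ξ)) = half A • (covForm S).form.nab m (∑ i, ∑ j, S.poisson i j •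
      tens (S.cov j η) (S.cov i ξ)) := fun m => by
    rw [CovModule.nab_smul, half, algebraMap_pd, zero_smul, zero_add]
  ext c b m
  simp only [Pi.add_apply, grad₂, CovModule.corr, covForm_nab, e2, e1,
    (covForm S).form.nab_poisson_sum h, map_add, flip₁₂_apply, Pi.smul_apply, Finset.sum_apply,
    smul_eq_mul, curvTerm₂, curvTerm, tens_apply, preTens_apply, curvBraid_tens h,
    CovModule.form_nab_tens, CovModule.R_add, R_tens, nab_grad h, grad, Pi.sub_apply]
  rw [sum_poisson_antisymm fun i j => S.cov i η c * (covForm S).R j m ξ b]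
  simp only [Finset.mul_sum, ← Finset.sum_add_distrib]
  refine Finset.sum_congr rfl fun i _ => Finset.sum_congr rfl fun j _ => ?_
  have h1 : ∑ k, S.Γ k m i * (S.cov j η c * S.cov k ξ b)
      = S.cov j η c * ∑ k, S.Γ k m i * S.cov k ξ b := by
    rw [Finset.mul_sum]; exact Finset.sum_congr rfl fun k _ => by ring
  have h2 : ∑ k, S.Γ k m j * (S.cov k η c * S.cov i ξ b)
      = S.cov i ξ b * ∑ k, S.Γ k m j * S.cov k η c := by
    rw [Finset.mul_sum]; exact Finset.sum_congr rfl fun k _ => by ring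
  rw [h1, h2]
  simp only [CovModule.R, covForm_nab, Pi.sub_apply]
  ring

/-- On symbols, the connection induced on `Ω¹ ⊗₁ Ω¹` has the same form as the connection on `Ω¹`:
the terms coming from the braiding, the product and the curvature add up to the curvature of the
tensor product. -/
theorem symb₃_tensorNabla (h : IsParallelPoisson S) (X : QTensor S) :
    (symb₃ S).hom ((quantConn h).tensorNabla X) = (grad₂ S ((symb₂ S).hom X).1,
      grad₂ S ((symb₂ S).hom X).2 + curvTerm₂ S ((symb₂ S).hom X).1) := by
  induction X using BTensor.induction with
  | h0 =>
    have h1 : grad₂ S 0 = 0 := by ext; simp [grad₂]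
    have h2 : curvTerm₂ S 0 = 0 := by ext; simp [curvTerm₂, CovModule.R_zero]
    simp only [map_zero, Prod.fst_zero, Prod.snd_zero, h1, h2, add_zero]; rfl
  | ht ξ η =>
    have e : (quantConn h).tensorNabla (BTensor.tmul (QAlg S) ξ η)
      = BTensor.tmul (QAlg S) ((quantConn h).nabla ξ) η
        + BTensor.mapLeft (quantConn h).braiding (quantConn h).braiding_right
          (BTensor.prepend ξ ((quantConn h).nabla η)) := rfl
    have h3 := grad₂_corr h ξ.1 η.1
    rw [e, map_add, symb₃_tmul, symb₃_mapLeft_braiding, symb₃_prepend, symb₂_nabla, symb₂_nabla,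
      symb₂_tmul]
    simp only [map_add, grad₂_add, grad₂_tens, Prod.mk_add_mk, Prod.mk.injEq, true_and]
    rw [map_add] at h3
    linear_combination (norm := module) (-1 : A) • h3
  | ha X Y hX hY =>
    rw [map_add, map_add, hX, hY, map_add]
    simp only [Prod.fst_add, Prod.snd_add, grad₂_add, curvTerm₂_add, Prod.mk_add_mk, Prod.mk.injEq,
      true_and]
    abel

/-! ### The quantum wedge product and the quantum torsion -/

theorem R_covForm_apply (h : IsParallelPoisson S) (a b : ι) (ξ : ι → A) (d : ι) :
    (covForm S).R a b ξ d = - ∑ c, S.curv c d a b * ξ c := by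
  have h1 : ∀ a b, S.cov a (S.cov b ξ) d = S.pd a (S.pd b (ξ d))
      - ∑ k, S.pd a (S.Γ k b d) * ξ k - ∑ k, S.Γ k b d * S.pd a (ξ k)
      - ∑ k, S.Γ k a d * S.pd b (ξ k) + ∑ c, ∑ k, S.Γ c b k * S.Γ k a d * ξ c := fun a b => by
    have : ∑ c, ∑ k, S.Γ c b k * S.Γ k a d * ξ c = ∑ k, S.Γ k a d * ∑ c, S.Γ c b k * ξ c := by
      rw [Finset.sum_comm]
      simp only [Finset.mul_sum]
      exact Finset.sum_congr rfl fun k _ => Finset.sum_congr rfl fun c _ => by ring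
    rw [this]
    simp only [PatchData.cov, map_sub, map_sum, Derivation.leibniz, smul_eq_mul, mul_sub,
      Finset.sum_sub_distrib, Finset.sum_add_distrib, mul_comm (ξ _)]
    ring
  have h2 : ∑ c, S.curv c d a b * ξ c
      = ∑ k, S.pd a (S.Γ k b d) * ξ k - ∑ k, S.pd b (S.Γ k a d) * ξ k
        + (∑ c, ∑ k, S.Γ c a k * S.Γ k b d * ξ c - ∑ c, ∑ k, S.Γ c b k * S.Γ k a d * ξ c) := by
    simp only [PatchData.curv, add_mul, sub_mul, Finset.sum_mul, Finset.sum_add_distrib,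
      Finset.sum_sub_distrib]
  rw [CovModule.R, Pi.sub_apply, covForm_nab, covForm_nab, covForm_nab, covForm_nab, h1, h1, h2,
    h.pd_comm a b]
  ring

/-- The value of the two-form `H^{ij}` for a torsion-free connection. -/
theorem H_apply (h : IsParallelPoisson S) (i j a b : ι) :
    S.H i j a b = half A * ∑ s, S.poisson i s * (S.curv j a b s - S.curv j b a s) := by
  have h0 : ∀ i j k, S.torsion i j k = 0 := fun i j k => by
    rw [PatchData.torsion, h.symm, sub_self]
  have h1 : ∀ j n m s, S.covTorsion j n m s = 0 := fun j n m s => by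
    simp [PatchData.covTorsion, h0]
  have h2 : ∀ x : A, (1 / 4 : ℂ) • (x * 2) = half A * x := fun x => by
    rw [Algebra.smul_def, half]
    have : (2 : A) = algebraMap ℂ A 2 := (map_ofNat (algebraMap ℂ A) 2).symm
    rw [this, mul_comm x, ← mul_assoc, ← map_mul]
    norm_num
  have h3 : ∀ m n, ∑ s, (1 / 4 : ℂ) • (S.poisson i s * (S.covTorsion j n m s - 2 * S.curv j n m s))
      = - (half A * ∑ s, S.poisson i s * S.curv j n m s) := fun m n => by
    rw [Finset.mul_sum, ← Finset.sum_neg_distrib]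
    refine Finset.sum_congr rfl fun s _ => ?_
    rw [h1, ← h2, ← smul_neg]; congr 1; ring
  have h4 : S.H i j = ∑ m, ∑ n, (- (half A * ∑ s, S.poisson i s * S.curv j n m s)) •
      PatchData.wedge (Pi.single m (1 : A)) (Pi.single n (1 : A)) := by
    simp only [PatchData.H, ← h3, Finset.sum_smul]
  rw [h4]
  simp only [Finset.sum_apply, Pi.smul_apply, PatchData.wedge, Pi.single_apply, smul_eq_mul,
    mul_ite, mul_one, mul_zero, mul_sub, Finset.sum_sub_distrib, Finset.sum_ite_eq,
    Finset.mem_univ, if_true]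
  ring

/-- Antisymmetrisation `dx^m ⊗ dx^n ↦ dx^m ∧ dx^n`, on components. -/
def alt : (ι → ι → A) →ₗ[A] (ι → ι → A) where
  toFun X a b := X b a - X a b
  map_add' X Y := by ext a b; simp only [Pi.add_apply]; ring
  map_smul' r X := by ext a b; simp only [Pi.smul_apply, smul_eq_mul, RingHom.id_apply]; ring

theorem alt_apply (X : ι → ι → A) (a b : ι) : alt X a b = X b a - X a b := rfl

theorem alt_tens (ξ η : ι → A) : alt (tens η ξ) = PatchData.wedge ξ η := by
  ext a b
  simp only [alt_apply, tens_apply, PatchData.wedge, Pi.smul_apply, smul_eq_mul]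
  ring

/-- On symbols, `∧₁` is the classical antisymmetrisation corrected by contraction with `H^{ij}`. -/
theorem qWedge_eq (X : QTensor S) : qWedge S X = (alt ((symb₂ S).hom X).1,
    alt ((symb₂ S).hom X).2 + ∑ i, ∑ j, ((symb₂ S).hom X).1 j i • S.H i j) := by
  induction X using BTensor.induction with
  | h0 => simp [Prod.ext_iff]
  | ht ξ η =>
    have e : qWedge S (BTensor.tmul (QAlg S) ξ η) = (PatchData.wedge ξ.1 η.1,
      PatchData.wedge ξ.1 η.2 + PatchData.wedge ξ.2 η.1 + S.wedgeCorr ξ.1 η.1) := rfl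
    have e2 : (1 / 2 : ℂ) • ∑ i, ∑ j, S.poisson i j • PatchData.wedge (S.cov i ξ.1) (S.cov j η.1)
      = half A • ∑ i, ∑ j, S.poisson i j • PatchData.wedge (S.cov i ξ.1) (S.cov j η.1) :=
      (algebraMap_smul A (1 / 2 : ℂ) _).symm
    rw [e, symb₂_tmul]
    simp only [map_add, alt_tens, CovModule.corr, covForm_nab, map_smul, map_sum,
      PatchData.wedgeCorr, e2, tens_apply, Pi.smul_apply, smul_eq_mul, mul_comm (η.1 _),
      Prod.mk.injEq, true_and]
    abel
  | ha X Y hX hY =>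
    rw [map_add, hX, hY, map_add]
    simp only [Prod.fst_add, Prod.snd_add, map_add, Pi.add_apply, add_smul, Finset.sum_add_distrib,
      Prod.mk_add_mk, Prod.mk.injEq, true_and]
    abel

theorem curv_antisymm (c d a b : ι) : S.curv c d a b = - S.curv c d b a := by
  simp only [PatchData.curv, Finset.sum_sub_distrib]
  ring

/-- The curvature term of the quantised connection cancels the term with `H^{ij}` in `∧₁`; this is
why `∇_Q` is quantum torsion free. -/
theorem alt_curvTerm (h : IsParallelPoisson S) (ξ : ι → A) :
    alt (curvTerm S ξ) + ∑ i, ∑ j, grad S ξ j i • S.H i j = 0 := by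
  ext a b
  have h1 : ∀ i c, ∑ s, S.poisson i s * (S.curv c a b s - S.curv c b a s)
      = ∑ s, S.poisson i s * (S.curv c b s a - S.curv c a s b) := fun i c =>
    Finset.sum_congr rfl fun s _ => by rw [curv_antisymm c a b s, curv_antisymm c b a s]; ring
  have h2 : ∀ i, ∑ c, S.cov i ξ c
        * (half A * ∑ s, S.poisson i s * (S.curv c b s a - S.curv c a s b))
      = half A * ∑ s, S.poisson i s *
        (∑ c, S.curv c b s a * S.cov i ξ c - ∑ c, S.curv c a s b * S.cov i ξ c) := fun i => by
    simp only [← Finset.sum_sub_distrib, Finset.mul_sum]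
    rw [Finset.sum_comm]
    exact Finset.sum_congr rfl fun s _ => Finset.sum_congr rfl fun c _ => by ring
  simp only [Pi.add_apply, alt_apply, curvTerm, R_covForm_apply h, Finset.sum_apply, Pi.smul_apply,
    smul_eq_mul, H_apply h, grad, h1, h2, Pi.zero_apply, ← Finset.mul_sum, ← mul_sub, ← mul_add,
    ← Finset.sum_sub_distrib, ← Finset.sum_add_distrib]
  convert mul_zero _
  refine Finset.sum_eq_zero fun i _ => Finset.sum_eq_zero fun j _ => ?_
  rw [Finset.sum_sub_distrib]
  ring

theorem alt_grad (h : IsParallelPoisson S) (ξ : ι → A) :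
    alt (grad S ξ) = fun a b => S.pd a (ξ b) - S.pd b (ξ a) := by
  ext a b
  simp only [alt_apply, grad, PatchData.cov, h.symm _ a b]
  ring

theorem quantConn_torsionFree (h : IsParallelPoisson S) (ξ : QForm S) :
    qWedge S ((quantConn h).nabla ξ) = qd₁ S ξ := by
  rw [qWedge_eq, symb₂_nabla]
  have h1 := alt_curvTerm h ξ.1
  simp only [map_add, add_assoc, h1, add_zero, alt_grad h]
  rfl

/-! ### Quantised tensors with given coefficients -/

theorem const_mul_lam (c : ℂ) : QAlg.const S c * QAlg.lam S = lamAlg S (algebraMap ℂ A c) := by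
  ext1
  · exact mul_zero _
  · rw [QAlg.mul_snd]
    change algebraMap ℂ A c * 1 + 0 * 0 + (1 / 2 : ℂ) • S.bracket (algebraMap ℂ A c) 0 = _
    rw [S.bracket_zero_right, smul_zero, mul_one, mul_zero, add_zero, add_zero]
    rfl

theorem Symbol.lamAlg_smul {M : Type*} [AddCommGroup M] [Module (QAlg S) M]
    [Module (QAlg S)ᵐᵒᵖ M] [SMulCommClass (QAlg S) (QAlg S)ᵐᵒᵖ M] {C : CovModule S V}
    (s : Symbol S M C) (a : A) (m : M) : s.hom (lamAlg S a • m) = (0, a • (s.hom m).1) := by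
  rw [s.left]
  simp only [lamAlg_fst, lamAlg_snd, zero_smul, C.ham_zero_left, smul_zero, zero_add, add_zero]

theorem symb₂_ofCoeff (c : ι → ι → A) : (symb₂ S).hom (QTensor.ofCoeff S c)
    = (flip₂ c, ∑ n, (covForm S).corr (fun m => c m n) (Pi.single n 1)) := by
  have h := (Symbol.form S).tensorHom_sum (fun n => QForm.of S fun m => c m n)
  have h2 : (symb₂ S).hom (QTensor.ofCoeff S c)
    = (fun n => (fun m => c m n), (fun _ => 0) + ∑ n, (covForm S).corr (fun m => c m n)
      (Pi.single n 1)) := h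
  rw [h2, ← Pi.zero_def, zero_add]
  rfl

theorem cov_single (j n q : ι) : S.cov j (Pi.single n 1) q = - S.Γ n j q := by
  have : ∀ m, S.pd j ((Pi.single n 1 : ι → A) m) = 0 := fun m => by
    by_cases hm : m = n
    · subst hm; simp
    · simp [Pi.single_eq_of_ne hm]
  rw [PatchData.cov, this]
  simp only [Pi.single_apply, mul_ite, mul_one, mul_zero,
    Finset.sum_ite_eq', Finset.mem_univ, if_true, zero_sub]

theorem corr_coeff (c : ι → ι → A) (q m : ι) :
    (∑ n, (covForm S).corr (fun m => c m n) (Pi.single n 1)) q m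
      = - (half A * ∑ i, ∑ j, S.poisson i j * ∑ n, S.Γ n j q * S.cov i (fun m => c m n) m) := by
  simp only [CovModule.corr, covForm_nab, Finset.sum_apply, Pi.smul_apply, smul_eq_mul, tens_apply,
    cov_single, Finset.mul_sum, ← Finset.sum_neg_distrib]
  rw [Finset.sum_comm]
  refine Finset.sum_congr rfl fun i _ => ?_
  rw [Finset.sum_comm]
  exact Finset.sum_congr rfl fun j _ => Finset.sum_congr rfl fun n _ => by ring

/-- For a parallel symmetric tensor `g`, the correction in `g_Q` is that of the quantisation
functor. -/
theorem symb₂_metricQ {g : ι → ι → A} (h : IsParallelPoisson S) (hg : ∀ a b, g a b = g b a)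
    (hn : ∀ s, S.cov₂ s g = 0) : (symb₂ S).hom (metricQ S g) = (g, 0) := by
  have hgt : flip₂ g = g := by ext n m; exact hg m n
  have hc : ∀ i n m, S.cov i (fun m => g m n) m = ∑ p, S.Γ p i n * g p m := fun i n m => by
    have := congrFun (congrFun (hn i) m) n
    simp only [PatchData.cov₂, Pi.zero_apply] at this
    simp only [PatchData.cov, hg _ m]
    linear_combination this
  rw [metricQ, map_add, const_mul_lam, Symbol.lamAlg_smul, symb₂_ofCoeff, symb₂_ofCoeff, hgt,
    Prod.mk_add_mk, add_zero]
  congr 1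
  ext q m
  rw [Pi.add_apply, Pi.add_apply, corr_coeff]
  simp only [hc, Pi.smul_apply, flip₂_apply, smul_eq_mul, Pi.zero_apply]
  rw [neg_add_eq_zero]
  change half A * _ = half A * _
  congr 1
  refine Finset.sum_congr rfl fun i _ => Finset.sum_congr rfl fun j _ => ?_
  simp only [Finset.mul_sum]
  rw [Finset.sum_comm]
  refine Finset.sum_congr rfl fun p _ => Finset.sum_congr rfl fun n _ => ?_
  rw [h.symm p i n, h.symm n j q]
  ring_nf

theorem symb₂_quantumMetric {g : ι → ι → A} (h : IsParallelPoisson S) (hg : ∀ a b, g a b = g b a)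
    (hn : ∀ s, S.cov₂ s g = 0) : (symb₂ S).hom (quantumMetric S g)
      = (g, - (half A • flip₂ (genRicci S g))) := by
  rw [quantumMetric, map_sub, symb₂_metricQ h hg hn, const_mul_lam, Symbol.lamAlg_smul,
    symb₂_ofCoeff, Prod.mk_sub_mk, sub_zero, zero_sub]
  rfl

/-- On `dx^l` the symbol of `∇_Q` is `∇ dx^l` with the curvature term. The remaining terms of the
prescribed values undo the correction in the symbol of `Γ^l_{mn} dx^m ⊗₁ dx^n`. -/
theorem quantConn_isNablaQ (h : IsParallelPoisson S) : IsNablaQ S (quantConn h) := by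
  intro l
  apply (symb₂ S).ext
  have h1 : grad S (Pi.single l 1) = - flip₂ (fun m n => S.Γ l m n) := by
    ext n m; exact cov_single m l n
  rw [symb₂_nabla, nablaQdx, map_neg, map_add, const_mul_lam, Symbol.lamAlg_smul, symb₂_ofCoeff,
    symb₂_ofCoeff, Prod.mk_add_mk, add_zero, dx_fst, dx_snd, h1, grad_zero, zero_add, Prod.neg_mk]
  congr 1
  ext q m
  rw [Pi.neg_apply, Pi.neg_apply, Pi.add_apply, Pi.add_apply, corr_coeff]
  simp only [Pi.smul_apply, flip₂_apply, smul_eq_mul]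
  change half A * _ = -(-(half A * _) + half A * _)
  rw [neg_add, neg_neg, ← sub_eq_add_neg, ← mul_sub]
  congr 1
  have e1 : ∀ i j, ∑ n, S.Γ n j q * S.cov i (fun m => S.Γ l m n) m
      = ∑ k, S.pd i (S.Γ l m k) * S.Γ k j q
        - ∑ k, ∑ t, S.Γ l k t * S.Γ k i m * S.Γ t j q := fun i j => by
    rw [Finset.sum_comm, ← Finset.sum_sub_distrib]
    refine Finset.sum_congr rfl fun n _ => ?_
    rw [PatchData.cov, mul_sub, Finset.mul_sum, mul_comm]
    congr 1
    exact Finset.sum_congr rfl fun k _ => by ring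
  have e2 : ∀ i j, (covForm S).R j m (S.cov i (Pi.single l 1)) q
      = ∑ k, S.Γ l i k * S.curv k q j m := fun i j => by
    rw [R_covForm_apply h, ← Finset.sum_neg_distrib]
    exact Finset.sum_congr rfl fun k _ => by rw [cov_single]; ring
  simp only [e1, e2, ← Finset.sum_sub_distrib, ← mul_sub, sub_sub_cancel]
  rw [Finset.sum_comm]
  refine Finset.sum_congr rfl fun j _ => Finset.sum_congr rfl fun i _ => ?_
  rw [S.poisson_antisymm, neg_mul, ← mul_neg, ← Finset.sum_neg_distrib]
  congr 1
  exact Finset.sum_congr rfl fun k _ => by rw [curv_antisymm]; ring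

/-! ### Uniqueness of the quantum Levi-Civita connection -/

theorem qd_of_coord {x : ι → A} (hx : ∀ n, dFun S (x n) = Pi.single n 1) (n : ι) :
    qd S (QAlg.of S (x n)) = QForm.dx S n := by
  ext1
  · exact hx n
  · ext i; exact map_zero (S.pd i)

/-- The generalised braiding of a bimodule connection is determined by the connection. -/
theorem bimoduleConnection_ext {x : ι → A} (hx : ∀ n, dFun S (x n) = Pi.single n 1)
    {D D' : BimoduleConnection (qd S)} (h : ∀ ξ, D.nabla ξ = D'.nabla ξ) : D = D' := by
  have hn : D.nabla = D'.nabla := AddMonoidHom.ext h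
  refine BimoduleConnection.ext hn (AddMonoidHom.ext fun X => ?_)
  obtain ⟨Y, rfl⟩ := Symbol.exists_sum_tmul_dx X
  rw [map_sum, map_sum]
  refine Finset.sum_congr rfl fun n _ => ?_
  rw [← qd_of_coord hx n]
  have e := D.leibniz_right (Y n) (QAlg.of S (x n))
  have e' := D'.leibniz_right (Y n) (QAlg.of S (x n))
  rw [h, h, e'] at e
  exact (add_left_cancel e).symm

/-- The difference of two connections is left linear, hence determined on the `dx^n`. -/
theorem nabla_sub_eq_sum (D D' : BimoduleConnection (qd S)) {ξ : QForm S} {b : ι → QAlg S}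
    (hb : ξ = ∑ n, b n • QForm.dx S n) : D'.nabla ξ - D.nabla ξ
      = ∑ n, b n • (D'.nabla (QForm.dx S n) - D.nabla (QForm.dx S n)) := by
  rw [hb, map_sum, map_sum, ← Finset.sum_sub_distrib]
  refine Finset.sum_congr rfl fun n _ => ?_
  rw [D'.leibniz_left, D.leibniz_left, smul_sub]
  abel

theorem isNablaQ_unique {x : ι → A} (hx : ∀ n, dFun S (x n) = Pi.single n 1)
    {D D' : BimoduleConnection (qd S)} (h : IsNablaQ S D) (h' : IsNablaQ S D') : D' = D := by
  refine bimoduleConnection_ext hx fun ξ => sub_eq_zero.1 ?_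
  obtain ⟨b, -, hb⟩ := exists_sum_smul_dx ξ
  rw [nabla_sub_eq_sum D D' hb]
  exact Finset.sum_eq_zero fun n _ => by rw [h n, h' n, sub_self, smul_zero]

theorem lamForm_eq_smul (ζ : ι → A) : lamForm S ζ = lamAlg S 1 • QForm.of S ζ := by
  ext1
  · simp only [QForm.smul_fst, lamForm_fst, lamAlg_fst, zero_smul]
  · simp only [QForm.smul_snd, lamForm_snd, lamAlg_fst, lamAlg_snd, form_of_fst, form_of_snd,
      S.covHam_zero_left, smul_zero, zero_add, add_zero, one_smul]

theorem qd_lamAlg_one : qd S (lamAlg S 1) = 0 := by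
  ext1
  · ext i; exact map_zero (S.pd i)
  · ext i; exact (S.pd i).map_one_eq_zero

theorem tmul_zero_left (ξ : QForm S) : BTensor.tmul (QAlg S) (0 : QForm S) ξ = 0 :=
  DFunLike.congr_fun (map_zero (BTensor.tmulHom (QAlg S))) ξ

theorem nabla_lamForm (D : BimoduleConnection (qd S)) (ζ : ι → A) :
    D.nabla (lamForm S ζ) = lamAlg S 1 • D.nabla (QForm.of S ζ) := by
  rw [lamForm_eq_smul, D.leibniz_left, qd_lamAlg_one, tmul_zero_left, add_zero]

theorem rsmul_eq_smul_sub (ξ : QForm S) (a : QAlg S) :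
    ξ <• a = a • ξ - lamForm S (S.covHam a.1 ξ.1) := by
  have hh : S.covHam a.1 ξ.1
      = half A • S.covHam a.1 ξ.1 + half A • S.covHam a.1 ξ.1 := by
    rw [← add_smul, half_add_half, one_smul]
  rw [eq_sub_iff_add_eq]
  ext1
  · simp only [QForm.add_fst, QForm.smul_fst, QForm.rsmul_fst, lamForm_fst, add_zero,
      MulOpposite.unop_op]
  · simp only [QForm.add_snd, QForm.smul_snd, QForm.rsmul_snd, lamForm_snd, MulOpposite.unop_op,
      half_smul]
    linear_combination (norm := module) (1 : A) • hh

/-- At order zero, the generalised braiding of any bimodule connection is the flip. -/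
theorem symb₂_braiding_fst {x : ι → A} (hx : ∀ n, dFun S (x n) = Pi.single n 1)
    (D : BimoduleConnection (qd S)) (X : QTensor S) :
    ((symb₂ S).hom (D.braiding X)).1 = flip₂ ((symb₂ S).hom X).1 := by
  obtain ⟨Y, rfl⟩ := Symbol.exists_sum_tmul_dx X
  simp only [map_sum, Prod.fst_sum]
  refine Finset.sum_congr rfl fun n _ => ?_
  rw [← qd_of_coord hx n]
  have e := D.leibniz_right (Y n) (QAlg.of S (x n))
  rw [rsmul_eq_smul_sub, map_sub, D.leibniz_left, nabla_lamForm] at e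
  have e2 := congrArg (fun Z => ((symb₂ S).hom Z).1) e
  simp only [map_add, map_sub, (symb₂ S).left, (symb₂ S).right, Prod.fst_add, Prod.fst_sub,
    lamAlg_fst, zero_smul, sub_zero, symb₂_tmul] at e2
  rw [symb₂_tmul, flip₂_tens]
  exact (add_left_cancel e2).symm

/-- The change of `∇ X` when the connection coefficients change by `e`. -/
def contr (e : ι → ι → ι → A) (X : ι → ι → A) : ι → ι → ι → A := fun c b m =>
  ∑ k, (X c k * e k b m + X k b * e k c m)

theorem contr_add (e : ι → ι → ι → A) (X Y : ι → ι → A) :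
    contr e (X + Y) = contr e X + contr e Y := by
  ext c b m
  simp only [contr, Pi.add_apply, add_mul, Finset.sum_add_distrib]
  ring

theorem contr_tens (e : ι → ι → ι → A) (η ξ : ι → A) : contr e (tens η ξ)
    = tens η (∑ k, ξ k • e k) + flip₁₂ (preTens ξ (∑ k, η k • e k)) := by
  ext c b m
  simp only [contr, tens_apply, Pi.add_apply, flip₁₂_apply, preTens_apply, Pi.smul_apply,
    smul_eq_mul, Finset.sum_apply, Finset.mul_sum, ← Finset.sum_add_distrib]
  exact Finset.sum_congr rfl fun k _ => by ring

/-- A torsion-free change of the coefficients of a metric connection that preserves the metric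
vanishes. -/
theorem eq_zero_of_contr_eq_zero {g ginv : ι → ι → A} (hg : ∀ a b, g a b = g b a)
    (hinv : ∀ a c, ∑ b, ginv a b * g b c = if a = c then 1 else 0) {e : ι → ι → ι → A}
    (hs : ∀ k, alt (e k) = 0) (hc : contr e g = 0) : e = 0 := by
  have hs' : ∀ k b m, e k b m = e k m b := fun k b m => by
    have := congrFun (congrFun (hs k) m) b
    rw [alt_apply, Pi.zero_apply, Pi.zero_apply, sub_eq_zero] at this
    exact this
  set t : ι → ι → ι → A := fun c b m => ∑ k, g c k * e k b m with ht
  have t1 : ∀ c b m, t c b m = t c m b := fun c b m => by simp only [ht, hs' _ b m]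
  have t2 : ∀ c b m, t c b m = - t b c m := fun c b m => by
    have := congrFun (congrFun (congrFun hc c) b) m
    simp only [contr, Finset.sum_add_distrib, hg _ b] at this
    exact eq_neg_of_add_eq_zero_left this
  have t3 : ∀ c b m, t c b m = 0 := fun c b m => by
    have h1 : t c b m = - t c b m := by
      calc t c b m = - t b c m := t2 c b m
        _ = - t b m c := by rw [t1]
        _ = t m b c := by rw [t2 b m c, neg_neg]
        _ = t m c b := t1 m b c
        _ = - t c m b := t2 m c b
        _ = - t c b m := by rw [t1]
    linear_combination half A * h1 - t c b m * half_add_half (A := A)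
  ext k b m
  have h2 : ∑ a, ginv k a * t a b m = e k b m := by
    have : ∀ a, ginv k a * t a b m = ∑ l, ginv k a * g a l * e l b m := fun a => by
      simp only [ht, Finset.mul_sum, mul_assoc]
    simp only [this]
    rw [Finset.sum_comm]
    simp only [← Finset.sum_mul, hinv, ite_mul, one_mul, zero_mul, Finset.sum_ite_eq,
      Finset.mem_univ, if_true]
  rw [← h2]
  simp [t3]

theorem tensorNabla_tmul (D : BimoduleConnection (qd S)) (ξ η : QForm S) :
    D.tensorNabla (BTensor.tmul _ ξ η) = BTensor.tmul _ (D.nabla ξ) η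
      + BTensor.mapLeft D.braiding D.braiding_right (BTensor.prepend ξ (D.nabla η)) := rfl

theorem symb₃_mapLeft_fst {x : ι → A} (hx : ∀ n, dFun S (x n) = Pi.single n 1)
    (D : BimoduleConnection (qd S)) (Z : BTensor (QAlg S) (QTensor S) (QForm S)) :
    ((symb₃ S).hom (BTensor.mapLeft D.braiding D.braiding_right Z)).1
      = flip₁₂ ((symb₃ S).hom Z).1 := by
  induction Z using BTensor.induction with
  | h0 => simp only [map_zero, Prod.fst_zero]
  | ht X η =>
    have e : BTensor.mapLeft D.braiding D.braiding_right (BTensor.tmul (QAlg S) X η)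
      = BTensor.tmul (QAlg S) (D.braiding X) η := rfl
    rw [e, symb₃_tmul, symb₃_tmul, symb₂_braiding_fst hx]
    rfl
  | ha X Y hX hY => simp only [map_add, Prod.fst_add, hX, hY]

/-- At each order in `λ`, the difference of two quantum Levi-Civita connections obeys the equations
that force uniqueness of the classical Levi-Civita connection: it is symmetric, and it does not
move the metric. -/
theorem quantumLeviCivita_unique (h : IsParallelPoisson S) {x : ι → A}
    (hx : ∀ n, dFun S (x n) = Pi.single n 1) {g ginv : ι → ι → A} (hg : ∀ a b, g a b = g b a)
    (hinv : ∀ a c, ∑ b, ginv a b * g b c = if a = c then 1 else 0) {G : QTensor S}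
    (hG : ((symb₂ S).hom G).1 = g) (hQ : IsQuantumLeviCivita S (quantConn h) G)
    {D : BimoduleConnection (qd S)} (hD : IsQuantumLeviCivita S D G) : D = quantConn h := by
  set E : QForm S → QTensor S := fun ξ => D.nabla ξ - (quantConn h).nabla ξ with hE
  set e : ι → ι → ι → A := fun n => ((symb₂ S).hom (E (QForm.dx S n))).1 with he
  set f : ι → ι → ι → A := fun n => ((symb₂ S).hom (E (QForm.dx S n))).2 with hf
  have hE1 : ∀ ξ, ((symb₂ S).hom (E ξ)).1 = ∑ k, ξ.1 k • e k := fun ξ => by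
    obtain ⟨b, hb1, hb⟩ := exists_sum_smul_dx ξ
    simp only [hE, nabla_sub_eq_sum (quantConn h) D hb, map_sum, Prod.fst_sum, (symb₂ S).left, hb1]
    rfl
  have hw : ∀ ξ, qWedge S (E ξ) = 0 := fun ξ => by
    simp only [hE]
    rw [map_sub, hD.1, hQ.1, sub_self]
  -- At order zero the generalised braiding of `D` is already the flip, so the difference `e` acts
  -- on the metric as in the classical case.
  have he0 : e = 0 := by
    refine eq_zero_of_contr_eq_zero hg hinv (fun k => ?_) ?_
    · have := hw (QForm.dx S k)
      rw [qWedge_eq] at this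
      exact congrArg Prod.fst this
    · have key : ∀ X : QTensor S, ((symb₃ S).hom (D.tensorNabla X)).1
          - ((symb₃ S).hom ((quantConn h).tensorNabla X)).1 = contr e ((symb₂ S).hom X).1 := by
        intro X
        induction X using BTensor.induction with
        | h0 =>
          simp only [map_zero, Prod.fst_zero, sub_self]
          ext c b m; simp [contr]
        | ht ξ η =>
          have e1 := hE1 ξ
          have e2 := hE1 η
          simp only [hE, map_sub, Prod.fst_sub] at e1 e2
          simp only [tensorNabla_tmul, map_add, Prod.fst_add, symb₃_mapLeft_fst hx,
            symb₃_tmul, symb₃_prepend, symb₂_tmul, contr_tens, ← e1, ← e2, map_sub]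
          abel
        | ha X Y hX hY =>
          simp only [map_add, Prod.fst_add, contr_add, ← hX, ← hY]
          abel
      rw [← hG, ← key, hD.2, hQ.2, sub_self]
  -- Since `e = 0`, the difference `E` is `λ` times an `A`-linear map with coefficients `f`, and the
  -- two generalised braidings agree. So `f` obeys the same equations as `e` did.
  have hE2 : ∀ ξ, (symb₂ S).hom (E ξ) = (0, ∑ k, ξ.1 k • f k) := fun ξ => by
    obtain ⟨b, hb1, hb⟩ := exists_sum_smul_dx ξ
    have h0 : ∀ k, ((symb₂ S).hom (E (QForm.dx S k))).1 = 0 := fun k => congrFun he0 k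
    ext1
    · rw [hE1, he0]; simp
    · have h1 : E ξ = ∑ k, b k • E (QForm.dx S k) := nabla_sub_eq_sum (quantConn h) D hb
      simp only [h1, map_sum, Prod.snd_sum, (symb₂ S).left, h0, smul_zero,
        CovModule.ham_zero_right, add_zero, hb1]
      rfl
  have hbr : D.braiding = (quantConn h).braiding := by
    refine AddMonoidHom.ext fun X => ?_
    obtain ⟨Y, rfl⟩ := Symbol.exists_sum_tmul_dx X
    rw [map_sum, map_sum]
    refine Finset.sum_congr rfl fun n _ => ?_
    rw [← qd_of_coord hx n]
    have l1 := D.leibniz_right (Y n) (QAlg.of S (x n))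
    have l2 := (quantConn h).leibniz_right (Y n) (QAlg.of S (x n))
    have l3 : E (Y n <• QAlg.of S (x n)) = E (Y n) <• QAlg.of S (x n) := by
      apply (symb₂ S).ext
      rw [(symb₂ S).right, hE2, hE2]
      simp only [QForm.rsmul_fst, MulOpposite.unop_op, smul_zero, CovModule.ham_zero_right,
        add_zero, sub_zero, Pi.smul_apply, Finset.smul_sum, smul_eq_mul, mul_smul]
    simp only [hE, smul_sub, l1, l2] at l3
    rw [← sub_eq_zero] at l3 ⊢
    rw [← l3]; abel
  have hf0 : f = 0 := by
    refine eq_zero_of_contr_eq_zero hg hinv (fun k => ?_) ?_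
    · have := hw (QForm.dx S k)
      rw [qWedge_eq] at this
      have h0 : ((symb₂ S).hom (E (QForm.dx S k))).1 = 0 := congrFun he0 k
      have h2 := congrArg Prod.snd this
      simp only [h0, Pi.zero_apply, zero_smul, Finset.sum_const_zero, add_zero] at h2
      exact h2
    · have key : ∀ X : QTensor S, (symb₃ S).hom (D.tensorNabla X)
          - (symb₃ S).hom ((quantConn h).tensorNabla X) = (0, contr f ((symb₂ S).hom X).1) := by
        intro X
        induction X using BTensor.induction with
        | h0 =>
          have : contr f 0 = 0 := by ext c b m; simp [contr]
          simp only [map_zero, Prod.fst_zero, sub_self, this]; rfl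
        | ht ξ η =>
          have e1 : D.tensorNabla (BTensor.tmul _ ξ η)
              - (quantConn h).tensorNabla (BTensor.tmul _ ξ η)
              = BTensor.tmul _ (E ξ) η + BTensor.mapLeft (quantConn h).braiding
                (quantConn h).braiding_right (BTensor.prepend ξ (E η)) := by
            have e2 : BTensor.mapLeft D.braiding D.braiding_right
                (BTensor.prepend ξ (D.nabla η)) = BTensor.mapLeft (quantConn h).braiding
                (quantConn h).braiding_right (BTensor.prepend ξ (D.nabla η)) := by
              congr 1
              congr 1
            have e3 : BTensor.tmul (QAlg S) (D.nabla ξ) η = BTensor.tmul _ (E ξ) η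
                + BTensor.tmul _ ((quantConn h).nabla ξ) η := by
              rw [← BTensor.add_tmul]; simp only [hE, sub_add_cancel]
            rw [tensorNabla_tmul, tensorNabla_tmul, e2, e3]
            simp only [hE, map_sub]
            abel
          have c1 : (fun c : ι => curvBraid S ((0 : ι → ι → ι → A) c)) = 0 := by
            ext1 c; exact curvBraid_zero
          rw [← map_sub, e1, map_add, symb₃_mapLeft_braiding, symb₃_prepend, symb₃_tmul, hE2, hE2,
            symb₂_tmul, contr_tens]
          have c2 : (covForm S).form.corr 0 η.1 = 0 := CovModule.corr_zero_left _ _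
          simp only [map_zero, smul_zero, Finset.sum_const_zero, add_zero, c1, c2, Prod.mk_add_mk]
        | ha X Y hX hY =>
          simp only [map_add, Prod.fst_add, contr_add]
          rw [add_sub_add_comm, hX, hY, Prod.mk_add_mk, add_zero]
      have := key G
      rw [hD.2, hQ.2, sub_self, hG] at this
      exact (congrArg Prod.snd this).symm
  refine bimoduleConnection_ext hx fun ξ => sub_eq_zero.1 ?_
  change E ξ = 0
  apply (symb₂ S).ext
  rw [hE2, hf0, map_zero]
  simp only [Pi.zero_apply, smul_zero, Finset.sum_const_zero]
  rfl

/-! ### The quantum Levi-Civita connection of a parallel metric -/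

theorem form_nab_eq_cov₂ (s : ι) (X : ι → ι → A) (c b : ι) :
    (covForm S).form.nab s (flip₂ X) c b = S.cov₂ s X b c := by
  simp only [CovModule.form_nab, covForm_nab, Pi.sub_apply, Finset.sum_apply, Pi.smul_apply,
    smul_eq_mul, PatchData.cov, PatchData.cov₂, flip₂_apply]

theorem nab_eq_zero_of_cov₂ {X : ι → ι → A} (hX : ∀ s, S.cov₂ s X = 0) (s : ι) :
    (covForm S).form.nab s (flip₂ X) = 0 := by
  ext c b
  rw [form_nab_eq_cov₂, hX]
  rfl

theorem quantConn_isQuantumLeviCivita (h : IsParallelPoisson S) {g : ι → ι → A}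
    (hg : ∀ a b, g a b = g b a) (hn : ∀ s, S.cov₂ s g = 0)
    (hr : ∀ s, S.cov₂ s (genRicci S g) = 0) :
    IsQuantumLeviCivita S (quantConn h) (quantumMetric S g) := by
  refine ⟨quantConn_torsionFree h, (symb₃ S).ext ?_⟩
  have hgt : flip₂ g = g := by ext n m; exact hg m n
  have n1 : ∀ s, (covForm S).form.nab s g = 0 := fun s => by
    have := nab_eq_zero_of_cov₂ hn s
    rwa [hgt] at this
  have n2 : ∀ s, (covForm S).form.nab s (half A • flip₂ (genRicci S g)) = 0 := fun s => by
    rw [CovModule.nab_smul, half, algebraMap_pd, nab_eq_zero_of_cov₂ hr]; simp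
  rw [symb₃_tensorNabla, symb₂_quantumMetric h hg hn, map_zero]
  ext c b m
  · simp only [grad₂, n1]; rfl
  · simp only [grad₂, curvTerm₂, Pi.add_apply, map_neg, n1, n2, CovModule.R_zero, Pi.zero_apply,
      mul_zero, Finset.sum_const_zero, add_zero]
    exact neg_zero

/-- The antisymmetric correction in the quantum metric cancels `H^{ij} g_{ij}`. -/
theorem qWedge_quantumMetric (h : IsParallelPoisson S) {g : ι → ι → A}
    (hg : ∀ a b, g a b = g b a) (hn : ∀ s, S.cov₂ s g = 0) :
    qWedge S (quantumMetric S g) = 0 := by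
  rw [qWedge_eq, symb₂_quantumMetric h hg hn]
  have h1 : alt g = 0 := by ext a b; rw [alt_apply, hg, sub_self]; rfl
  have h2 : ∀ i j a b, S.H i j a b = - S.H i j b a := fun i j a b => by
    rw [H_apply h, H_apply h, ← mul_neg, ← Finset.sum_neg_distrib]
    congr 1
    exact Finset.sum_congr rfl fun s _ => by ring
  have h3 : ∀ a b, genRicci S g a b = - genRicci S g b a := fun a b => by
    simp only [genRicci, Finset.sum_apply, Pi.smul_apply, smul_eq_mul, h2 _ _ a b, mul_neg,
      Finset.sum_neg_distrib]
  have h4 : ∑ i, ∑ j, g j i • S.H i j = genRicci S g := by simp only [genRicci, hg]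
  rw [h1]
  simp only [h4]
  ext a b
  · rfl
  · simp only [Pi.add_apply, alt_apply, Pi.neg_apply, Pi.smul_apply, smul_eq_mul, flip₂_apply,
      h3 b a]
    change _ = (0 : A)
    linear_combination (-genRicci S g a b) * half_add_half (A := A)

end General

section ProjectiveSpace

open CPn

variable {n : ℕ}

/-! ### Coordinates and frames on the affine chart -/

theorem smooth_ext {f g : Smooth n} (h : ∀ z, f.1 z = g.1 z) : f = g := Subtype.ext (funext h)

theorem cpn_pd_comm (a b : Idx n) (f : Smooth n) : pd a (pd b f) = pd b (pd a f) := by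
  have key : ∀ a b : Idx n, ∀ z, (pd a (pd b f)).1 z
      = fderiv ℝ (fderiv ℝ f.1) z (basisVec a) (basisVec b) := fun a b z => by
    have hd : DifferentiableAt ℝ (fderiv ℝ f.1) z :=
      ((Smooth.contDiff f).fderiv_right (m := ∞) (by simp)).differentiable (by simp) z
    change fderiv ℝ (fun w => fderiv ℝ f.1 w (basisVec b)) z (basisVec a) = _
    rw [fderiv_clm_apply hd (differentiableAt_const _)]
    simp
  refine smooth_ext fun z => ?_
  rw [key, key]
  exact ((Smooth.contDiff f).contDiffAt.isSymmSndFDerivAt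
    (by simpa using (by exact_mod_cast le_top : ((2 : ℕ∞) : WithTop ℕ∞) ≤ ∞))).eq _ _

theorem dz_eq (i : Fin n) (a : Idx n) : dz i a = algebraMap ℂ (Smooth n) (basisVec a i) := by
  refine smooth_ext fun z => ?_
  change fderiv ℝ (fun z : Fin n → ℂ => z i) z (basisVec a) = basisVec a i
  have h : (fun z : Fin n → ℂ => z i) = (ContinuousLinearMap.proj (R := ℝ) i :
    (Fin n → ℂ) →L[ℝ] ℂ) := rfl
  rw [h, ContinuousLinearMap.fderiv]
  rfl

theorem dzbar_eq (i : Fin n) (a : Idx n) :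
    dzbar i a = algebraMap ℂ (Smooth n) ((starRingEnd ℂ) (basisVec a i)) := by
  refine smooth_ext fun z => ?_
  change fderiv ℝ (fun z : Fin n → ℂ => (starRingEnd ℂ) (z i)) z (basisVec a)
    = (starRingEnd ℂ) (basisVec a i)
  have h : (fun z : Fin n → ℂ => (starRingEnd ℂ) (z i)) =
    ((Complex.conjCLE : ℂ →L[ℝ] ℂ).comp (ContinuousLinearMap.proj (R := ℝ) i :
    (Fin n → ℂ) →L[ℝ] ℂ)) := rfl
  rw [h, ContinuousLinearMap.fderiv]
  rfl

theorem pd_algebraMap (a : Idx n) (c : ℂ) : pd a (algebraMap ℂ (Smooth n) c) = 0 :=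
  (pd a).map_algebraMap c

theorem pd_dz (a : Idx n) (i : Fin n) (b : Idx n) : pd a (dz i b) = 0 := by
  rw [dz_eq, pd_algebraMap]

theorem pd_dzbar (a : Idx n) (i : Fin n) (b : Idx n) : pd a (dzbar i b) = 0 := by
  rw [dzbar_eq, pd_algebraMap]

theorem pd_zc (a : Idx n) (i : Fin n) : pd a (zc i) = dz i a := rfl

theorem pd_zbar (a : Idx n) (i : Fin n) : pd a (zbar i) = dzbar i a := rfl

/-- The components of the vector field `∂/∂z^i` for the real coordinates. -/
def frame (i : Fin n) : Idx n → ℂ :=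
  Sum.elim (fun j => if i = j then 1 / 2 else 0) (fun j => if i = j then - I / 2 else 0)

/-- The components of the vector field `∂/∂\bar z^i` for the real coordinates. -/
def frameBar (i : Fin n) : Idx n → ℂ :=
  Sum.elim (fun j => if i = j then 1 / 2 else 0) (fun j => if i = j then I / 2 else 0)

theorem basisVec_inl (j i : Fin n) :
    (basisVec (Sum.inl j) : Fin n → ℂ) i = if i = j then 1 else 0 := by
  rw [basisVec, Pi.single_apply]

theorem basisVec_inr (j i : Fin n) :
    (basisVec (Sum.inr j) : Fin n → ℂ) i = if i = j then I else 0 := by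
  rw [basisVec, Pi.single_apply]

/-- The projection `(∂/∂z^i) ⊗ dz^i` onto the vectors of type `(1, 0)`. -/
def projHol (a b : Idx n) : Smooth n := ∑ i, algebraMap ℂ (Smooth n) (frame i a) * dz i b

/-- The projection `(∂/∂\bar z^i) ⊗ d\bar z^i` onto the vectors of type `(0, 1)`. -/
def projAnti (a b : Idx n) : Smooth n := ∑ i, algebraMap ℂ (Smooth n) (frameBar i a) * dzbar i b

theorem projHol_add_projAnti (a b : Idx n) :
    projHol a b + projAnti a b = if a = b then 1 else 0 := by
  have h : ∑ i, frame i a * (basisVec b : Fin n → ℂ) i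
      + ∑ i, frameBar i a * (starRingEnd ℂ) ((basisVec b : Fin n → ℂ) i)
      = if a = b then (1 : ℂ) else 0 := by
    have hI : - I / 2 * I = 1 / 2 := by linear_combination (-1 / 2 : ℂ) * Complex.I_mul_I
    rcases a with a | a <;> rcases b with b | b
    all_goals
      by_cases hab : a = b
      · subst hab
        simp [frame, frameBar, basisVec_inl, basisVec_inr, apply_ite (starRingEnd ℂ)]
        try linear_combination hI + hI
        try ring
      · simp [frame, frameBar, basisVec_inl, basisVec_inr, apply_ite (starRingEnd ℂ), hab,
          Ne.symm hab]
  simp only [projHol, projAnti, dz_eq, dzbar_eq, ← map_mul, ← map_sum, ← map_add, h]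
  split_ifs <;> simp

theorem sum_dz_frame (i j : Fin n) :
    ∑ a, (basisVec a : Fin n → ℂ) i * frame j a = if i = j then 1 else 0 := by
  have hI : I * (- I / 2) = 1 / 2 := by linear_combination (-1 / 2 : ℂ) * Complex.I_mul_I
  rw [Fintype.sum_sum_type]
  by_cases h : i = j
  · subst h; simp [frame, basisVec_inl, basisVec_inr, hI]; norm_num
  · simp [frame, basisVec_inl, basisVec_inr, h]

theorem sum_dz_frameBar (i j : Fin n) :
    ∑ a, (basisVec a : Fin n → ℂ) i * frameBar j a = 0 := by
  have hI : I * (I / 2) = - (1 / 2) := by linear_combination (1 / 2 : ℂ) * Complex.I_mul_I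
  rw [Fintype.sum_sum_type]
  by_cases h : i = j
  · subst h; simp [frameBar, basisVec_inl, basisVec_inr, hI]
  · simp [frameBar, basisVec_inl, basisVec_inr, h]

theorem frameBar_eq (j : Fin n) (a : Idx n) : frameBar j a = (starRingEnd ℂ) (frame j a) := by
  rcases a with a | a <;> by_cases h : j = a <;> simp [frame, frameBar, h, map_ofNat]

theorem sum_dzbar_frameBar (i j : Fin n) :
    ∑ a, (starRingEnd ℂ) ((basisVec a : Fin n → ℂ) i) * frameBar j a = if i = j then 1 else 0 := by
  simp only [frameBar_eq, ← map_mul, ← map_sum, sum_dz_frame]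
  split_ifs <;> simp

theorem sum_dzbar_frame (i j : Fin n) :
    ∑ a, (starRingEnd ℂ) ((basisVec a : Fin n → ℂ) i) * frame j a = 0 := by
  have h := congrArg (starRingEnd ℂ) (sum_dz_frameBar i j)
  simpa [frameBar_eq] using h

/-- A one-form of type `(1, 0)`: it vanishes on the vectors of type `(0, 1)`. -/
def IsHol (α : Idx n → Smooth n) : Prop := ∀ c, ∑ a, α a * projAnti a c = 0

/-- A one-form of type `(0, 1)`: it vanishes on the vectors of type `(1, 0)`. -/
def IsAnti (α : Idx n → Smooth n) : Prop := ∀ c, ∑ a, α a * projHol a c = 0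

theorem IsHol.sum_projHol {α : Idx n → Smooth n} (h : IsHol α) (c : Idx n) :
    ∑ a, α a * projHol a c = α c := by
  have h1 : ∑ a, α a * projHol a c + ∑ a, α a * projAnti a c = α c := by
    simp only [← Finset.sum_add_distrib, ← mul_add, projHol_add_projAnti, mul_ite, mul_one,
      mul_zero, Finset.sum_ite_eq', Finset.mem_univ, if_true]
  rwa [h c, add_zero] at h1

theorem IsAnti.sum_projAnti {α : Idx n → Smooth n} (h : IsAnti α) (c : Idx n) :
    ∑ a, α a * projAnti a c = α c := by
  have h1 : ∑ a, α a * projHol a c + ∑ a, α a * projAnti a c = α c := by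
    simp only [← Finset.sum_add_distrib, ← mul_add, projHol_add_projAnti, mul_ite, mul_one,
      mul_zero, Finset.sum_ite_eq', Finset.mem_univ, if_true]
  rwa [h c, zero_add] at h1

theorem isHol_dz (i : Fin n) : IsHol (dz i) := fun c => by
  simp only [projAnti, Finset.mul_sum]
  rw [Finset.sum_comm]
  refine Finset.sum_eq_zero fun j _ => ?_
  simp only [← mul_assoc, ← Finset.sum_mul, dz_eq, ← map_mul, ← map_sum, sum_dz_frameBar, map_zero,
    zero_mul]

theorem isAnti_dzbar (i : Fin n) : IsAnti (dzbar i) := fun c => by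
  simp only [projHol, Finset.mul_sum]
  rw [Finset.sum_comm]
  refine Finset.sum_eq_zero fun j _ => ?_
  simp only [← mul_assoc, ← Finset.sum_mul, dzbar_eq, ← map_mul, ← map_sum, sum_dzbar_frame,
    map_zero, zero_mul]

theorem IsHol.smul {α : Idx n → Smooth n} (h : IsHol α) (f : Smooth n) :
    IsHol (fun a => f * α a) := fun c => by
  simp only [mul_assoc, ← Finset.mul_sum, h c, mul_zero]

theorem IsAnti.smul {α : Idx n → Smooth n} (h : IsAnti α) (f : Smooth n) :
    IsAnti (fun a => f * α a) := fun c => by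
  simp only [mul_assoc, ← Finset.mul_sum, h c, mul_zero]

theorem IsHol.sub {α β : Idx n → Smooth n} (h : IsHol α) (h' : IsHol β) :
    IsHol (fun a => α a - β a) := fun c => by
  simp only [sub_mul, Finset.sum_sub_distrib, h c, h' c, sub_zero]

theorem IsAnti.sub {α β : Idx n → Smooth n} (h : IsAnti α) (h' : IsAnti β) :
    IsAnti (fun a => α a - β a) := fun c => by
  simp only [sub_mul, Finset.sum_sub_distrib, h c, h' c, sub_zero]

theorem IsHol.add {α β : Idx n → Smooth n} (h : IsHol α) (h' : IsHol β) :
    IsHol (fun a => α a + β a) := fun c => by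
  simp only [add_mul, Finset.sum_add_distrib, h c, h' c, add_zero]

theorem IsAnti.add {α β : Idx n → Smooth n} (h : IsAnti α) (h' : IsAnti β) :
    IsAnti (fun a => α a + β a) := fun c => by
  simp only [add_mul, Finset.sum_add_distrib, h c, h' c, add_zero]

theorem IsHol.sum {α : Fin n → Idx n → Smooth n} (h : ∀ i, IsHol (α i)) :
    IsHol (fun a => ∑ i, α i a) := fun c => by
  simp only [Finset.sum_mul]
  rw [Finset.sum_comm]
  exact Finset.sum_eq_zero fun i _ => h i c

theorem IsAnti.sum {α : Fin n → Idx n → Smooth n} (h : ∀ i, IsAnti (α i)) :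
    IsAnti (fun a => ∑ i, α i a) := fun c => by
  simp only [Finset.sum_mul]
  rw [Finset.sum_comm]
  exact Finset.sum_eq_zero fun i _ => h i c

theorem tau_apply (a : Idx n) : tau a = ∑ i, t2 * zbar i * dz i a := by
  simp [tau, Finset.sum_apply]

theorem taubar_apply (a : Idx n) : taubar a = ∑ i, t2 * zc i * dzbar i a := by
  simp [taubar, Finset.sum_apply]

theorem isHol_tau : IsHol (tau : Idx n → Smooth n) := by
  have : (tau : Idx n → Smooth n) = fun a => ∑ i, t2 * zbar i * dz i a := funext tau_apply
  rw [this]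
  exact IsHol.sum fun i => (isHol_dz i).smul _

theorem isAnti_taubar : IsAnti (taubar : Idx n → Smooth n) := by
  have : (taubar : Idx n → Smooth n) = fun a => ∑ i, t2 * zc i * dzbar i a := funext taubar_apply
  rw [this]
  exact IsAnti.sum fun i => (isAnti_dzbar i).smul _

/-- The real coordinates `x^a`. -/
def coord (a : Idx n) : Smooth n :=
  Sum.elim (fun i => (1 / 2 : ℂ) • (zc i + zbar i)) (fun i => (- I / 2 : ℂ) • (zc i - zbar i)) a

theorem pd_coord (a b : Idx n) : pd b (coord a) = if b = a then 1 else 0 := by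
  have hI : - I / 2 * (I + I) = 1 := by linear_combination (-1 : ℂ) * Complex.I_mul_I
  have key : ∀ u : ℂ, u = (if b = a then 1 else 0) →
      algebraMap ℂ (Smooth n) u = if b = a then 1 else 0 := by
    rintro _ rfl
    split_ifs <;> simp
  rcases a with i | i
  · change pd b ((1 / 2 : ℂ) • (zc i + zbar i)) = _
    rw [Derivation.map_smul, map_add, pd_zc, pd_zbar, dz_eq, dzbar_eq, ← map_add,
      Algebra.smul_def, ← map_mul]
    apply key
    rcases b with j | j
    all_goals
      by_cases h : j = i
      · subst h; simp [basisVec_inl, basisVec_inr]; try norm_num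
      · simp [basisVec_inl, basisVec_inr, h, Ne.symm h]
  · change pd b ((- I / 2 : ℂ) • (zc i - zbar i)) = _
    rw [Derivation.map_smul, map_sub, pd_zc, pd_zbar, dz_eq, dzbar_eq, ← map_sub,
      Algebra.smul_def, ← map_mul]
    apply key
    rcases b with j | j
    all_goals
      by_cases h : j = i
      · subst h; simp [basisVec_inl, basisVec_inr, hI]
      · simp [basisVec_inl, basisVec_inr, h, Ne.symm h]

theorem t2_mul (n : ℕ) : (t2 : Smooth n) * (1 + ∑ i, zc i * zbar i) = 1 := by
  refine smooth_ext fun z => ?_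
  have h1 : ((t2 : Smooth n) * (1 + ∑ i, zc i * zbar i)).1 z
      = ((tFun z ^ 2 : ℝ) : ℂ) * (1 + ∑ i, z i * (starRingEnd ℂ) (z i)) := by
    have : (∑ i, zc i * zbar i : Smooth n).1 z = ∑ i, z i * (starRingEnd ℂ) (z i) := by
      rw [AddSubmonoidClass.coe_finsetSum, Finset.sum_apply]; rfl
    rw [← this]; rfl
  have h2 : (1 + ∑ i, z i * (starRingEnd ℂ) (z i)) = ((1 + ∑ i, ‖z i‖ ^ 2 : ℝ) : ℂ) := by
    push_cast
    simp only [Complex.mul_conj, Complex.normSq_eq_norm_sq, Complex.ofReal_pow]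
  rw [h1, h2, ← Complex.ofReal_mul, tFun, inv_pow, Real.sq_sqrt (one_add_pos z).le,
    inv_mul_cancel₀ (one_add_pos z).ne']
  rfl

theorem pd_t2 (a : Idx n) : pd a t2 = - (t2 * (tau a + taubar a)) := by
  have h := congrArg (pd a) (t2_mul n)
  have h3 : ∑ i, (zc i * dzbar i a + zbar i * dz i a) * t2 = tau a + taubar a := by
    rw [tau_apply, taubar_apply, ← Finset.sum_add_distrib]
    exact Finset.sum_congr rfl fun i _ => by ring
  rw [← Finset.sum_mul] at h3
  simp only [Derivation.leibniz, map_add, map_sum, Derivation.map_one_eq_zero, smul_eq_mul, pd_zc,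
    pd_zbar, zero_add] at h
  linear_combination t2 * h - t2 * h3 - pd a t2 * t2_mul n

/-! ### The Fubini-Study metric in affine coordinates -/

/-- The Hermitian form `t² u · \bar v - t⁴ (\bar z · u) (z · \bar v)`. -/
def hermFun (z u v : Fin n → ℂ) : ℂ :=
  ((tFun z ^ 2 : ℝ) : ℂ) * ∑ i, u i * (starRingEnd ℂ) (v i)
    - (((tFun z ^ 2 : ℝ) : ℂ) * ∑ i, (starRingEnd ℂ) (z i) * u i)
      * (((tFun z ^ 2 : ℝ) : ℂ) * ∑ i, z i * (starRingEnd ℂ) (v i))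

theorem inner_homogLin (k : Fin (n + 1)) (u v : Fin n → ℂ) :
    inner ℂ (homogLin k u) (homogLin k v) = ∑ i, v i * (starRingEnd ℂ) (u i) := by
  rw [PiLp.inner_apply, Fin.sum_univ_succAbove _ k]
  simp [homogLin]

theorem inner_sphereLift_homogLin (k : Fin (n + 1)) (z v : Fin n → ℂ) :
    inner ℂ (sphereLift k z) (homogLin k v)
      = ((tFun z : ℝ) : ℂ) * ∑ i, v i * (starRingEnd ℂ) (z i) := by
  have h : inner ℂ (homog k z) (homogLin k v) = ∑ i, v i * (starRingEnd ℂ) (z i) := by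
    rw [PiLp.inner_apply, Fin.sum_univ_succAbove _ k]
    simp [homogLin, homog]
  rw [sphereLift, ← Complex.coe_smul, inner_smul_left, Complex.conj_ofReal, h]

theorem inner_horizontal (k : Fin (n + 1)) (z : Fin n → ℂ)
    (x y : EuclideanSpace ℂ (Fin (n + 1))) :
    inner ℂ (horizontal (sphereLift k z) x) (horizontal (sphereLift k z) y)
      = inner ℂ x y
        - (starRingEnd ℂ) (inner ℂ (sphereLift k z) x) * inner ℂ (sphereLift k z) y := by
  simp only [horizontal, inner_sub_left, inner_sub_right, inner_smul_left, inner_smul_right,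
    inner_homog]
  rw [← inner_conj_symm x (sphereLift k z)]
  ring

/-- The derivative of the lift to the sphere is, up to a multiple of the lift, `t` times the linear
part of the homogeneous coordinates; so the chart `U_k` enters only through its norm. -/
theorem fubiniStudy_eq (k : Fin (n + 1)) (z u v : Fin n → ℂ) :
    ((fubiniStudy k z u v : ℝ) : ℂ) = hermFun z u v + hermFun z v u := by
  set w : ℂ := inner ℂ (horizontal (sphereLift k z) (fderiv ℝ (sphereLift k) z u))
    (horizontal (sphereLift k z) (fderiv ℝ (sphereLift k) z v)) with hw
  have h1 : w = hermFun z v u := by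
    rw [hw, horizontal_fderiv, horizontal_fderiv, inner_smul_left, inner_smul_right,
      inner_horizontal, inner_homogLin, inner_sphereLift_homogLin, inner_sphereLift_homogLin]
    have e : ∑ i, v i * (starRingEnd ℂ) (z i) = ∑ i, (starRingEnd ℂ) (z i) * v i :=
      Finset.sum_congr rfl fun i _ => mul_comm _ _
    have e' : ∑ i, (starRingEnd ℂ) (u i) * z i = ∑ i, z i * (starRingEnd ℂ) (u i) :=
      Finset.sum_congr rfl fun i _ => mul_comm _ _
    simp only [hermFun, map_mul, map_sum, Complex.conj_ofReal, Complex.conj_conj,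
      Complex.ofReal_pow, e, e']
    ring
  have h2 : (starRingEnd ℂ) (hermFun z v u) = hermFun z u v := by
    have e : ∑ i, (starRingEnd ℂ) (v i) * u i = ∑ i, u i * (starRingEnd ℂ) (v i) :=
      Finset.sum_congr rfl fun i _ => mul_comm _ _
    simp only [hermFun, map_mul, map_sum, map_sub, Complex.conj_ofReal, Complex.conj_conj]
    rw [e]
    ring
  have h3 : fubiniStudy k z u v = 2 * w.re := rfl
  rw [h3, ← Complex.add_conj, h1, h2, add_comm]

/-- The Hermitian form `h = t² dz^i ⊗ d\bar z^i - τ ⊗ \bar τ = g_{i \bar j} dz^i ⊗ d\bar z^j`. The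
metric is `h_{ab} + h_{ba}`. -/
def herm (a b : Idx n) : Smooth n := t2 * ∑ i, dz i a * dzbar i b - tau a * taubar b

theorem sum_apply (f : Fin n → Smooth n) (z : Fin n → ℂ) : (∑ i, f i).1 z = ∑ i, (f i).1 z := by
  rw [AddSubmonoidClass.coe_finsetSum, Finset.sum_apply]

theorem dz_val (i : Fin n) (a : Idx n) (z : Fin n → ℂ) : (dz i a).1 z = basisVec a i := by
  rw [dz_eq]; rfl

theorem dzbar_val (i : Fin n) (a : Idx n) (z : Fin n → ℂ) :
    (dzbar i a).1 z = (starRingEnd ℂ) (basisVec a i) := by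
  rw [dzbar_eq]; rfl

theorem herm_val (a b : Idx n) (z : Fin n → ℂ) :
    (herm a b).1 z = hermFun z (basisVec a) (basisVec b) := by
  have e : (herm a b).1 z = (t2 : Smooth n).1 z * (∑ i, dz i a * dzbar i b : Smooth n).1 z
    - (tau a).1 z * (taubar b).1 z := rfl
  have e1 : ∀ i, (dz i a * dzbar i b).1 z = (dz i a).1 z * (dzbar i b).1 z := fun i => rfl
  have e2 : ∀ i, (t2 * zbar i * dz i a).1 z
    = (t2 : Smooth n).1 z * ((starRingEnd ℂ) (z i) * (dz i a).1 z) := fun i => mul_assoc _ _ _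
  have e3 : ∀ i, (t2 * zc i * dzbar i b).1 z
    = (t2 : Smooth n).1 z * (z i * (dzbar i b).1 z) := fun i => mul_assoc _ _ _
  rw [e, tau_apply, taubar_apply, sum_apply, sum_apply, sum_apply]
  simp only [e1, e2, e3, dz_val, dzbar_val, ← Finset.mul_sum]
  rfl

theorem metric_eq (k : Fin (n + 1)) (a b : Idx n) : metric k a b = herm a b + herm b a := by
  refine smooth_ext fun z => ?_
  change ((fubiniStudy k z _ _ : ℝ) : ℂ) = (herm a b).1 z + (herm b a).1 z
  rw [fubiniStudy_eq, herm_val, herm_val]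

theorem metric_symm (k : Fin (n + 1)) (a b : Idx n) : metric k a b = metric k b a := by
  rw [metric_eq, metric_eq, add_comm]

variable (n) in
/-- The constant function `i`. -/
def imag : Smooth n := algebraMap ℂ (Smooth n) I

theorem omegaLow_eq (k : Fin (n + 1)) (a b : Idx n) :
    omegaLow k a b = imag n * (herm b a - herm a b) := by
  refine smooth_ext fun z => ?_
  change ((fubiniStudy k z _ _ : ℝ) : ℂ) = I * ((herm b a).1 z - (herm a b).1 z)
  rw [fubiniStudy_eq, herm_val, herm_val]
  simp only [hermFun, Pi.smul_apply, smul_eq_mul, map_mul, Complex.conj_I, mul_left_comm _ I,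
    mul_left_comm _ (-I), mul_assoc, ← Finset.mul_sum]
  ring

theorem isHol_herm (b : Idx n) : IsHol (fun a => herm a b) := by
  have : (fun a => herm a b) = fun a => (∑ i, (t2 * dzbar i b) * dz i a) - taubar b * tau a := by
    funext a
    rw [herm, Finset.mul_sum, mul_comm (tau a)]
    congr 1
    exact Finset.sum_congr rfl fun i _ => by ring
  rw [this]
  exact (IsHol.sum fun i => (isHol_dz i).smul _).sub (isHol_tau.smul _)

theorem isAnti_herm (a : Idx n) : IsAnti (fun b => herm a b) := by
  have : (fun b => herm a b) = fun b => (∑ i, (t2 * dz i a) * dzbar i b) - tau a * taubar b := by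
    funext b
    rw [herm, Finset.mul_sum]
    congr 1
    exact Finset.sum_congr rfl fun i _ => by ring
  rw [this]
  exact (IsAnti.sum fun i => (isAnti_dzbar i).smul _).sub (isAnti_taubar.smul _)

theorem sum_metric_projHol (k : Fin (n + 1)) (a c : Idx n) :
    ∑ b, metric k a b * projHol b c = herm c a := by
  simp only [metric_eq, add_mul, Finset.sum_add_distrib]
  rw [isAnti_herm a c, (isHol_herm a).sum_projHol, zero_add]

theorem sum_metric_projAnti (k : Fin (n + 1)) (a c : Idx n) :
    ∑ b, metric k a b * projAnti b c = herm a c := by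
  simp only [metric_eq, add_mul, Finset.sum_add_distrib]
  rw [(isAnti_herm a).sum_projAnti, isHol_herm a c, add_zero]

variable (n) in
/-- The function `t⁻² = 1 + |z|²`. -/
def rho : Smooth n := 1 + ∑ i, zc i * zbar i

theorem t2_mul_rho : t2 * rho n = 1 := t2_mul n

theorem rho_mul_tau (a : Idx n) : rho n * tau a = ∑ i, zbar i * dz i a := by
  rw [tau_apply, Finset.mul_sum]
  exact Finset.sum_congr rfl fun i _ => by linear_combination zbar i * dz i a * t2_mul_rho (n := n)

theorem rho_mul_taubar (a : Idx n) : rho n * taubar a = ∑ i, zc i * dzbar i a := by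
  rw [taubar_apply, Finset.mul_sum]
  exact Finset.sum_congr rfl fun i _ => by linear_combination zc i * dzbar i a * t2_mul_rho (n := n)

theorem alg_sum_dz_frame (i j : Fin n) :
    ∑ a, algebraMap ℂ (Smooth n) (frame j a) * dz i a = if i = j then 1 else 0 := by
  simp only [dz_eq, ← map_mul, ← map_sum, mul_comm (frame j _), sum_dz_frame]
  split_ifs <;> simp

theorem alg_sum_dz_frameBar (i j : Fin n) :
    ∑ a, algebraMap ℂ (Smooth n) (frameBar j a) * dz i a = 0 := by
  simp only [dz_eq, ← map_mul, ← map_sum, mul_comm (frameBar j _), sum_dz_frameBar, map_zero]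

theorem alg_sum_dzbar_frameBar (i j : Fin n) :
    ∑ a, algebraMap ℂ (Smooth n) (frameBar j a) * dzbar i a = if i = j then 1 else 0 := by
  simp only [dzbar_eq, ← map_mul, ← map_sum, mul_comm (frameBar j _), sum_dzbar_frameBar]
  split_ifs <;> simp

theorem alg_sum_dzbar_frame (i j : Fin n) :
    ∑ a, algebraMap ℂ (Smooth n) (frame j a) * dzbar i a = 0 := by
  simp only [dzbar_eq, ← map_mul, ← map_sum, mul_comm (frame j _), sum_dzbar_frame, map_zero]

theorem sum_frame_metric (k : Fin (n + 1)) (i : Fin n) (c : Idx n) :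
    ∑ b, algebraMap ℂ (Smooth n) (frame i b) * metric k b c
      = t2 * dzbar i c - t2 * zbar i * taubar c := by
  have h : ∀ b, algebraMap ℂ (Smooth n) (frame i b) * metric k b c
      = ∑ l, t2 * dzbar l c * (algebraMap ℂ (Smooth n) (frame i b) * dz l b)
        - ∑ l, taubar c * (t2 * zbar l) * (algebraMap ℂ (Smooth n) (frame i b) * dz l b)
        + ∑ l, t2 * dz l c * (algebraMap ℂ (Smooth n) (frame i b) * dzbar l b)
        - ∑ l, tau c * (t2 * zc l) * (algebraMap ℂ (Smooth n) (frame i b) * dzbar l b) :=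
      fun b => by
    simp only [metric_eq, herm, tau_apply b, taubar_apply b, mul_add, mul_sub, Finset.mul_sum,
      Finset.sum_mul, add_sub_assoc]
    congr 1
    · congr 1 <;> exact Finset.sum_congr rfl fun l _ => by ring
    · congr 1 <;> exact Finset.sum_congr rfl fun l _ => by ring
  simp only [h, Finset.sum_add_distrib, Finset.sum_sub_distrib]
  rw [Finset.sum_comm, Finset.sum_comm (f := fun b l => taubar c * (t2 * zbar l) * _),
    Finset.sum_comm (f := fun b l => t2 * dz l c * _),
    Finset.sum_comm (f := fun b l => tau c * (t2 * zc l) * _)]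
  simp only [← Finset.mul_sum, alg_sum_dz_frame, alg_sum_dzbar_frame, mul_ite, mul_one, mul_zero,
    Finset.sum_ite_eq', Finset.mem_univ, if_true, Finset.sum_const_zero]
  ring

theorem sum_frameBar_metric (k : Fin (n + 1)) (i : Fin n) (c : Idx n) :
    ∑ b, algebraMap ℂ (Smooth n) (frameBar i b) * metric k b c
      = t2 * dz i c - t2 * zc i * tau c := by
  have h : ∀ b, algebraMap ℂ (Smooth n) (frameBar i b) * metric k b c
      = ∑ l, t2 * dzbar l c * (algebraMap ℂ (Smooth n) (frameBar i b) * dz l b)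
        - ∑ l, taubar c * (t2 * zbar l) * (algebraMap ℂ (Smooth n) (frameBar i b) * dz l b)
        + ∑ l, t2 * dz l c * (algebraMap ℂ (Smooth n) (frameBar i b) * dzbar l b)
        - ∑ l, tau c * (t2 * zc l) * (algebraMap ℂ (Smooth n) (frameBar i b) * dzbar l b) :=
      fun b => by
    simp only [metric_eq, herm, tau_apply b, taubar_apply b, mul_add, mul_sub, Finset.mul_sum,
      Finset.sum_mul, add_sub_assoc]
    congr 1
    · congr 1 <;> exact Finset.sum_congr rfl fun l _ => by ring
    · congr 1 <;> exact Finset.sum_congr rfl fun l _ => by ring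
  simp only [h, Finset.sum_add_distrib, Finset.sum_sub_distrib]
  rw [Finset.sum_comm, Finset.sum_comm (f := fun b l => taubar c * (t2 * zbar l) * _),
    Finset.sum_comm (f := fun b l => t2 * dz l c * _),
    Finset.sum_comm (f := fun b l => tau c * (t2 * zc l) * _)]
  simp only [← Finset.mul_sum, alg_sum_dz_frameBar, alg_sum_dzbar_frameBar, mul_ite, mul_one,
    mul_zero, Finset.sum_ite_eq', Finset.mem_univ, if_true, Finset.sum_const_zero]
  ring

/-- The inverse of the matrix `g_{i \bar j}`. -/
def gBarInv (i j : Fin n) : Smooth n := rho n * ((if i = j then 1 else 0) + zc i * zbar j)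

theorem sum_zc_zbar : ∑ i, zc i * zbar i = rho n - 1 := by rw [rho]; ring

theorem sum_gBarInv_dz (i : Fin n) (c : Idx n) :
    ∑ j, gBarInv i j * (t2 * dz j c - t2 * zc j * tau c) = dz i c := by
  have h : ∀ j, gBarInv i j * (t2 * dz j c - t2 * zc j * tau c)
      = (if i = j then dz j c - zc j * tau c else 0)
        + zc i * (zbar j * dz j c - zc j * zbar j * tau c) := fun j => by
    have := t2_mul_rho (n := n)
    rw [gBarInv]
    split_ifs
    · linear_combination ((1 + zc i * zbar j) * (dz j c - zc j * tau c)) * this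
    · linear_combination ((zc i * zbar j) * (dz j c - zc j * tau c)) * this
  simp only [h, Finset.sum_add_distrib, Finset.sum_ite_eq, Finset.mem_univ, if_true,
    ← Finset.mul_sum, Finset.sum_sub_distrib, ← Finset.sum_mul, sum_zc_zbar, ← rho_mul_tau]
  ring

theorem sum_gBarInv_dzbar (j : Fin n) (c : Idx n) :
    ∑ i, gBarInv i j * (t2 * dzbar i c - t2 * zbar i * taubar c) = dzbar j c := by
  have h : ∀ i, gBarInv i j * (t2 * dzbar i c - t2 * zbar i * taubar c)
      = (if i = j then dzbar i c - zbar i * taubar c else 0)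
        + zbar j * (zc i * dzbar i c - zc i * zbar i * taubar c) := fun i => by
    have := t2_mul_rho (n := n)
    rw [gBarInv]
    split_ifs
    · linear_combination ((1 + zc i * zbar j) * (dzbar i c - zbar i * taubar c)) * this
    · linear_combination ((zc i * zbar j) * (dzbar i c - zbar i * taubar c)) * this
  simp only [h, Finset.sum_add_distrib, Finset.sum_ite_eq', Finset.mem_univ, if_true,
    ← Finset.mul_sum, Finset.sum_sub_distrib, ← Finset.sum_mul, sum_zc_zbar, ← rho_mul_taubar]
  ring

/-- The inverse metric `g^{i \bar j} (∂/∂z^i ⊗ ∂/∂\bar z^j + ∂/∂\bar z^j ⊗ ∂/∂z^i)`, in the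
components for the real coordinates. -/
def gInv (a b : Idx n) : Smooth n := ∑ i, ∑ j, gBarInv i j *
  (algebraMap ℂ (Smooth n) (frame i a) * algebraMap ℂ (Smooth n) (frameBar j b)
    + algebraMap ℂ (Smooth n) (frameBar j a) * algebraMap ℂ (Smooth n) (frame i b))

theorem sum_gInv_metric (k : Fin (n + 1)) (a c : Idx n) :
    ∑ b, gInv a b * metric k b c = if a = c then 1 else 0 := by
  have h1 : ∑ b, gInv a b * metric k b c = ∑ i, ∑ j, gBarInv i j *
      (algebraMap ℂ (Smooth n) (frame i a)
          * ∑ b, algebraMap ℂ (Smooth n) (frameBar j b) * metric k b c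
        + algebraMap ℂ (Smooth n) (frameBar j a)
          * ∑ b, algebraMap ℂ (Smooth n) (frame i b) * metric k b c) := by
    simp only [gInv, Finset.sum_mul, Finset.mul_sum, ← Finset.sum_add_distrib]
    rw [Finset.sum_comm]
    refine Finset.sum_congr rfl fun i _ => ?_
    rw [Finset.sum_comm]
    exact Finset.sum_congr rfl fun j _ => Finset.sum_congr rfl fun b _ => by ring
  rw [h1, ← projHol_add_projAnti, projHol, projAnti]
  simp only [sum_frameBar_metric, sum_frame_metric, mul_add, Finset.sum_add_distrib]
  congr 1
  · refine Finset.sum_congr rfl fun i _ => ?_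
    rw [← sum_gBarInv_dz i c, Finset.mul_sum]
    exact Finset.sum_congr rfl fun j _ => by ring
  · rw [Finset.sum_comm]
    refine Finset.sum_congr rfl fun j _ => ?_
    rw [← sum_gBarInv_dzbar j c, Finset.mul_sum]
    exact Finset.sum_congr rfl fun i _ => by ring

theorem metricInv_eq (k : Fin (n + 1)) (a b : Idx n) : metricInv k a b = gInv a b := by
  have h : (Matrix.of (gInv : Idx n → Idx n → Smooth n))
      * (Matrix.of (metric k : Idx n → Idx n → Smooth n)) = 1 := by
    ext1 a c
    rw [Matrix.mul_apply, Matrix.one_apply]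
    exact sum_gInv_metric k a c
  rw [metricInv, Matrix.inv_eq_left_inv h]
  rfl

theorem sum_metricInv_metric (k : Fin (n + 1)) (a c : Idx n) :
    ∑ b, metricInv k a b * metric k b c = if a = c then 1 else 0 := by
  simp only [metricInv_eq, sum_gInv_metric]

theorem sum_metricInv_metric' (k : Fin (n + 1)) (a c : Idx n) :
    ∑ b, metricInv k b a * metric k b c = if a = c then 1 else 0 := by
  have h : (Matrix.of (gInv : Idx n → Idx n → Smooth n))
      * (Matrix.of (metric k : Idx n → Idx n → Smooth n)) = 1 := by
    ext1 a c
    rw [Matrix.mul_apply, Matrix.one_apply]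
    exact sum_gInv_metric k a c
  have h1 : (Matrix.of (metric k : Idx n → Idx n → Smooth n))
      * (Matrix.of (gInv : Idx n → Idx n → Smooth n)) = 1 := mul_eq_one_comm.1 h
  have h2 := congrFun (congrFun h1 c) a
  rw [Matrix.mul_apply, Matrix.one_apply] at h2
  have h3 : ∑ b, metricInv k b a * metric k b c = ∑ b, metric k c b * gInv b a :=
    Finset.sum_congr rfl fun b _ => by rw [metricInv_eq, metric_symm k b c, mul_comm]
  rw [h3]
  exact h2.trans (if_congr eq_comm rfl rfl)

/-! ### The Poisson tensor and contractions with it -/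

/-- The complex structure `J^a_b`. -/
def cplx (a b : Idx n) : Smooth n := imag n * (projHol a b - projAnti a b)

theorem sum_omegaUp_metric (k : Fin (n + 1)) (a c : Idx n) :
    ∑ b, omegaUp k a b * metric k b c = cplx a c := by
  have h1 : ∑ b, omegaUp k a b * metric k b c
      = ∑ e, ∑ d, metricInv k a e * omegaLow k e d * ∑ b, metricInv k b d * metric k b c := by
    simp only [omegaUp, Finset.sum_mul, Finset.mul_sum]
    rw [Finset.sum_comm]
    refine Finset.sum_congr rfl fun e _ => ?_
    rw [Finset.sum_comm]
    exact Finset.sum_congr rfl fun d _ => Finset.sum_congr rfl fun b _ => by ring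
  have h2 : ∀ e, omegaLow k e c = ∑ f, metric k e f * cplx f c := fun e => by
    have : ∀ f, metric k e f * cplx f c
        = imag n * (metric k e f * projHol f c - metric k e f * projAnti f c) := fun f => by
      rw [cplx]; ring
    simp only [this, ← Finset.mul_sum, Finset.sum_sub_distrib, sum_metric_projHol,
      sum_metric_projAnti, omegaLow_eq]
  have h3 : ∑ e, metricInv k a e * ∑ f, metric k e f * cplx f c
      = ∑ f, (∑ e, metricInv k a e * metric k e f) * cplx f c := by
    simp only [Finset.mul_sum, Finset.sum_mul, ← mul_assoc]
    exact Finset.sum_comm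
  rw [h1]
  simp only [sum_metricInv_metric', mul_ite, mul_one, mul_zero, Finset.sum_ite_eq',
    Finset.mem_univ, if_true, h2, h3, sum_metricInv_metric, ite_mul, one_mul, zero_mul,
    Finset.sum_ite_eq]

theorem isHol_projHol (a : Idx n) : IsHol (projHol a) := by
  have : (projHol a : Idx n → Smooth n)
    = fun b => ∑ i, algebraMap ℂ (Smooth n) (frame i a) * dz i b := rfl
  rw [this]
  exact IsHol.sum fun i => (isHol_dz i).smul _

theorem isAnti_projAnti (a : Idx n) : IsAnti (projAnti a) := by
  have : (projAnti a : Idx n → Smooth n)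
    = fun b => ∑ i, algebraMap ℂ (Smooth n) (frameBar i a) * dzbar i b := rfl
  rw [this]
  exact IsAnti.sum fun i => (isAnti_dzbar i).smul _

theorem sum_cplx_projHol (a c : Idx n) : ∑ b, cplx a b * projHol b c = imag n * projHol a c := by
  simp only [cplx, mul_sub, sub_mul, mul_assoc, Finset.sum_sub_distrib, ← Finset.mul_sum,
    (isHol_projHol a).sum_projHol, isAnti_projAnti a c, mul_zero, sub_zero]

theorem sum_cplx_projAnti (a c : Idx n) :
    ∑ b, cplx a b * projAnti b c = - (imag n * projAnti a c) := by
  simp only [cplx, mul_sub, sub_mul, mul_assoc, Finset.sum_sub_distrib, ← Finset.mul_sum,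
    (isAnti_projAnti a).sum_projAnti, isHol_projHol a c, mul_zero, zero_sub]

theorem sum_omegaUp_herm (k : Fin (n + 1)) (a m : Idx n) :
    ∑ b, omegaUp k a b * herm m b = imag n * projHol a m := by
  simp only [← sum_metric_projHol k _ m, Finset.mul_sum, ← mul_assoc]
  rw [Finset.sum_comm]
  simp only [← Finset.sum_mul, sum_omegaUp_metric, sum_cplx_projHol]

theorem sum_omegaUp_herm' (k : Fin (n + 1)) (a m : Idx n) :
    ∑ b, omegaUp k a b * herm b m = - (imag n * projAnti a m) := by
  simp only [← sum_metric_projAnti k _ m, Finset.mul_sum, ← mul_assoc]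
  rw [Finset.sum_comm]
  simp only [← Finset.sum_mul, sum_omegaUp_metric, sum_cplx_projAnti]

/-- The contraction `ω^{ab} α_a β_b`. -/
def pois (k : Fin (n + 1)) (α β : Idx n → Smooth n) : Smooth n :=
  ∑ a, ∑ b, omegaUp k a b * (α a * β b)

theorem pois_add_right (k : Fin (n + 1)) (α β β' : Idx n → Smooth n) :
    pois k α (fun a => β a + β' a) = pois k α β + pois k α β' := by
  simp only [pois, mul_add, Finset.sum_add_distrib]

theorem pois_smul_right (k : Fin (n + 1)) (f : Smooth n) (α β : Idx n → Smooth n) :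
    pois k α (fun a => f * β a) = f * pois k α β := by
  simp only [pois, Finset.mul_sum]
  exact Finset.sum_congr rfl fun a _ => Finset.sum_congr rfl fun b _ => by ring

theorem pois_sum_right {κ : Type*} [Fintype κ] (k : Fin (n + 1)) (α : Idx n → Smooth n)
    (f : Idx n → κ → Smooth n) :
    pois k α (fun b => ∑ m, f b m) = ∑ m, pois k α (fun b => f b m) := by
  simp only [pois, Finset.mul_sum]
  rw [Finset.sum_congr rfl fun a _ => Finset.sum_comm, Finset.sum_comm]

theorem pois_antisymm (k : Fin (n + 1)) (α β : Idx n → Smooth n) :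
    pois k α β = - pois k β α := by
  rw [pois, pois, Finset.sum_comm, ← Finset.sum_neg_distrib]
  refine Finset.sum_congr rfl fun b _ => ?_
  rw [← Finset.sum_neg_distrib]
  refine Finset.sum_congr rfl fun a _ => ?_
  rw [omegaUp_antisymm]; ring

theorem pois_eq (k : Fin (n + 1)) (α β : Idx n → Smooth n) :
    pois k α β = ∑ a, α a * ∑ b, omegaUp k a b * β b := by
  simp only [pois, Finset.mul_sum]
  exact Finset.sum_congr rfl fun a _ => Finset.sum_congr rfl fun b _ => by ring

/-- Contraction with `h` acts on forms of type `(1, 0)` as the complex structure does. -/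
theorem pois_hol_herm (k : Fin (n + 1)) {α : Idx n → Smooth n} (h : IsHol α) (m : Idx n) :
    pois k α (fun b => herm m b) = imag n * α m := by
  rw [pois_eq]
  simp only [sum_omegaUp_herm, mul_left_comm (α _), ← Finset.mul_sum, h.sum_projHol]

theorem pois_hol_herm' (k : Fin (n + 1)) {α : Idx n → Smooth n} (h : IsHol α) (m : Idx n) :
    pois k α (fun b => herm b m) = 0 := by
  rw [pois_eq]
  have e : ∀ a, α a * -(imag n * projAnti a m) = -imag n * (α a * projAnti a m) := fun a => by ring
  simp only [sum_omegaUp_herm', e, ← Finset.mul_sum, h m, mul_zero]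

theorem pois_anti_herm (k : Fin (n + 1)) {α : Idx n → Smooth n} (h : IsAnti α) (m : Idx n) :
    pois k α (fun b => herm m b) = 0 := by
  rw [pois_eq]
  simp only [sum_omegaUp_herm, mul_left_comm (α _), ← Finset.mul_sum, h m, mul_zero]

theorem pois_anti_herm' (k : Fin (n + 1)) {α : Idx n → Smooth n} (h : IsAnti α) (m : Idx n) :
    pois k α (fun b => herm b m) = - (imag n * α m) := by
  rw [pois_eq]
  have e : ∀ a, α a * -(imag n * projAnti a m) = -imag n * (α a * projAnti a m) := fun a => by ring
  simp only [sum_omegaUp_herm', e, ← Finset.mul_sum, h.sum_projAnti]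
  ring

theorem sum_metric_raise (k : Fin (n + 1)) (β : Idx n → Smooth n) (b : Idx n) :
    ∑ m, metric k b m * ∑ c, metricInv k c m * β c = β b := by
  have : ∑ m, metric k b m * ∑ c, metricInv k c m * β c
      = ∑ c, (∑ m, metricInv k c m * metric k m b) * β c := by
    simp only [Finset.mul_sum, Finset.sum_mul]
    rw [Finset.sum_comm]
    exact Finset.sum_congr rfl fun c _ => Finset.sum_congr rfl fun m _ => by
      rw [metric_symm k b m]; ring
  rw [this]
  simp only [sum_metricInv_metric, ite_mul, one_mul, zero_mul, Finset.sum_ite_eq', Finset.mem_univ,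
    if_true]

/-- The Poisson tensor is of type `(1, 1)`. -/
theorem pois_hol_hol (k : Fin (n + 1)) {α β : Idx n → Smooth n} (hα : IsHol α) (hβ : IsHol β) :
    pois k α β = 0 := by
  have h : β = fun b => ∑ m, herm b m * ∑ c, metricInv k c m * β c := by
    funext b
    have h2 : ∀ a, β a = ∑ m, metric k a m * ∑ c, metricInv k c m * β c := fun a =>
      (sum_metric_raise k β a).symm
    rw [← hβ.sum_projHol b]
    simp only [fun a => congrArg (· * projHol a b) (h2 a)]
    simp only [Finset.sum_mul]
    rw [Finset.sum_comm]
    refine Finset.sum_congr rfl fun m _ => ?_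
    rw [← sum_metric_projHol k m b, Finset.sum_mul]
    exact Finset.sum_congr rfl fun a _ => by rw [metric_symm k a m]; ring
  rw [h, pois_sum_right]
  refine Finset.sum_eq_zero fun m _ => ?_
  simp only [mul_comm (herm _ m)]
  rw [pois_smul_right, pois_hol_herm' k hα, mul_zero]

theorem pois_anti_anti (k : Fin (n + 1)) {α β : Idx n → Smooth n} (hα : IsAnti α)
    (hβ : IsAnti β) : pois k α β = 0 := by
  have h : β = fun b => ∑ m, herm m b * ∑ c, metricInv k c m * β c := by
    funext b
    have h2 : ∀ a, β a = ∑ m, metric k a m * ∑ c, metricInv k c m * β c := fun a =>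
      (sum_metric_raise k β a).symm
    rw [← hβ.sum_projAnti b]
    simp only [fun a => congrArg (· * projAnti a b) (h2 a)]
    simp only [Finset.sum_mul]
    rw [Finset.sum_comm]
    refine Finset.sum_congr rfl fun m _ => ?_
    rw [← sum_metric_projAnti k m b, Finset.sum_mul]
    exact Finset.sum_congr rfl fun a _ => by rw [metric_symm k a m]; ring
  rw [h, pois_sum_right]
  refine Finset.sum_eq_zero fun m _ => ?_
  simp only [mul_comm (herm m _)]
  rw [pois_smul_right, pois_anti_herm k hα, mul_zero]

/-! ### The Levi-Civita connection and its curvature -/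

theorem pd_tau (b d : Idx n) : pd b (tau d) = herm d b - tau b * tau d := by
  have h1 : pd b (tau d) = t2 * (∑ i, dz i d * dzbar i b) + pd b t2 * (rho n * tau d) := by
    rw [rho_mul_tau, tau_apply, map_sum, Finset.mul_sum, Finset.mul_sum, ← Finset.sum_add_distrib]
    refine Finset.sum_congr rfl fun i _ => ?_
    simp only [Derivation.leibniz, pd_dz, pd_zbar, smul_eq_mul]
    ring
  rw [h1, pd_t2, herm]
  linear_combination (-(tau b + taubar b) * tau d) * t2_mul_rho (n := n)

theorem pd_taubar (b d : Idx n) : pd b (taubar d) = herm b d - taubar b * taubar d := by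
  have h1 : pd b (taubar d) = t2 * (∑ i, dz i b * dzbar i d) + pd b t2 * (rho n * taubar d) := by
    rw [rho_mul_taubar, taubar_apply, map_sum, Finset.mul_sum, Finset.mul_sum,
      ← Finset.sum_add_distrib]
    refine Finset.sum_congr rfl fun i _ => ?_
    simp only [Derivation.leibniz, pd_dzbar, pd_zc, smul_eq_mul]
    ring
  rw [h1, pd_t2, herm]
  linear_combination (-(tau b + taubar b) * taubar d) * t2_mul_rho (n := n)

theorem pd_herm (b d c : Idx n) : pd b (herm d c)
    = - ((tau b + taubar b) * herm d c) - herm d b * taubar c - tau d * herm b c := by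
  have h1 : pd b (∑ i, dz i d * dzbar i c) = 0 := by
    rw [map_sum]
    refine Finset.sum_eq_zero fun i _ => ?_
    simp only [Derivation.leibniz, pd_dz, pd_dzbar, smul_zero, add_zero]
  rw [herm, map_sub, Derivation.leibniz, Derivation.leibniz, h1, pd_tau, pd_taubar, pd_t2]
  simp only [smul_eq_mul, herm]
  ring

/-- The Christoffel symbols in the form `∇ dz^i = τ ⊗ dz^i + dz^i ⊗ τ`,
`∇ d\bar z^i = \bar τ ⊗ d\bar z^i + d\bar z^i ⊗ \bar τ`. -/
def conn (a b c : Idx n) : Smooth n :=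
  - (tau b * projHol a c + projHol a b * tau c)
    - (taubar b * projAnti a c + projAnti a b * taubar c)

theorem conn_symm (a b c : Idx n) : conn a b c = conn a c b := by
  rw [conn, conn]; ring

theorem IsHol.sum_conn {α : Idx n → Smooth n} (h : IsHol α) (b c : Idx n) :
    ∑ a, conn a b c * α a = - (tau b * α c + α b * tau c) := by
  have e : ∀ a, conn a b c * α a = - (tau b * (α a * projHol a c) + tau c * (α a * projHol a b))
      - (taubar b * (α a * projAnti a c) + taubar c * (α a * projAnti a b)) := fun a => by
    rw [conn]; ring
  simp only [e, Finset.sum_sub_distrib, Finset.sum_neg_distrib, Finset.sum_add_distrib,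
    ← Finset.mul_sum, h.sum_projHol, h c, h b]
  ring

theorem IsAnti.sum_conn {α : Idx n → Smooth n} (h : IsAnti α) (b c : Idx n) :
    ∑ a, conn a b c * α a = - (taubar b * α c + α b * taubar c) := by
  have e : ∀ a, conn a b c * α a = - (tau b * (α a * projHol a c) + tau c * (α a * projHol a b))
      - (taubar b * (α a * projAnti a c) + taubar c * (α a * projAnti a b)) := fun a => by
    rw [conn]; ring
  simp only [e, Finset.sum_sub_distrib, Finset.sum_neg_distrib, Finset.sum_add_distrib,
    ← Finset.mul_sum, h.sum_projAnti, h c, h b]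
  ring

theorem christoffel_eq (k : Fin (n + 1)) (a b c : Idx n) : christoffel k a b c = conn a b c := by
  have h1 : ∀ d, ∑ e, conn e b c * metric k e d = - (tau b * herm c d + herm b d * tau c)
      - (taubar b * herm d c + herm d b * taubar c) := fun d => by
    simp only [metric_eq, mul_add, Finset.sum_add_distrib]
    rw [(isHol_herm d).sum_conn, (isAnti_herm d).sum_conn]
    ring
  have h2 : ∀ d, pd b (metric k d c) + pd c (metric k d b) - pd d (metric k b c)
      = 2 * ∑ e, conn e b c * metric k e d := fun d => by
    rw [h1]
    simp only [metric_eq, map_add, pd_herm]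
    ring
  have h3 : ∑ d, metricInv k a d * (2 * ∑ e, conn e b c * metric k e d)
      = 2 * ∑ e, conn e b c * ∑ d, metricInv k a d * metric k d e := by
    simp only [Finset.mul_sum]
    rw [Finset.sum_comm]
    exact Finset.sum_congr rfl fun e _ => Finset.sum_congr rfl fun d _ => by
      rw [metric_symm k e d]; ring
  have h4 : ∀ x : Smooth n, (1 / 2 : ℂ) • (2 * x) = x := fun x => by
    rw [two_mul, ← two_smul ℂ, smul_smul]; norm_num
  simp only [christoffel, h2, h3, h4, sum_metricInv_metric, mul_ite, mul_one, mul_zero,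
    Finset.sum_ite_eq, Finset.mem_univ, if_true]

theorem patch_Γ (k : Fin (n + 1)) (a b c : Idx n) : (patch n k).Γ a b c = conn a b c :=
  christoffel_eq k a b c

theorem patch_pd (k : Fin (n + 1)) (a : Idx n) : (patch n k).pd a = pd a := rfl

theorem patch_poisson (k : Fin (n + 1)) (a b : Idx n) : (patch n k).poisson a b = omegaUp k a b :=
  rfl

theorem IsHol.cov (k : Fin (n + 1)) {α : Idx n → Smooth n} (h : IsHol α) (j m : Idx n) :
    (patch n k).cov j α m = pd j (α m) + (tau j * α m + α j * tau m) := by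
  simp only [PatchData.cov, patch_Γ, patch_pd, h.sum_conn]
  ring

theorem IsAnti.cov (k : Fin (n + 1)) {α : Idx n → Smooth n} (h : IsAnti α) (j m : Idx n) :
    (patch n k).cov j α m = pd j (α m) + (taubar j * α m + α j * taubar m) := by
  simp only [PatchData.cov, patch_Γ, patch_pd, h.sum_conn]
  ring

theorem cov_dz (k : Fin (n + 1)) (i : Fin n) (j m : Idx n) :
    (patch n k).cov j (dz i) m = tau j * dz i m + dz i j * tau m := by
  rw [(isHol_dz i).cov, pd_dz, zero_add]

theorem cov_dzbar (k : Fin (n + 1)) (i : Fin n) (j m : Idx n) :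
    (patch n k).cov j (dzbar i) m = taubar j * dzbar i m + dzbar i j * taubar m := by
  rw [(isAnti_dzbar i).cov, pd_dzbar, zero_add]

theorem cov_tau (k : Fin (n + 1)) (j m : Idx n) :
    (patch n k).cov j tau m = herm m j + tau j * tau m := by
  rw [isHol_tau.cov, pd_tau]; ring

theorem cov_taubar (k : Fin (n + 1)) (j m : Idx n) :
    (patch n k).cov j taubar m = herm j m + taubar j * taubar m := by
  rw [isAnti_taubar.cov, pd_taubar]; ring

theorem cov₂_herm (k : Fin (n + 1)) (s : Idx n) :
    (patch n k).cov₂ s (herm : Idx n → Idx n → Smooth n) = 0 := by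
  ext1 a
  ext1 b
  have h1 := (isHol_herm b).sum_conn s a
  have h2 := (isAnti_herm a).sum_conn s b
  simp only [PatchData.cov₂, patch_Γ, patch_pd, h1, h2, pd_herm]
  change _ = (0 : Smooth n)
  ring

theorem cov₂_smul_herm_add (k : Fin (n + 1)) (s : Idx n) (c c' : ℂ) :
    (patch n k).cov₂ s (fun a b => c • herm a b + c' • herm b a) = 0 := by
  ext1 a
  ext1 b
  have h0 : ∀ a b, pd s (herm a b) = ∑ k, conn k s a * herm k b + ∑ k, conn k s b * herm a k :=
    fun a b => by
      have h := congrFun (congrFun (cov₂_herm k s) a) b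
      simp only [PatchData.cov₂, patch_Γ, patch_pd] at h
      change _ = (0 : Smooth n) at h
      linear_combination h
  simp only [PatchData.cov₂, patch_Γ, patch_pd, map_add, Derivation.map_smul, h0, mul_add,
    mul_smul_comm, Finset.sum_add_distrib, ← Finset.smul_sum]
  change _ = (0 : Smooth n)
  module

theorem cov₂_metric (k : Fin (n + 1)) (s : Idx n) : (patch n k).cov₂ s (metric k) = 0 := by
  have h : metric k = fun a b : Idx n => (1 : ℂ) • herm a b + (1 : ℂ) • herm b a := by
    ext1 a; ext1 b; rw [one_smul, one_smul, metric_eq]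
  rw [h, cov₂_smul_herm_add]

theorem sum_cplx_conn (a s c : Idx n) :
    ∑ b, cplx a b * conn b s c = ∑ b, conn a s b * cplx b c := by
  have e1 : ∀ b, cplx a b * conn b s c
      = - (tau s * (cplx a b * projHol b c) + tau c * (cplx a b * projHol b s))
        - (taubar s * (cplx a b * projAnti b c) + taubar c * (cplx a b * projAnti b s)) :=
    fun b => by rw [conn]; ring
  have e2 : ∀ b, conn a s b * cplx b c
      = imag n * (- (tau s * (projHol a b * projHol b c) + projHol a s * (tau b * projHol b c))
        - (taubar s * (projAnti a b * projHol b c) + projAnti a s * (taubar b * projHol b c))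
        + (tau s * (projHol a b * projAnti b c) + projHol a s * (tau b * projAnti b c))
        + (taubar s * (projAnti a b * projAnti b c) + projAnti a s * (taubar b * projAnti b c))) :=
    fun b => by rw [conn, cplx]; ring
  simp only [e1, e2, Finset.sum_sub_distrib, Finset.sum_add_distrib, Finset.sum_neg_distrib,
    ← Finset.mul_sum, sum_cplx_projHol, sum_cplx_projAnti, (isHol_projHol a).sum_projHol,
    (isAnti_projAnti a).sum_projAnti, isHol_projHol a c, isAnti_projAnti a c, isHol_tau c,
    isAnti_taubar c, isHol_tau.sum_projHol, isAnti_taubar.sum_projAnti]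
  ring

/-- The bivector is parallel: `ω^{ab} g_{bc}` is the complex structure, which has constant
components and commutes with the Christoffel symbols, while `g` is parallel and invertible. -/
theorem isParallelPoisson (k : Fin (n + 1)) : IsParallelPoisson (patch n k) where
  pd_comm := cpn_pd_comm
  symm i j l := by rw [patch_Γ, patch_Γ, conn_symm]
  nab_poisson s i j := by
    simp only [patch_Γ, patch_pd, patch_poisson]
    set v : Idx n → Smooth n := fun b => pd s (omegaUp k i b)
      + ∑ l, conn i s l * omegaUp k l b + ∑ l, conn b s l * omegaUp k i l with hv
    have h0 : ∀ b c, pd s (metric k b c)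
        = ∑ l, conn l s b * metric k l c + ∑ l, conn l s c * metric k b l := fun b c => by
      have h := congrFun (congrFun (cov₂_metric k s) b) c
      simp only [PatchData.cov₂, patch_Γ, patch_pd] at h
      change _ = (0 : Smooth n) at h
      linear_combination h
    have h1 : ∀ c, ∑ b, v b * metric k b c = 0 := fun c => by
      have h2 : ∑ b, (omegaUp k i b * pd s (metric k b c) + metric k b c * pd s (omegaUp k i b))
          = 0 := by
        have h3 := congrArg (pd s) (sum_omegaUp_metric k i c)
        have h4 : pd s (cplx i c) = 0 := by
          simp only [cplx, imag, projHol, projAnti, dz_eq, dzbar_eq, ← map_mul, ← map_sum,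
            ← map_sub, pd_algebraMap]
        rw [h4, map_sum] at h3
        simpa only [Derivation.leibniz, smul_eq_mul] using h3
      have h5 : ∑ b, (∑ l, conn i s l * omegaUp k l b) * metric k b c
          = ∑ l, conn i s l * cplx l c := by
        simp only [Finset.sum_mul, mul_assoc]
        rw [Finset.sum_comm]
        simp only [← Finset.mul_sum, sum_omegaUp_metric]
      have h6 : ∑ b, omegaUp k i b * ∑ l, conn l s c * metric k b l
          = ∑ l, cplx i l * conn l s c := by
        simp only [Finset.mul_sum, ← sum_omegaUp_metric k i, Finset.sum_mul]
        rw [Finset.sum_comm]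
        exact Finset.sum_congr rfl fun l _ => Finset.sum_congr rfl fun b _ => by ring
      have h7 : ∑ b, omegaUp k i b * ∑ l, conn l s b * metric k l c
          = ∑ b, (∑ l, conn b s l * omegaUp k i l) * metric k b c := by
        simp only [Finset.mul_sum, Finset.sum_mul]
        rw [Finset.sum_comm]
        exact Finset.sum_congr rfl fun l _ => Finset.sum_congr rfl fun b _ => by ring
      have h8 : ∑ b, metric k b c * pd s (omegaUp k i b)
          = ∑ b, pd s (omegaUp k i b) * metric k b c :=
        Finset.sum_congr rfl fun b _ => mul_comm _ _
      rw [Finset.sum_add_distrib, h8] at h2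
      simp only [h0, mul_add, Finset.sum_add_distrib, h6, h7, sum_cplx_conn, ← h5] at h2
      simp only [hv, add_mul, Finset.sum_add_distrib]
      linear_combination h2
    have h9 : v j = ∑ b, ∑ c, v b * metric k b c * metricInv k j c := by
      simp only [mul_assoc, ← Finset.mul_sum]
      have : ∀ b, ∑ c, metric k b c * metricInv k j c = if j = b then 1 else 0 := fun b => by
        rw [← sum_metricInv_metric k j b]
        exact Finset.sum_congr rfl fun c _ => by rw [metric_symm, mul_comm]
      simp only [this, mul_ite, mul_one, mul_zero, Finset.sum_ite_eq, Finset.mem_univ, if_true]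
    change v j = 0
    rw [h9, Finset.sum_comm]
    simp only [← Finset.sum_mul, h1, zero_mul, Finset.sum_const_zero]

theorem R_dz (k : Fin (n + 1)) (i : Fin n) (a b d : Idx n) :
    (covForm (patch n k)).R a b (dz i) d
      = (herm b a - herm a b) * dz i d + dz i b * herm d a - dz i a * herm d b := by
  have h1 : ∀ a b, (patch n k).cov a ((patch n k).cov b (dz i)) d
      = herm b a * dz i d + tau b * tau d * dz i a + tau a * dz i b * tau d
        + dz i b * herm d a := fun a b => by
    have e : (patch n k).cov b (dz i) = fun m => tau b * dz i m + dz i b * tau m :=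
      funext fun m => cov_dz k i b m
    have hh : IsHol fun m => tau b * dz i m + dz i b * tau m :=
      ((isHol_dz i).smul _).add (isHol_tau.smul _)
    rw [e, hh.cov]
    simp only [map_add, Derivation.leibniz, pd_dz, pd_tau, smul_eq_mul]
    ring
  rw [CovModule.R, Pi.sub_apply, covForm_nab, covForm_nab, covForm_nab, covForm_nab, h1, h1]
  ring

theorem R_dzbar (k : Fin (n + 1)) (i : Fin n) (a b d : Idx n) :
    (covForm (patch n k)).R a b (dzbar i) d
      = (herm a b - herm b a) * dzbar i d + dzbar i b * herm a d - dzbar i a * herm b d := by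
  have h1 : ∀ a b, (patch n k).cov a ((patch n k).cov b (dzbar i)) d
      = herm a b * dzbar i d + taubar b * taubar d * dzbar i a + taubar a * dzbar i b * taubar d
        + dzbar i b * herm a d := fun a b => by
    have e : (patch n k).cov b (dzbar i) = fun m => taubar b * dzbar i m + dzbar i b * taubar m :=
      funext fun m => cov_dzbar k i b m
    have hh : IsAnti fun m => taubar b * dzbar i m + dzbar i b * taubar m :=
      ((isAnti_dzbar i).smul _).add (isAnti_taubar.smul _)
    rw [e, hh.cov]
    simp only [map_add, Derivation.leibniz, pd_dzbar, pd_taubar, smul_eq_mul]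
    ring
  rw [CovModule.R, Pi.sub_apply, covForm_nab, covForm_nab, covForm_nab, covForm_nab, h1, h1]
  ring

/-- The curvature tensor is that of constant holomorphic sectional curvature. -/
theorem curv_eq (k : Fin (n + 1)) (c d a b : Idx n) : (patch n k).curv c d a b
    = - ((herm b a - herm a b) * projHol c d + projHol c b * herm d a - projHol c a * herm d b)
      - ((herm a b - herm b a) * projAnti c d + projAnti c b * herm a d
        - projAnti c a * herm b d) := by
  have h1 : ∀ i, ∑ e, (patch n k).curv e d a b * dz i e
      = - ((herm b a - herm a b) * dz i d + dz i b * herm d a - dz i a * herm d b) := fun i => by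
    rw [← R_dz k, R_covForm_apply (isParallelPoisson k), neg_neg]
  have h2 : ∀ i, ∑ e, (patch n k).curv e d a b * dzbar i e
      = - ((herm a b - herm b a) * dzbar i d + dzbar i b * herm a d - dzbar i a * herm b d) :=
      fun i => by
    rw [← R_dzbar k, R_covForm_apply (isParallelPoisson k), neg_neg]
  have h3 : (patch n k).curv c d a b
      = ∑ e, (patch n k).curv e d a b * projHol c e + ∑ e, (patch n k).curv e d a b * projAnti c e
      := by
    simp only [← Finset.sum_add_distrib, ← mul_add, projHol_add_projAnti, mul_ite, mul_one,
      mul_zero, Finset.sum_ite_eq, Finset.mem_univ, if_true]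
  have h4 : ∑ e, (patch n k).curv e d a b * projHol c e
      = ∑ i, algebraMap ℂ (Smooth n) (frame i c) * ∑ e, (patch n k).curv e d a b * dz i e := by
    simp only [projHol, Finset.mul_sum]
    rw [Finset.sum_comm]
    exact Finset.sum_congr rfl fun i _ => Finset.sum_congr rfl fun e _ => by ring
  have h5 : ∑ e, (patch n k).curv e d a b * projAnti c e
      = ∑ i, algebraMap ℂ (Smooth n) (frameBar i c)
        * ∑ e, (patch n k).curv e d a b * dzbar i e := by
    simp only [projAnti, Finset.mul_sum]
    rw [Finset.sum_comm]
    exact Finset.sum_congr rfl fun i _ => Finset.sum_congr rfl fun e _ => by ring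
  rw [h3, h4, h5]
  simp only [h1, h2, projHol, projAnti, Finset.mul_sum, Finset.sum_mul, sub_eq_add_neg, neg_add,
    neg_neg, mul_add, ← Finset.sum_neg_distrib, ← Finset.sum_add_distrib]
  exact Finset.sum_congr rfl fun i _ => by ring

theorem IsHol.R {α : Idx n → Smooth n} (h : IsHol α) (k : Fin (n + 1)) (a b d : Idx n) :
    (covForm (patch n k)).R a b α d
      = (herm b a - herm a b) * α d + α b * herm d a - α a * herm d b := by
  have e : ∀ c, (patch n k).curv c d a b * α c
      = - ((herm b a - herm a b) * (α c * projHol c d) + herm d a * (α c * projHol c b)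
          - herm d b * (α c * projHol c a))
        - ((herm a b - herm b a) * (α c * projAnti c d) + herm a d * (α c * projAnti c b)
          - herm b d * (α c * projAnti c a)) := fun c => by rw [curv_eq]; ring
  rw [R_covForm_apply (isParallelPoisson k)]
  simp only [e, Finset.sum_sub_distrib, Finset.sum_add_distrib, Finset.sum_neg_distrib,
    ← Finset.mul_sum, h.sum_projHol, h a, h b, h d]
  ring

theorem IsAnti.R {α : Idx n → Smooth n} (h : IsAnti α) (k : Fin (n + 1)) (a b d : Idx n) :
    (covForm (patch n k)).R a b α d
      = (herm a b - herm b a) * α d + α b * herm a d - α a * herm b d := by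
  have e : ∀ c, (patch n k).curv c d a b * α c
      = - ((herm b a - herm a b) * (α c * projHol c d) + herm d a * (α c * projHol c b)
          - herm d b * (α c * projHol c a))
        - ((herm a b - herm b a) * (α c * projAnti c d) + herm a d * (α c * projAnti c b)
          - herm b d * (α c * projAnti c a)) := fun c => by rw [curv_eq]; ring
  rw [R_covForm_apply (isParallelPoisson k)]
  simp only [e, Finset.sum_sub_distrib, Finset.sum_add_distrib, Finset.sum_neg_distrib,
    ← Finset.mul_sum, h.sum_projAnti, h a, h b, h d]
  ring

/-! ### The generalised Ricci form -/

theorem trace_projHol : ∑ s : Idx n, projHol s s = (n : Smooth n) := by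
  simp only [projHol]
  rw [Finset.sum_comm]
  simp only [alg_sum_dz_frame, if_true, Finset.sum_const, Finset.card_univ, Fintype.card_fin,
    nsmul_eq_mul, mul_one]

theorem trace_projAnti : ∑ s : Idx n, projAnti s s = (n : Smooth n) := by
  simp only [projAnti]
  rw [Finset.sum_comm]
  simp only [alg_sum_dzbar_frameBar, if_true, Finset.sum_const, Finset.card_univ,
    Fintype.card_fin, nsmul_eq_mul, mul_one]

theorem sum_cplx_curv (k : Fin (n + 1)) (p q : Idx n) :
    ∑ s, ∑ j, cplx s j * (patch n k).curv j p q s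
      = - (imag n * (n + 1) * (herm p q - herm q p)) := by
  have e : ∀ s j, cplx s j * (patch n k).curv j p q s
      = - ((herm s q - herm q s) * (cplx s j * projHol j p)
          + herm p q * (cplx s j * projHol j s) - herm p s * (cplx s j * projHol j q))
        - ((herm q s - herm s q) * (cplx s j * projAnti j p) + herm q p * (cplx s j * projAnti j s)
          - herm s p * (cplx s j * projAnti j q)) := fun s j => by rw [curv_eq]; ring
  simp only [e, Finset.sum_sub_distrib, Finset.sum_add_distrib, Finset.sum_neg_distrib,
    ← Finset.mul_sum, sum_cplx_projHol, sum_cplx_projAnti]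
  have e1 : ∑ s, (herm s q - herm q s) * (imag n * projHol s p) = imag n * herm p q := by
    have : ∀ s, (herm s q - herm q s) * (imag n * projHol s p)
      = imag n * (herm s q * projHol s p - herm q s * projHol s p) := fun s => by ring
    simp only [this, ← Finset.mul_sum, Finset.sum_sub_distrib]
    rw [(isHol_herm q).sum_projHol, isAnti_herm q p, sub_zero]
  have e2 : ∑ s, herm p s * (imag n * projHol s q) = 0 := by
    simp only [mul_left_comm _ (imag n), ← Finset.mul_sum]
    rw [isAnti_herm p q, mul_zero]
  have e3 : ∑ s, (herm q s - herm s q) * -(imag n * projAnti s p) = - (imag n * herm q p) := by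
    have : ∀ s, (herm q s - herm s q) * -(imag n * projAnti s p)
      = - imag n * (herm q s * projAnti s p - herm s q * projAnti s p) := fun s => by ring
    simp only [this, ← Finset.mul_sum, Finset.sum_sub_distrib]
    rw [(isAnti_herm q).sum_projAnti, isHol_herm q p, sub_zero]
    ring
  have e4 : ∑ s, herm s p * -(imag n * projAnti s q) = 0 := by
    have : ∀ s, herm s p * -(imag n * projAnti s q) = - imag n * (herm s p * projAnti s q) :=
      fun s => by ring
    simp only [this, ← Finset.mul_sum]
    rw [isHol_herm p q, mul_zero]
  rw [e1, e2, e3, e4, trace_projHol, trace_projAnti]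
  ring

theorem genRicci_apply (k : Fin (n + 1)) (p q : Idx n) :
    genRicci (patch n k) (metric k) p q = imag n * (n + 1) * (herm p q - herm q p) := by
  have h1 : ∀ s j, ∑ i, omegaUp k i s * metric k i j = - cplx s j := fun s j => by
    rw [← sum_omegaUp_metric k, ← Finset.sum_neg_distrib]
    exact Finset.sum_congr rfl fun i _ => by rw [omegaUp_antisymm]; ring
  have h2 : genRicci (patch n k) (metric k) p q = half (Smooth n) * ∑ s, ∑ j,
      (∑ i, omegaUp k i s * metric k i j)
        * ((patch n k).curv j p q s - (patch n k).curv j q p s) := by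
    simp only [genRicci, Finset.sum_apply, Pi.smul_apply, smul_eq_mul,
      H_apply (isParallelPoisson k), patch_poisson, Finset.mul_sum, Finset.sum_mul]
    rw [Finset.sum_comm, Finset.sum_congr rfl fun j _ => Finset.sum_comm, Finset.sum_comm]
    exact Finset.sum_congr rfl fun s _ => Finset.sum_congr rfl fun j _ =>
      Finset.sum_congr rfl fun i _ => by ring
  have h3 : ∑ s, ∑ j, - cplx s j * ((patch n k).curv j p q s - (patch n k).curv j q p s)
      = - ∑ s, ∑ j, cplx s j * (patch n k).curv j p q s
        + ∑ s, ∑ j, cplx s j * (patch n k).curv j q p s := by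
    simp only [← Finset.sum_neg_distrib, ← Finset.sum_add_distrib]
    exact Finset.sum_congr rfl fun s _ => Finset.sum_congr rfl fun j _ => by ring
  rw [h2]
  simp only [h1]
  rw [h3, sum_cplx_curv, sum_cplx_curv]
  linear_combination (imag n * (n + 1) * (herm p q - herm q p)) * half_add_half (A := Smooth n)

theorem varpi_apply (k : Fin (n + 1)) (p q : Idx n) :
    varpi k p q = 2 * (imag n * (herm p q - herm q p)) := by
  have h : varpi k p q = omegaLow k q p - omegaLow k p q := by
    simp only [varpi, Finset.sum_apply, Pi.smul_apply, PatchData.wedge, Pi.single_apply,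
      smul_eq_mul, mul_ite, mul_one, mul_zero, mul_sub, Finset.sum_sub_distrib,
      Finset.sum_ite_irrel, Finset.sum_const_zero, Finset.sum_ite_eq, Finset.mem_univ, if_true]
  rw [h, omegaLow_eq, omegaLow_eq]
  ring

theorem genRicci_eq (k : Fin (n + 1)) :
    genRicci (patch n k) (metric k) = (((n : ℂ) + 1) / 2) • varpi k := by
  ext1 p
  ext1 q
  have h : ∀ x : Smooth n, (((n : ℂ) + 1) / 2) • (2 * x) = (n + 1) * x := fun x => by
    rw [two_mul, ← two_smul ℂ, smul_smul, div_mul_cancel₀ _ two_ne_zero, Algebra.smul_def]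
    simp
  rw [genRicci_apply, Pi.smul_apply, Pi.smul_apply, varpi_apply, h]
  ring

theorem cov₂_genRicci (k : Fin (n + 1)) (s : Idx n) :
    (patch n k).cov₂ s (genRicci (patch n k) (metric k)) = 0 := by
  have h : genRicci (patch n k) (metric k) = fun a b : Idx n =>
      (I * (n + 1)) • herm a b + (- (I * (n + 1))) • herm b a := by
    ext1 a
    ext1 b
    rw [genRicci_apply, Algebra.smul_def, Algebra.smul_def, map_neg, map_mul, map_add, map_natCast,
      map_one, imag]
    ring
  rw [h, cov₂_smul_herm_add]

/-! ### The quantum metric and the quantum Levi-Civita connection -/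

theorem hom_of_tens {S : PatchData (Smooth n) (Idx n)} (ξ η : Idx n → Smooth n) :
    (symb₂ S).hom (QForm.of S ξ ⊗₁ QForm.of S η) = (tens η ξ, (covForm S).corr ξ η) := by
  change (symb₂ S).hom (BTensor.tmul _ (QForm.of S ξ) (QForm.of S η)) = _
  rw [symb₂_tmul]
  simp only [form_of_fst, form_of_snd, map_zero, LinearMap.zero_apply, zero_add]

theorem hom_sum_of_tens {S : PatchData (Smooth n) (Idx n)}
    (f : Fin n → Fin n → Idx n → Smooth n) (η : Fin n → Idx n → Smooth n) :
    (symb₂ S).hom (∑ j, ∑ i, QForm.of S (f j i) ⊗₁ QForm.of S (η j))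
      = (∑ j, tens (η j) (∑ i, f j i), ∑ j, (covForm S).corr (∑ i, f j i) (η j)) := by
  have h : ∀ j, ∑ i, QForm.of S (f j i) ⊗₁ QForm.of S (η j)
      = QForm.of S (∑ i, f j i) ⊗₁ QForm.of S (η j) := fun j => by
    rw [← sum_form_of]
    exact (map_sum ((BTensor.tmulHom (M := QForm S) (N := QForm S) (QAlg S)).flip
      (QForm.of S (η j))) _ _).symm
  simp only [h, map_sum, hom_of_tens]
  ext1
  · exact Prod.fst_sum
  · exact Prod.snd_sum

theorem corr_apply (k : Fin (n + 1)) (ξ η : Idx n → Smooth n) (q m : Idx n) :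
    (covForm (patch n k)).corr ξ η q m = half (Smooth n)
      * pois k (fun a => (patch n k).cov a ξ m) (fun b => (patch n k).cov b η q) := by
  simp only [CovModule.corr, pois, Pi.smul_apply, Finset.sum_apply, tens_apply, smul_eq_mul,
    covForm_nab, patch_poisson]
  congr 1
  exact Finset.sum_congr rfl fun a _ => Finset.sum_congr rfl fun b _ => by ring

theorem sum_gBar_dz (j : Fin n) (a : Idx n) :
    (∑ i, gBar i j • dz i) a = t2 * dz j a - t2 * zc j * tau a := by
  have h : ∀ i, gBar i j * dz i a
      = (if i = j then t2 * dz i a else 0) - t2 * zc j * (t2 * zbar i * dz i a) := fun i => by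
    rw [gBar]; split_ifs <;> ring
  simp only [Finset.sum_apply, Pi.smul_apply, smul_eq_mul, h, Finset.sum_sub_distrib,
    ← Finset.mul_sum, ← tau_apply, Finset.sum_ite_eq', Finset.mem_univ, if_true]

theorem sum_gBar_dzbar (i : Fin n) (a : Idx n) :
    (∑ j, gBar i j • dzbar j) a = t2 * dzbar i a - t2 * zbar i * taubar a := by
  have h : ∀ j, gBar i j * dzbar j a
      = (if i = j then t2 * dzbar j a else 0) - t2 * zbar i * (t2 * zc j * dzbar j a) := fun j => by
    rw [gBar]; split_ifs <;> ring
  simp only [Finset.sum_apply, Pi.smul_apply, smul_eq_mul, h, Finset.sum_sub_distrib,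
    ← Finset.mul_sum, ← taubar_apply, Finset.sum_ite_eq, Finset.mem_univ, if_true]

/-- The form `g_{i \bar j} dz^i` is the metric dual of `∂/∂\bar z^j`, so its covariant derivatives
along vectors of type `(1, 0)` vanish: as a function of `a` the right hand side is of type
`(0, 1)`. -/
theorem cov_sum_gBar_dz (k : Fin (n + 1)) (j : Fin n) (a m : Idx n) :
    (patch n k).cov a (∑ i, gBar i j • dz i) m
      = (t2 * zc j * tau m - t2 * dz j m) * taubar a - t2 * zc j * herm m a := by
  have e : (∑ i, gBar i j • dz i) = fun a => t2 * dz j a - t2 * zc j * tau a :=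
    funext fun a => sum_gBar_dz j a
  have hh : IsHol fun a => t2 * dz j a - t2 * zc j * tau a :=
    ((isHol_dz j).smul _).sub (isHol_tau.smul _)
  rw [e, hh.cov]
  simp only [map_sub, Derivation.leibniz, pd_dz, pd_tau, pd_t2, pd_zc, smul_eq_mul]
  ring

theorem cov_sum_gBar_dzbar (k : Fin (n + 1)) (i : Fin n) (a m : Idx n) :
    (patch n k).cov a (∑ j, gBar i j • dzbar j) m
      = (t2 * zbar i * taubar m - t2 * dzbar i m) * tau a - t2 * zbar i * herm a m := by
  have e : (∑ j, gBar i j • dzbar j) = fun a => t2 * dzbar i a - t2 * zbar i * taubar a :=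
    funext fun a => sum_gBar_dzbar i a
  have hh : IsAnti fun a => t2 * dzbar i a - t2 * zbar i * taubar a :=
    ((isAnti_dzbar i).smul _).sub (isAnti_taubar.smul _)
  rw [e, hh.cov]
  simp only [map_sub, Derivation.leibniz, pd_dzbar, pd_taubar, pd_t2, pd_zbar, smul_eq_mul]
  ring

theorem isHol_cov_dz (k : Fin (n + 1)) (i : Fin n) (m : Idx n) :
    IsHol fun a => (patch n k).cov a (dz i) m := by
  have e : (fun a => (patch n k).cov a (dz i) m) = fun a => dz i m * tau a + tau m * dz i a :=
    funext fun a => by rw [cov_dz]; ring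
  rw [e]
  exact (isHol_tau.smul _).add ((isHol_dz i).smul _)

theorem isAnti_cov_dzbar (k : Fin (n + 1)) (i : Fin n) (m : Idx n) :
    IsAnti fun a => (patch n k).cov a (dzbar i) m := by
  have e : (fun a => (patch n k).cov a (dzbar i) m)
      = fun a => dzbar i m * taubar a + taubar m * dzbar i a :=
    funext fun a => by rw [cov_dzbar]; ring
  rw [e]
  exact (isAnti_taubar.smul _).add ((isAnti_dzbar i).smul _)

theorem corr_gBar_dz (k : Fin (n + 1)) (j : Fin n) :
    (covForm (patch n k)).corr (∑ i, gBar i j • dz i) (dzbar j) = 0 := by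
  ext1 q
  ext1 m
  have h : IsAnti fun a => (patch n k).cov a (∑ i, gBar i j • dz i) m := by
    simp only [cov_sum_gBar_dz]
    exact (isAnti_taubar.smul _).sub ((isAnti_herm m).smul _)
  rw [corr_apply, pois_anti_anti k h (isAnti_cov_dzbar k j q), mul_zero]
  rfl

theorem corr_gBar_dzbar (k : Fin (n + 1)) (i : Fin n) :
    (covForm (patch n k)).corr (∑ j, gBar i j • dzbar j) (dz i) = 0 := by
  ext1 q
  ext1 m
  have h : IsHol fun a => (patch n k).cov a (∑ j, gBar i j • dzbar j) m := by
    simp only [cov_sum_gBar_dzbar]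
    exact (isHol_tau.smul _).sub ((isHol_herm m).smul _)
  rw [corr_apply, pois_hol_hol k h (isHol_cov_dz k i q), mul_zero]
  rfl

theorem symb₂_gBar_dz (k : Fin (n + 1)) :
    (symb₂ (patch n k)).hom (∑ i, ∑ j, QForm.of (patch n k) (gBar i j • dz i)
      ⊗₁ QForm.of (patch n k) (dzbar j)) = (flip₂ herm, 0) := by
  rw [Finset.sum_comm, hom_sum_of_tens fun j i : Fin n => (gBar i j • dz i : Idx n → Smooth n)]
  simp only [corr_gBar_dz, Finset.sum_const_zero]
  congr 1
  ext1 q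
  ext1 m
  have h : ∀ j, dzbar j q * (t2 * dz j m - t2 * zc j * tau m)
      = t2 * (dz j m * dzbar j q) - tau m * (t2 * zc j * dzbar j q) := fun j => by ring
  rw [Finset.sum_apply, Finset.sum_apply]
  simp only [tens_apply, Pi.smul_apply, smul_eq_mul, sum_gBar_dz, h,
    Finset.sum_sub_distrib, ← Finset.mul_sum, ← taubar_apply]
  rfl

theorem symb₂_gBar_dzbar (k : Fin (n + 1)) :
    (symb₂ (patch n k)).hom (∑ i, ∑ j, QForm.of (patch n k) (gBar i j • dzbar j)
      ⊗₁ QForm.of (patch n k) (dz i)) = (herm, 0) := by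
  rw [hom_sum_of_tens fun i j : Fin n => (gBar i j • dzbar j : Idx n → Smooth n)]
  simp only [corr_gBar_dzbar, Finset.sum_const_zero]
  congr 1
  ext1 q
  ext1 m
  have h : ∀ i, dz i q * (t2 * dzbar i m - t2 * zbar i * taubar m)
      = t2 * (dz i q * dzbar i m) - taubar m * (t2 * zbar i * dz i q) := fun i => by ring
  rw [Finset.sum_apply, Finset.sum_apply]
  simp only [tens_apply, Pi.smul_apply, smul_eq_mul, sum_gBar_dzbar, h,
    Finset.sum_sub_distrib, ← Finset.mul_sum, ← tau_apply]
  rw [herm, mul_comm (taubar m)]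

theorem symb₂_gammabar_fst (k : Fin (n + 1)) :
    ((symb₂ (patch n k)).hom (gammabar k)).1 = flip₂ herm := by
  rw [gammabar, map_sub, map_sum]
  simp only [hom_of_tens, Prod.fst_sub, Prod.fst_sum]
  ext1 q
  ext1 m
  have h : ∀ i, dzbar i q * (t2 * dz i m) = t2 * (dz i m * dzbar i q) := fun i => by ring
  simp only [Pi.sub_apply, Finset.sum_apply, tens_apply, Pi.smul_apply, smul_eq_mul, h,
    ← Finset.mul_sum, flip₂_apply]
  rw [herm, mul_comm (tau m)]

theorem symb₂_gamma_fst (k : Fin (n + 1)) :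
    ((symb₂ (patch n k)).hom (gamma k)).1 = (herm : Idx n → Idx n → Smooth n) := by
  rw [gamma, map_sub, map_sum]
  simp only [hom_of_tens, Prod.fst_sub, Prod.fst_sum]
  ext1 q
  ext1 m
  have h : ∀ i, dz i q * (t2 * dzbar i m) = t2 * (dz i q * dzbar i m) := fun i => by ring
  simp only [Pi.sub_apply, Finset.sum_apply, tens_apply, Pi.smul_apply, smul_eq_mul, h,
    ← Finset.mul_sum]
  rfl

theorem symb₂_varpiTilde_fst (k : Fin (n + 1)) :
    ((symb₂ (patch n k)).hom (varpiTilde k)).1 = imag n • (flip₂ herm - herm) := by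
  rw [varpiTilde, (symb₂ (patch n k)).left, map_sub, Prod.fst_sub, symb₂_gammabar_fst,
    symb₂_gamma_fst]
  rfl

theorem quantumMetric_eq (k : Fin (n + 1)) : quantumMetric (patch n k) (metric k)
    = (∑ i, ∑ j, QForm.of (patch n k) (gBar i j • dz i) ⊗₁ QForm.of (patch n k) (dzbar j))
      + (∑ i, ∑ j, QForm.of (patch n k) (gBar i j • dzbar j) ⊗₁ QForm.of (patch n k) (dz i))
      - (QAlg.const (patch n k) (((n : ℂ) + 1) / 2) * QAlg.lam (patch n k)) • varpiTilde k := by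
  apply (symb₂ (patch n k)).ext
  rw [symb₂_quantumMetric (isParallelPoisson k) (metric_symm k) (cov₂_metric k), map_sub, map_add,
    symb₂_gBar_dz, symb₂_gBar_dzbar, const_mul_lam, Symbol.lamAlg_smul, symb₂_varpiTilde_fst]
  have hc : algebraMap ℂ (Smooth n) (((n : ℂ) + 1) / 2) = half (Smooth n) * (n + 1) := by
    rw [half, div_eq_mul_inv, mul_comm, one_div, map_mul, map_add, map_natCast, map_one]
  ext1
  · rw [Prod.fst_sub, Prod.fst_add, sub_zero]
    ext1 q
    ext1 m
    simp only [Pi.add_apply, flip₂_apply, metric_eq]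
    rw [add_comm]
  · rw [Prod.snd_sub, Prod.snd_add, add_zero, zero_sub, hc]
    refine congrArg Neg.neg ?_
    ext1 q
    ext1 m
    simp only [Pi.smul_apply, Pi.sub_apply, flip₂_apply, genRicci_apply, smul_eq_mul]
    ring

/-- The order `λ` part of `∇_Q dz^i` is `i` times its order zero part: of the four terms of
`ω^{ab} [∇_b, ∇_m] ∇_a dz^i`, two are equal to `i ∇_m dz^i`, one vanishes by type, and one contracts
`ω^{ab}` with the symmetric tensor `∇ dz^i`. -/
theorem curvTerm_dz (k : Fin (n + 1)) (i : Fin n) (q m : Idx n) :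
    curvTerm (patch n k) (dz i) q m = imag n * (patch n k).cov m (dz i) q := by
  have hh : ∀ a, IsHol ((patch n k).cov a (dz i)) := fun a => by
    have e : (patch n k).cov a (dz i) = fun m => tau a * dz i m + dz i a * tau m :=
      funext fun m => cov_dz k i a m
    rw [e]
    exact ((isHol_dz i).smul _).add (isHol_tau.smul _)
  have hs : ∀ a b, (patch n k).cov a (dz i) b = (patch n k).cov b (dz i) a := fun a b => by
    rw [cov_dz, cov_dz]; ring
  have h0 : ∑ a, ∑ b, omegaUp k a b * (patch n k).cov a (dz i) b = 0 := by
    have h1 : ∑ a, ∑ b, omegaUp k a b * (patch n k).cov a (dz i) b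
        = pois k tau (dz i) + pois k (dz i) tau := by
      simp only [pois, cov_dz, mul_add, Finset.sum_add_distrib]
    rw [h1, pois_hol_hol k isHol_tau (isHol_dz i), pois_hol_hol k (isHol_dz i) isHol_tau, add_zero]
  have h2 : ∑ a, ∑ b, omegaUp k a b
        * (covForm (patch n k)).R b m ((patch n k).cov a (dz i)) q
      = pois k (fun a => (patch n k).cov a (dz i) q) (fun b => herm m b)
        - pois k (fun a => (patch n k).cov a (dz i) q) (fun b => herm b m)
        + pois k (fun a => (patch n k).cov a (dz i) m) (fun b => herm q b)
        - herm q m * ∑ a, ∑ b, omegaUp k a b * (patch n k).cov a (dz i) b := by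
    simp only [(hh _).R, pois, Finset.mul_sum, ← Finset.sum_add_distrib, ← Finset.sum_sub_distrib]
    exact Finset.sum_congr rfl fun a _ => Finset.sum_congr rfl fun b _ => by ring
  rw [pois_hol_herm k (isHol_cov_dz k i q), pois_hol_herm' k (isHol_cov_dz k i q),
    pois_hol_herm k (isHol_cov_dz k i m), h0, hs q m] at h2
  simp only [curvTerm, patch_poisson, h2]
  linear_combination (imag n * (patch n k).cov m (dz i) q) * half_add_half (A := Smooth n)

theorem curvTerm_dzbar (k : Fin (n + 1)) (i : Fin n) (q m : Idx n) :
    curvTerm (patch n k) (dzbar i) q m = - (imag n * (patch n k).cov m (dzbar i) q) := by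
  have hh : ∀ a, IsAnti ((patch n k).cov a (dzbar i)) := fun a => by
    have e : (patch n k).cov a (dzbar i) = fun m => taubar a * dzbar i m + dzbar i a * taubar m :=
      funext fun m => cov_dzbar k i a m
    rw [e]
    exact ((isAnti_dzbar i).smul _).add (isAnti_taubar.smul _)
  have hs : ∀ a b, (patch n k).cov a (dzbar i) b = (patch n k).cov b (dzbar i) a := fun a b => by
    rw [cov_dzbar, cov_dzbar]; ring
  have h0 : ∑ a, ∑ b, omegaUp k a b * (patch n k).cov a (dzbar i) b = 0 := by
    have h1 : ∑ a, ∑ b, omegaUp k a b * (patch n k).cov a (dzbar i) b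
        = pois k taubar (dzbar i) + pois k (dzbar i) taubar := by
      simp only [pois, cov_dzbar, mul_add, Finset.sum_add_distrib]
    rw [h1, pois_anti_anti k isAnti_taubar (isAnti_dzbar i),
      pois_anti_anti k (isAnti_dzbar i) isAnti_taubar, add_zero]
  have h2 : ∑ a, ∑ b, omegaUp k a b
        * (covForm (patch n k)).R b m ((patch n k).cov a (dzbar i)) q
      = pois k (fun a => (patch n k).cov a (dzbar i) q) (fun b => herm b m)
        - pois k (fun a => (patch n k).cov a (dzbar i) q) (fun b => herm m b)
        + pois k (fun a => (patch n k).cov a (dzbar i) m) (fun b => herm b q)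
        - herm m q * ∑ a, ∑ b, omegaUp k a b * (patch n k).cov a (dzbar i) b := by
    simp only [(hh _).R, pois, Finset.mul_sum, ← Finset.sum_add_distrib, ← Finset.sum_sub_distrib]
    exact Finset.sum_congr rfl fun a _ => Finset.sum_congr rfl fun b _ => by ring
  rw [pois_anti_herm' k (isAnti_cov_dzbar k i q), pois_anti_herm k (isAnti_cov_dzbar k i q),
    pois_anti_herm' k (isAnti_cov_dzbar k i m), h0, hs q m] at h2
  simp only [curvTerm, patch_poisson, h2]
  linear_combination (-(imag n * (patch n k).cov m (dzbar i) q)) * half_add_half (A := Smooth n)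

/-- The symmetric tensor `τ ⊗₁ dz^i + dz^i ⊗₁ τ` is its own symbol: the two corrections cancel. -/
theorem symb₂_tau_dz (k : Fin (n + 1)) (i : Fin n) : (symb₂ (patch n k)).hom
    (QForm.of _ tau ⊗₁ QForm.of _ (dz i) + QForm.of _ (dz i) ⊗₁ QForm.of _ tau)
      = (grad (patch n k) (dz i), 0) := by
  rw [map_add, hom_of_tens, hom_of_tens, Prod.mk_add_mk]
  congr 1
  · ext1 q
    ext1 m
    simp only [Pi.add_apply, tens_apply, smul_eq_mul, grad, Pi.smul_apply, cov_dz]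
    ring
  · ext1 q
    ext1 m
    have h : ∀ m, (fun a => (patch n k).cov a tau m) = fun a => herm m a + tau m * tau a :=
      fun m => funext fun a => by rw [cov_tau]; ring
    rw [Pi.add_apply, Pi.add_apply, corr_apply, corr_apply, h, h,
      pois_antisymm k (fun a => herm m a + tau m * tau a), pois_add_right, pois_add_right,
      pois_smul_right, pois_smul_right, pois_hol_herm k (isHol_cov_dz k i q),
      pois_hol_herm k (isHol_cov_dz k i m), pois_hol_hol k (isHol_cov_dz k i q) isHol_tau,
      pois_hol_hol k (isHol_cov_dz k i m) isHol_tau, cov_dz, cov_dz]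
    change _ = (0 : Smooth n)
    ring

theorem symb₂_taubar_dzbar (k : Fin (n + 1)) (i : Fin n) : (symb₂ (patch n k)).hom
    (QForm.of _ taubar ⊗₁ QForm.of _ (dzbar i) + QForm.of _ (dzbar i) ⊗₁ QForm.of _ taubar)
      = (grad (patch n k) (dzbar i), 0) := by
  rw [map_add, hom_of_tens, hom_of_tens, Prod.mk_add_mk]
  congr 1
  · ext1 q
    ext1 m
    simp only [Pi.add_apply, tens_apply, smul_eq_mul, grad, Pi.smul_apply, cov_dzbar]
    ring
  · ext1 q
    ext1 m
    have h : ∀ m, (fun a => (patch n k).cov a taubar m)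
        = fun a => herm a m + taubar m * taubar a :=
      fun m => funext fun a => by rw [cov_taubar]; ring
    rw [Pi.add_apply, Pi.add_apply, corr_apply, corr_apply, h, h,
      pois_antisymm k (fun a => herm a m + taubar m * taubar a), pois_add_right, pois_add_right,
      pois_smul_right, pois_smul_right, pois_anti_herm' k (isAnti_cov_dzbar k i q),
      pois_anti_herm' k (isAnti_cov_dzbar k i m),
      pois_anti_anti k (isAnti_cov_dzbar k i q) isAnti_taubar,
      pois_anti_anti k (isAnti_cov_dzbar k i m) isAnti_taubar, cov_dzbar, cov_dzbar]
    change _ = (0 : Smooth n)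
    ring

theorem quantConn_dz (k : Fin (n + 1)) (i : Fin n) :
    (quantConn (isParallelPoisson k)).nabla (QForm.of _ (dz i))
      = (1 + QAlg.const (patch n k) I * QAlg.lam (patch n k)) •
        (QForm.of _ tau ⊗₁ QForm.of _ (dz i) + QForm.of _ (dz i) ⊗₁ QForm.of _ tau) := by
  apply (symb₂ (patch n k)).ext
  rw [symb₂_nabla, form_of_fst, form_of_snd, grad_zero, zero_add, add_smul, one_smul,
    const_mul_lam, map_add _ _ (lamAlg _ _ • _), Symbol.lamAlg_smul, symb₂_tau_dz, Prod.mk_add_mk,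
    add_zero, zero_add]
  congr 1
  ext1 q
  ext1 m
  exact curvTerm_dz k i q m

theorem quantConn_dzbar (k : Fin (n + 1)) (i : Fin n) :
    (quantConn (isParallelPoisson k)).nabla (QForm.of _ (dzbar i))
      = (1 - QAlg.const (patch n k) I * QAlg.lam (patch n k)) •
        (QForm.of _ taubar ⊗₁ QForm.of _ (dzbar i)
          + QForm.of _ (dzbar i) ⊗₁ QForm.of _ taubar) := by
  apply (symb₂ (patch n k)).ext
  rw [symb₂_nabla, form_of_fst, form_of_snd, grad_zero, zero_add, sub_smul, one_smul,
    const_mul_lam, map_sub _ _ (lamAlg _ _ • _), Symbol.lamAlg_smul, symb₂_taubar_dzbar,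
    Prod.mk_sub_mk, sub_zero, zero_sub]
  congr 1
  ext1 q
  ext1 m
  exact curvTerm_dzbar k i q m

theorem dFun_coord (k : Fin (n + 1)) (a : Idx n) :
    dFun (patch n k) (coord a) = Pi.single a 1 := by
  ext1 b
  rw [Pi.single_apply]
  exact pd_coord a b

end ProjectiveSpace

end Semiquantum

end

theorem mainTheorem3 (n : ℕ) (k : Fin (n + 1)) :
    -- the quantum metric
    (quantumMetric (CPn.patch n k) (CPn.metric k)
      = (∑ i, ∑ j, QForm.of (CPn.patch n k) (CPn.gBar i j • CPn.dz i)
            ⊗₁ QForm.of (CPn.patch n k) (CPn.dzbar j))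
        + (∑ i, ∑ j, QForm.of (CPn.patch n k) (CPn.gBar i j • CPn.dzbar j)
            ⊗₁ QForm.of (CPn.patch n k) (CPn.dz i))
        - (QAlg.const (CPn.patch n k) (((n : ℂ) + 1) / 2) * QAlg.lam (CPn.patch n k)) •
            CPn.varpiTilde k) ∧
    -- it is quantum symmetric
    qWedge (CPn.patch n k) (quantumMetric (CPn.patch n k) (CPn.metric k)) = 0 ∧
    -- the generalised Ricci two-form, which is covariantly constant
    genRicci (CPn.patch n k) (CPn.metric k) = (((n : ℂ) + 1) / 2) • CPn.varpi k ∧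
    (∀ s, (CPn.patch n k).cov₂ s (genRicci (CPn.patch n k) (CPn.metric k)) = 0) ∧
    -- the connection `∇_Q` exists, is the quantum Levi-Civita connection, and is given on `dz^i_±`
    ∃ D : BimoduleConnection (qd (CPn.patch n k)),
      (∀ D', IsNablaQ (CPn.patch n k) D' ↔ D' = D) ∧
      (∀ D', IsQuantumLeviCivita (CPn.patch n k) D'
          (quantumMetric (CPn.patch n k) (CPn.metric k)) ↔ D' = D) ∧
      (∀ i, D.nabla (QForm.of _ (CPn.dz i))
        = (1 + QAlg.const (CPn.patch n k) Complex.I * QAlg.lam (CPn.patch n k)) •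
          (QForm.of _ CPn.tau ⊗₁ QForm.of _ (CPn.dz i)
            + QForm.of _ (CPn.dz i) ⊗₁ QForm.of _ CPn.tau)) ∧
      (∀ i, D.nabla (QForm.of _ (CPn.dzbar i))
        = (1 - QAlg.const (CPn.patch n k) Complex.I * QAlg.lam (CPn.patch n k)) •
          (QForm.of _ CPn.taubar ⊗₁ QForm.of _ (CPn.dzbar i)
            + QForm.of _ (CPn.dzbar i) ⊗₁ QForm.of _ CPn.taubar)) := by
  refine ⟨Semiquantum.quantumMetric_eq k,
    Semiquantum.qWedge_quantumMetric (Semiquantum.isParallelPoisson k)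
      (Semiquantum.metric_symm k) (Semiquantum.cov₂_metric k),
    Semiquantum.genRicci_eq k, Semiquantum.cov₂_genRicci k,
    Semiquantum.quantConn (Semiquantum.isParallelPoisson k), fun D' => ⟨fun h => ?_, ?_⟩,
    fun D' => ⟨fun h => ?_, ?_⟩, Semiquantum.quantConn_dz k, Semiquantum.quantConn_dzbar k⟩
  · exact Semiquantum.isNablaQ_unique (Semiquantum.dFun_coord k)
      (Semiquantum.quantConn_isNablaQ _) h
  · rintro rfl
    exact Semiquantum.quantConn_isNablaQ _
  · exact Semiquantum.quantumLeviCivita_unique (Semiquantum.isParallelPoisson k)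
      (Semiquantum.dFun_coord k) (Semiquantum.metric_symm k)
      (Semiquantum.sum_metricInv_metric k)
      (congrArg Prod.fst (Semiquantum.symb₂_quantumMetric (Semiquantum.isParallelPoisson k)
        (Semiquantum.metric_symm k) (Semiquantum.cov₂_metric k)))
      (Semiquantum.quantConn_isQuantumLeviCivita _ (Semiquantum.metric_symm k)
        (Semiquantum.cov₂_metric k) (Semiquantum.cov₂_genRicci k)) h
  · rintro rfl
    exact Semiquantum.quantConn_isQuantumLeviCivita _ (Semiquantum.metric_symm k)
      (Semiquantum.cov₂_metric k) (Semiquantum.cov₂_genRicci k)
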